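/- Let $D\in\{2,3\}$, let $\Omega=\prod_{i=1}^D(0,L_i)$ with $L_i>0$, and let $H^m_{\rm per}(\Omega)$ denote the Sobolev space of real $\Omega$-periodic functions with square-integrable weak derivatives up to order $m$. Write $(\cdot,\cdot)$ for the $L^2(\Omega)$ inner product. Let $\varepsilon>0$, $A\ge 1$ and $\eta\ge-\varepsilon^{-2}$ (in particular any $\eta>0$), let $M:\mathbb R\to(0,\infty)$ be continuous, and for $\phi\in H^2_{\rm per}(\Omega)$ set $$\mathcal F(\phi)=\frac{\varepsilon^{-2}}2\int_\Omega\big(\phi^3-\phi-\varepsilon^2\Delta\phi\big)^2\,dx-\eta\int_\Omega\Big(\tfrac14\phi^4-\tfrac12\phi^2+\tfrac{\varepsilon^2}2|\nabla\phi|^2\Big)dx .$$ Consider the semi-discrete convex-splitting scheme $\phi^{k+1}-\phi^k=s\,\nabla\cdot\big(M(\phi^k)\nabla\tilde\mu\big)$ with $$\begin{aligned}\tilde\mu={}&3\varepsilon^{-2}(\phi^{k+1})^5+4A(\phi^{k+1})^3+(\varepsilon^{-2}+\eta)\phi^{k+1}+\varepsilon^2\Delta^2\phi^{k+1}+6\phi^{k+1}|\nabla\phi^{k+1}|^2\\&-6\nabla\cdot\big((\phi^{k+1})^2\nabla\phi^{k+1}\big)-4A\nabla\cdot\big(|\nabla\phi^{k+1}|^2\nabla\phi^{k+1}\big)\\&-(4\varepsilon^{-2}+\eta)(\phi^k)^3+(2+\eta\varepsilon^2)\Delta\phi^k-4A(\phi^k)^3+4A\nabla\cdot\big(|\nabla\phi^k|^2\nabla\phi^k\big),\end{aligned}$$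 understood in the following weak sense: given $g=\phi^k\in H^2_{\rm per}(\Omega)$, find $(\phi,\mu)=(\phi^{k+1},\tilde\mu)\in H^2_{\rm per}(\Omega)\times H^1_{\rm per}(\Omega)$ such that for all $\nu\in H^1_{\rm per}(\Omega)$ and $\psi\in H^2_{\rm per}(\Omega)$ $$(\phi,\nu)+s\,(M(g)\nabla\mu,\nabla\nu)=(g,\nu),$$ $$\begin{aligned}&\big(3\varepsilon^{-2}\phi^5+4A\phi^3+(\varepsilon^{-2}+\eta)\phi,\psi\big)+\varepsilon^2(\Delta\phi,\Delta\psi)+6(\phi|\nabla\phi|^2,\psi)+6(\phi^2\nabla\phi,\nabla\psi)+4A(|\nabla\phi|^2\nabla\phi,\nabla\psi)-(\mu,\psi)\\&\qquad=\big((4\varepsilon^{-2}+\eta)g^3+4Ag^3,\psi\big)+(2+\eta\varepsilon^2)(\nabla g,\nabla\psi)+4A(|\nabla g|^2\nabla g,\nabla\psi).\end{aligned}$$ Then, for every time step $s>0$ and every $\phi^k\in H^2_{\rm per}(\Omega)$, there is exactly one solution $(\phi^{k+1},\tilde\mu)\in H^2_{\rm per}(\Omega)\times H^1_{\rm per}(\Omega)$.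 In particular $\phi^{k+1}\in H^2_{\rm per}(\Omega)$, and the energy does not increase: $\mathcal F(\phi^{k+1})\le\mathcal F(\phi^k)$. -/

import Mathlib

open MeasureTheory
open scoped ContDiff

namespace FCH

/-- Lebesgue measure on the box `Ω = ∏ i, (0, L i)`. -/
noncomputable def boxMeasure {D : ℕ} (L : Fin D → ℝ) : Measure (Fin D → ℝ) :=
  volume.restrict (Set.univ.pi fun i => Set.Ioo 0 (L i))

/-- The real Hilbert space `L²(Ω)` (its elements are classes of functions modulo a.e. equality). -/
abbrev L2Box {D : ℕ} (L : Fin D → ℝ) : Type := Lp ℝ 2 (boxMeasure L)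

/-- `χ ∈ C^∞_per`: smooth on `ℝ^D` and `L i`-periodic in the `i`-th variable. -/
structure IsSmoothPeriodic {D : ℕ} (L : Fin D → ℝ) (χ : (Fin D → ℝ) → ℝ) : Prop where
  smooth : ContDiff ℝ ∞ χ
  periodic : ∀ i x, χ (x + Pi.single i (L i)) = χ x

/-- `v` is the weak `i`-th partial derivative of the periodic function `u`:
`∫_Ω u ∂ᵢχ = - ∫_Ω v χ` for every smooth periodic `χ`. The test functions need not vanish near
`∂Ω`, so that the relation encodes the periodic boundary conditions. -/
def HasWeakPartial {D : ℕ} (L : Fin D → ℝ) (i : Fin D) (u v : L2Box L) : Prop :=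
  ∀ χ : (Fin D → ℝ) → ℝ, IsSmoothPeriodic L χ →
    ∫ x, u x * fderiv ℝ χ x (Pi.single i 1) ∂(boxMeasure L) = -∫ x, v x * χ x ∂(boxMeasure L)

open Classical in
/-- The weak partial derivative `∂ᵢ u ∈ L²(Ω)`; the default value `0` is used only if there is
none. -/
noncomputable def weakPartial {D : ℕ} (L : Fin D → ℝ) (i : Fin D) (u : L2Box L) : L2Box L :=
  if h : ∃ v, HasWeakPartial L i u v then h.choose else 0

/-- `u ∈ H¹_per(Ω)`. -/
def MemH1per {D : ℕ} (L : Fin D → ℝ) (u : L2Box L) : Prop :=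
  ∀ i, ∃ v, HasWeakPartial L i u v

/-- `u ∈ H²_per(Ω)`: `u` and all its first weak derivatives are in `H¹_per(Ω)`. -/
def MemH2per {D : ℕ} (L : Fin D → ℝ) (u : L2Box L) : Prop :=
  MemH1per L u ∧ ∀ i, MemH1per L (weakPartial L i u)

/-- The pointwise product `∇u · ∇v`. -/
noncomputable def gradDot {D : ℕ} (L : Fin D → ℝ) (u v : L2Box L) (x : Fin D → ℝ) : ℝ :=
  ∑ i, weakPartial L i u x * weakPartial L i v x

/-- The pointwise value `|∇u|²`. -/
noncomputable def gradSq {D : ℕ} (L : Fin D → ℝ) (u : L2Box L) (x : Fin D → ℝ) : ℝ :=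
  gradDot L u u x

/-- The Laplacian `Δu`. -/
noncomputable def laplacian {D : ℕ} (L : Fin D → ℝ) (u : L2Box L) : L2Box L :=
  ∑ i, weakPartial L i (weakPartial L i u)

/-- The Cahn-Hilliard energy `F₀(φ) = ∫_Ω φ⁴/4 - φ²/2 + (ε²/2) |∇φ|²`. -/
noncomputable def energyCH {D : ℕ} (L : Fin D → ℝ) (ε : ℝ) (φ : L2Box L) : ℝ :=
  ∫ x, (1 / 4 * φ x ^ 4 - 1 / 2 * φ x ^ 2 + ε ^ 2 / 2 * gradSq L φ x) ∂(boxMeasure L)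

/-- The functionalized Cahn-Hilliard energy `F(φ) = (ε⁻²/2) ∫_Ω μ₀² - η F₀(φ)`, where
`μ₀ = φ³ - φ - ε² Δφ`. -/
noncomputable def energyFCH {D : ℕ} (L : Fin D → ℝ) (ε η : ℝ) (φ : L2Box L) : ℝ :=
  (ε ^ 2)⁻¹ / 2 * ∫ x, (φ x ^ 3 - φ x - ε ^ 2 * laplacian L φ x) ^ 2 ∂(boxMeasure L)
    - η * energyCH L ε φ

/-- The implicit part `⟨δF_c(φ), ψ⟩` of the chemical potential, in weak form. -/
noncomputable def implicitPart {D : ℕ} (L : Fin D → ℝ) (ε η A : ℝ) (φ ψ : L2Box L) : ℝ :=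
  ∫ x, (3 * (ε ^ 2)⁻¹ * φ x ^ 5 + 4 * A * φ x ^ 3 + ((ε ^ 2)⁻¹ + η) * φ x) * ψ x ∂(boxMeasure L)
    + ε ^ 2 * ∫ x, laplacian L φ x * laplacian L ψ x ∂(boxMeasure L)
    + 6 * ∫ x, φ x * gradSq L φ x * ψ x ∂(boxMeasure L)
    + 6 * ∫ x, φ x ^ 2 * gradDot L φ ψ x ∂(boxMeasure L)
    + 4 * A * ∫ x, gradSq L φ x * gradDot L φ ψ x ∂(boxMeasure L)

/-- The explicit part `⟨δF_e(g), ψ⟩` of the chemical potential, in weak form, that is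
`⟨(4ε⁻² + η) g³ - (2 + ηε²) Δg + 4A g³ - 4A ∇·(|∇g|² ∇g), ψ⟩`. -/
noncomputable def explicitPart {D : ℕ} (L : Fin D → ℝ) (ε η A : ℝ) (g ψ : L2Box L) : ℝ :=
  ∫ x, ((4 * (ε ^ 2)⁻¹ + η) * g x ^ 3 + 4 * A * g x ^ 3) * ψ x ∂(boxMeasure L)
    + (2 + η * ε ^ 2) * ∫ x, gradDot L g ψ x ∂(boxMeasure L)
    + 4 * A * ∫ x, gradSq L g x * gradDot L g ψ x ∂(boxMeasure L)

/-- One step of the convex splitting scheme in weak form: `φ = φ^{k+1}` and the chemical potential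
`μ` are computed from `g = φ^k` with time step `s` and mobility `M(φ^k)`. -/
structure IsSchemeStep {D : ℕ} (L : Fin D → ℝ) (ε η A s : ℝ) (M : ℝ → ℝ)
    (g φ μ : L2Box L) : Prop where
  massBalance : ∀ ν : L2Box L, MemH1per L ν →
    ∫ x, φ x * ν x ∂(boxMeasure L) + s * ∫ x, M (g x) * gradDot L μ ν x ∂(boxMeasure L)
      = ∫ x, g x * ν x ∂(boxMeasure L)
  potential : ∀ ψ : L2Box L, MemH2per L ψ →
    implicitPart L ε η A φ ψ - ∫ x, μ x * ψ x ∂(boxMeasure L) = explicitPart L ε η A g ψ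

end FCH

/-!
The scheme is a convex splitting: on `H²_per(Ω)` the energy is a difference
`F = F_c - F_e` of two convex functionals (`MemH2per.energyFCH_eq`), with densities
`ε⁻²/2 φ⁶ + A φ⁴ + (ε⁻² + η)/2 φ² + 3 φ² |∇φ|² + A |∇φ|⁴ + ε²/2 |Δφ|²` and
`(ε⁻² + η/4 + A) φ⁴ + (1 + ηε²/2) |∇φ|² + A |∇φ|⁴`. The implicit and the explicit part of the
chemical potential are the differentials of `F_c` at the new state and of `F_e` at the old one. The
only term of doubtful convexity is `3 φ² |∇φ|²`; it is absorbed by the quartic terms as `A ≥ 1`,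
because `a⁴ + 3 a² r² + r⁴ = ((a + r)⁴ + (a - r)⁴) / 4 + (a⁴ + r⁴) / 2` (`quartic_tangent`).
Convexity is used throughout in the form of tangent inequalities between functionals
(`convexEnergy_tangent`, `explicitEnergy_tangent`), the former with a surplus `ε²/2 ‖Δh‖²` for an
increment `h`.

*Energy decay* (`IsSchemeStep.energy_le`). The tangents of `F_c` at the new state and of `F_e` at
the old one give `F(φ) - F(g) ≤ (μ, φ - g)`, and testing the mass balance with `μ` identifies the
right-hand side with `-s (M(g) ∇μ, ∇μ) ≤ 0`.

*Uniqueness* (`IsSchemeStep.unique`). The increments `d` of the state and `m` of the potential of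
two solutions satisfy `(d, m) ≤ 0` by the mass balance and `ε² ‖Δd‖² ≤ (d, m)` by strong
monotonicity of the differential of `F_c`. As `d` has mean zero, `d = 0`, and `m` is then orthogonal
to the dense subspace `H²_per(Ω)`.

*Existence* (`exists_isSchemeStep`). For `x` of mean zero let `W x` be the mean zero solution of the
weighted Laplace problem `s ∇·(M(g) ∇w) = x` (`exists_mobilityForm_solution`). A critical point `x`
of `F_c(g + x) - ⟨F_e'(g), x⟩ + s/2 (M(g) ∇(W x), ∇(W x))` among the functions of mean zero in
`H²_per(Ω)` solves the scheme with `φ = g + x` and `μ = W x + κ`, where the constant `κ` is the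
Lagrange multiplier of the mass constraint. Both the weighted Laplace problem and this problem are
solved by `exists_critical_point`, an abstract minimisation result which replaces weak compactness
by strong convexity: minimising sequences are Cauchy.

The analysis rests on the Fourier basis of the box (`modeBasis`). Weak derivatives act on Fourier
coefficients as multipliers (`HasWeakPartial.coef`), which gives their uniqueness, the Poincaré
inequality and the bounds of second derivatives by the Laplacian. The Fourier coefficients of a
function in `H²` are absolutely summable for `D ≤ 3`, so that it is bounded; an integration by parts
in `∫ (∂ᵢu)⁴` then puts its gradient into `L⁴` (`exists_sobolev_bound`). These two embeddings make
all integrals above finite.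
-/

namespace FCH

variable {D : ℕ} {L : Fin D → ℝ}

/-! ### The Fourier basis of the box -/

/-- The Haar probability measure of the torus `(ℝ/ℤ)^D`. -/
noncomputable abbrev torusMeasure (D : ℕ) : Measure (UnitAddTorus (Fin D)) :=
  Measure.pi fun _ => (AddCircle.haarAddCircle : Measure UnitAddCircle)

/-- The covering map from `ℝ^D` to the torus `(ℝ/ℤ)^D` which rescales the box to a unit cube. -/
noncomputable def toTorus (L : Fin D → ℝ) (x : Fin D → ℝ) : UnitAddTorus (Fin D) :=
  fun i => ((x i * (L i)⁻¹ : ℝ) : UnitAddCircle)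

/-- The volume of the box. -/
noncomputable def boxVolume (L : Fin D → ℝ) : ℝ := ∏ i, L i

lemma boxVolume_pos (hL : ∀ i, 0 < L i) : 0 < boxVolume L :=
  Finset.prod_pos fun i _ => hL i

lemma boxMeasure_eq_pi (L : Fin D → ℝ) :
    boxMeasure L = Measure.pi fun i => (volume : Measure ℝ).restrict (Set.Ioo 0 (L i)) := by
  rw [boxMeasure, volume_pi, Measure.restrict_pi_pi]

instance : IsFiniteMeasure (boxMeasure L) := by
  rw [boxMeasure_eq_pi]; infer_instance

lemma measurePreserving_toCircle {l : ℝ} (hl : 0 < l) :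
    MeasurePreserving (fun x : ℝ => ((x * l⁻¹ : ℝ) : UnitAddCircle))
      (volume.restrict (Set.Ioo 0 l)) (ENNReal.ofReal l • AddCircle.haarAddCircle) := by
  have h1 : MeasurePreserving (fun x : ℝ => x * l⁻¹) (volume.restrict (Set.Ioo 0 l))
      (ENNReal.ofReal l • (volume : Measure ℝ).restrict (Set.Ioc 0 (0 + 1))) := by
    refine ⟨by fun_prop, ?_⟩
    have hpre : (fun x : ℝ => x * l⁻¹) ⁻¹' Set.Ioc 0 (0 + 1) = Set.Ioc 0 l := by
      ext x
      simp only [Set.mem_preimage, Set.mem_Ioc, zero_add, ← div_eq_mul_inv,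
        div_pos_iff_of_pos_right hl,
        div_le_one hl]
    rw [← Measure.restrict_smul, restrict_Ioo_eq_restrict_Ioc, ← hpre,
      ← Measure.restrict_map (by fun_prop) measurableSet_Ioc,
      Real.map_volume_mul_right (inv_ne_zero hl.ne'), inv_inv, abs_of_pos hl]
  have h2 : MeasurePreserving (fun x : ℝ => (x : UnitAddCircle))
      ((volume : Measure ℝ).restrict (Set.Ioc 0 (0 + 1))) AddCircle.haarAddCircle := by
    have := UnitAddCircle.measurePreserving_mk 0
    rwa [AddCircle.volume_eq_smul_haarAddCircle, ENNReal.ofReal_one, one_smul] at this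
  exact (h2.smul_measure _).comp h1

lemma measurePreserving_toTorus (hL : ∀ i, 0 < L i) :
    MeasurePreserving (toTorus L) (boxMeasure L)
      (ENNReal.ofReal (boxVolume L) • torusMeasure D) := by
  have : ∀ i, IsFiniteMeasure
      (ENNReal.ofReal (L i) • (AddCircle.haarAddCircle : Measure UnitAddCircle)) :=
    fun i => Measure.smul_finite _ ENNReal.ofReal_ne_top
  have h := measurePreserving_pi (fun i => (volume : Measure ℝ).restrict (Set.Ioo 0 (L i)))
    (fun i => ENNReal.ofReal (L i) • (AddCircle.haarAddCircle : Measure UnitAddCircle))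
    (fun i => measurePreserving_toCircle (hL i))
  rw [← boxMeasure_eq_pi] at h
  have h2 : Measure.pi
      (fun i => ENNReal.ofReal (L i) • (AddCircle.haarAddCircle : Measure UnitAddCircle))
      = ENNReal.ofReal (boxVolume L) • torusMeasure D := by
    refine Measure.pi_eq fun s hs => ?_
    simp only [Measure.smul_apply, torusMeasure, smul_eq_mul, Measure.pi_pi,
      Finset.prod_mul_distrib, boxVolume]
    rw [ENNReal.ofReal_prod_of_nonneg fun i _ => (hL i).le]
  rw [← h2]
  exact h

lemma integral_toTorus (hL : ∀ i, 0 < L i) {E : Type*} [NormedAddCommGroup E] [NormedSpace ℝ E]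
    {G : UnitAddTorus (Fin D) → E} (hG : AEStronglyMeasurable G (torusMeasure D)) :
    ∫ x, G (toTorus L x) ∂(boxMeasure L) = boxVolume L • ∫ t, G t ∂(torusMeasure D) := by
  have h := measurePreserving_toTorus hL
  rw [← integral_map h.measurable.aemeasurable, h.map_eq, integral_smul_measure,
    ENNReal.toReal_ofReal (boxVolume_pos hL).le]
  rw [h.map_eq]
  exact hG.smul_measure _

/-- The angular frequency `2π kⱼ / Lⱼ`. -/
noncomputable def freq (L : Fin D → ℝ) (k : Fin D → ℤ) (j : Fin D) : ℝ :=
  2 * Real.pi * k j / L j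

/-- The phase `∑ⱼ (2π kⱼ / Lⱼ) xⱼ` of the `k`-th Fourier mode. -/
noncomputable def phase (L : Fin D → ℝ) (k : Fin D → ℤ) (x : Fin D → ℝ) : ℝ :=
  ∑ j, freq L k j * x j

/-- The normalised Fourier mode `|Ω|^(-1/2) exp(i ∑ⱼ (2π kⱼ / Lⱼ) xⱼ)`. -/
noncomputable def mode (L : Fin D → ℝ) (k : Fin D → ℤ) (x : Fin D → ℝ) : ℂ :=
  ((Real.sqrt (boxVolume L))⁻¹ : ℝ) * Complex.exp (phase L k x * Complex.I)

lemma mode_eq (L : Fin D → ℝ) (k : Fin D → ℤ) (x : Fin D → ℝ) :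
    mode L k x = ((Real.sqrt (boxVolume L))⁻¹ : ℝ) * UnitAddTorus.mFourier k (toTorus L x) := by
  simp only [mode, UnitAddTorus.mFourier, toTorus, ContinuousMap.coe_mk, fourier_coe_apply,
    ← Complex.exp_sum, phase, freq]
  congr 2
  push_cast
  rw [Finset.sum_mul]
  refine Finset.sum_congr rfl fun i _ => ?_
  simp only [div_eq_mul_inv, inv_one]
  ring

lemma continuous_mode (L : Fin D → ℝ) (k : Fin D → ℤ) : Continuous (mode L k) := by
  unfold mode phase
  fun_prop

lemma norm_mode (L : Fin D → ℝ) (k : Fin D → ℤ) (x : Fin D → ℝ) :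
    ‖mode L k x‖ = (Real.sqrt (boxVolume L))⁻¹ := by
  rw [mode, norm_mul, Complex.norm_exp_ofReal_mul_I, mul_one, Complex.norm_real, Real.norm_eq_abs,
    abs_of_nonneg (by positivity)]

lemma memLp_mode (L : Fin D → ℝ) (k : Fin D → ℤ) : MemLp (mode L k) 2 (boxMeasure L) :=
  MemLp.of_bound (continuous_mode L k).aestronglyMeasurable _
    (Filter.Eventually.of_forall fun x => (norm_mode L k x).le)

/-- The Fourier mode as an element of the complex `L²` space. -/
noncomputable def modeLp (L : Fin D → ℝ) (k : Fin D → ℤ) : Lp ℂ 2 (boxMeasure L) :=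
  (memLp_mode L k).toLp _

lemma inner_modeLp (k : Fin D → ℤ) (f : Lp ℂ 2 (boxMeasure L)) :
    inner ℂ (modeLp L k) f = ∫ x, (starRingEnd ℂ) (mode L k x) * f x ∂(boxMeasure L) := by
  rw [L2.inner_def]
  refine integral_congr_ae ?_
  filter_upwards [(memLp_mode L k).coeFn_toLp] with x hx
  rw [RCLike.inner_apply, modeLp, hx, mul_comm]

lemma orthonormal_modeLp (hL : ∀ i, 0 < L i) : Orthonormal ℂ (modeLp L) := by
  rw [orthonormal_iff_ite]
  intro m n
  have h0 := (orthonormal_iff_ite.mp (UnitAddTorus.orthonormal_mFourier (d := Fin D))) m n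
  have hV := boxVolume_pos hL
  rw [ContinuousMap.inner_toLp] at h0
  rw [← h0, inner_modeLp]
  set G : UnitAddTorus (Fin D) → ℂ := fun t => ((boxVolume L)⁻¹ : ℝ) •
    ((UnitAddTorus.mFourier n t) * (starRingEnd ℂ) (UnitAddTorus.mFourier m t)) with hG
  have : ∀ᵐ x ∂(boxMeasure L), (starRingEnd ℂ) (mode L m x) * modeLp L n x =
      G (toTorus L x) := by
    filter_upwards [(memLp_mode L n).coeFn_toLp] with x hx
    rw [modeLp, hx, mode_eq, mode_eq, map_mul, Complex.conj_ofReal]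
    simp only [hG, Complex.real_smul]
    have : ((boxVolume L)⁻¹ : ℝ) = ((Real.sqrt (boxVolume L))⁻¹ : ℝ)
        * ((Real.sqrt (boxVolume L))⁻¹ : ℝ) := by
      rw [← mul_inv, Real.mul_self_sqrt hV.le]
    rw [this]
    push_cast
    ring
  rw [integral_congr_ae this, integral_toTorus hL, hG, integral_smul, smul_smul,
    mul_inv_cancel₀ hV.ne', one_smul]
  · rfl
  · exact Continuous.aestronglyMeasurable (by fun_prop)

/-- The section of `toTorus L` with values in `∏ i, (0, L i]`. -/
noncomputable def ofTorus (L : Fin D → ℝ) (t : UnitAddTorus (Fin D)) : Fin D → ℝ :=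
  fun i => (AddCircle.measurableEquivIoc 1 0 (t i) : ℝ) * L i

lemma measurable_ofTorus (L : Fin D → ℝ) : Measurable (ofTorus L) := by
  unfold ofTorus
  refine measurable_pi_lambda _ fun i => ?_
  exact (measurable_subtype_coe.comp
    ((AddCircle.measurableEquivIoc 1 0).measurable.comp (measurable_pi_apply i))).mul_const _

lemma ae_mem_box (L : Fin D → ℝ) :
    ∀ᵐ x ∂(boxMeasure L), x ∈ Set.univ.pi fun i => Set.Ioo 0 (L i) :=
  ae_restrict_mem (MeasurableSet.univ_pi fun _ => measurableSet_Ioo)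

lemma ofTorus_toTorus (hL : ∀ i, 0 < L i) {x : Fin D → ℝ}
    (hx : x ∈ Set.univ.pi fun i => Set.Ioo 0 (L i)) : ofTorus L (toTorus L x) = x := by
  funext i
  have hi := hx i (Set.mem_univ i)
  have hmem : x i * (L i)⁻¹ ∈ Set.Ioc (0 : ℝ) (0 + 1) := by
    rw [← div_eq_mul_inv, Set.mem_Ioc, zero_add, div_le_one (hL i)]
    exact ⟨div_pos hi.1 (hL i), hi.2.le⟩
  have : AddCircle.measurableEquivIoc 1 0 ((x i * (L i)⁻¹ : ℝ) : UnitAddCircle)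
      = ⟨x i * (L i)⁻¹, hmem⟩ := Subtype.ext (AddCircle.equivIoc_coe_of_mem hmem)
  rw [ofTorus, toTorus, this, inv_mul_cancel_right₀ (hL i).ne']

/-- A square-integrable function on the box orthogonal to every mode vanishes: rescaled to the
torus it is orthogonal to the Fourier basis of the torus. -/
lemma eq_zero_of_inner_modeLp (hL : ∀ i, 0 < L i) (f : Lp ℂ 2 (boxMeasure L))
    (hf : ∀ k, inner ℂ (modeLp L k) f = 0) : f = 0 := by
  have hmp := measurePreserving_toTorus hL
  have hV := boxVolume_pos hL
  have hV' : ENNReal.ofReal (boxVolume L) ≠ 0 := by simpa using hV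
  set F : UnitAddTorus (Fin D) → ℂ := fun t => f (ofTorus L t) with hF
  have hFm : StronglyMeasurable F :=
    (Lp.stronglyMeasurable f).comp_measurable (measurable_ofTorus L)
  have hFq : (fun x => F (toTorus L x)) =ᵐ[boxMeasure L] f := by
    filter_upwards [ae_mem_box L] with x hx
    rw [hF]
    simp only [ofTorus_toTorus hL hx]
  have hFL : MemLp F 2 (torusMeasure D) := by
    have h1 : MemLp F 2 (ENNReal.ofReal (boxVolume L) • torusMeasure D) := by
      rw [← hmp.map_eq, memLp_map_measure_iff hFm.aestronglyMeasurable hmp.measurable.aemeasurable]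
      exact (memLp_congr_ae hFq).2 (Lp.memLp f)
    have h2 := h1.smul_measure (c := (ENNReal.ofReal (boxVolume L))⁻¹) (by simpa using hV)
    rwa [smul_smul, ENNReal.inv_mul_cancel hV' ENNReal.ofReal_ne_top, one_smul] at h2
  have hz : hFL.toLp F = 0 := by
    refine (UnitAddTorus.mFourierBasis (d := Fin D)).repr.injective ?_
    rw [map_zero]
    ext k
    rw [UnitAddTorus.mFourierBasis_repr]
    have h1 : UnitAddTorus.mFourierCoeff (hFL.toLp F) k
        = ∫ t, (starRingEnd ℂ) (UnitAddTorus.mFourier k t) * F t ∂(torusMeasure D) := by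
      rw [UnitAddTorus.mFourierCoeff]
      refine integral_congr_ae ?_
      filter_upwards [hFL.coeFn_toLp] with t ht
      rw [ht, UnitAddTorus.mFourier_neg, smul_eq_mul]
    have h2 := hf k
    rw [inner_modeLp] at h2
    set G : UnitAddTorus (Fin D) → ℂ := fun t => ((Real.sqrt (boxVolume L))⁻¹ : ℝ) •
      ((starRingEnd ℂ) (UnitAddTorus.mFourier k t) * F t) with hG
    have h3 : ∀ᵐ x ∂(boxMeasure L), (starRingEnd ℂ) (mode L k x) * f x = G (toTorus L x) := by
      filter_upwards [hFq] with x hx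
      simp only [hG, hx]
      rw [mode_eq, map_mul, Complex.conj_ofReal, Complex.real_smul, mul_assoc]
    rw [integral_congr_ae h3, integral_toTorus hL, hG, integral_smul, smul_smul] at h2
    · rw [h1]
      refine (smul_eq_zero.1 h2).resolve_left ?_
      positivity
    · have hc : Continuous fun t : UnitAddTorus (Fin D) =>
          (starRingEnd ℂ) (UnitAddTorus.mFourier k t) := by fun_prop
      exact (hc.aestronglyMeasurable.mul hFm.aestronglyMeasurable).const_smul
        ((Real.sqrt (boxVolume L))⁻¹)
  have hF0 : F =ᵐ[torusMeasure D] 0 :=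
    hFL.coeFn_toLp.symm.trans (hz ▸ Lp.coeFn_zero ℂ 2 (torusMeasure D))
  have hF1 : F =ᵐ[(boxMeasure L).map (toTorus L)] 0 := by
    rw [hmp.map_eq]
    exact Measure.ae_smul_measure hF0 _
  have hF2 := ae_of_ae_map hmp.measurable.aemeasurable hF1
  rw [Lp.eq_zero_iff_ae_eq_zero]
  filter_upwards [hFq, hF2] with x h1 h2
  rw [← h1]
  exact h2

/-- The Fourier basis of the complex `L²` space of the box. -/
noncomputable def modeBasis (hL : ∀ i, 0 < L i) :
    HilbertBasis (Fin D → ℤ) ℂ (Lp ℂ 2 (boxMeasure L)) :=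
  HilbertBasis.mkOfOrthogonalEqBot (orthonormal_modeLp hL) <| by
    rw [Submodule.eq_bot_iff]
    intro f hf
    refine eq_zero_of_inner_modeLp hL f fun k => ?_
    exact Submodule.mem_orthogonal _ _ |>.1 hf _ (Submodule.subset_span ⟨k, rfl⟩)

lemma modeBasis_apply (hL : ∀ i, 0 < L i) (k : Fin D → ℤ) : modeBasis hL k = modeLp L k := by
  rw [modeBasis, HilbertBasis.coe_mkOfOrthogonalEqBot]

/-! ### Fourier coefficients of real functions -/

/-- The Fourier coefficient `∫_Ω u(x) conj(e_k(x)) dx` of a real function, as a bounded real-linear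
functional with complex values. -/
noncomputable def coef (L : Fin D → ℝ) (k : Fin D → ℤ) : L2Box L →L[ℝ] ℂ :=
  ((innerSL ℂ (modeLp L k)).restrictScalars ℝ).comp
    (Complex.ofRealCLM.compLpL 2 (boxMeasure L))

lemma coef_apply (k : Fin D → ℤ) (u : L2Box L) :
    coef L k u = inner ℂ (modeLp L k) (Complex.ofRealCLM.compLpL 2 (boxMeasure L) u) := rfl

lemma coef_eq_integral (k : Fin D → ℤ) (u : L2Box L) :
    coef L k u = ∫ x, (starRingEnd ℂ) (mode L k x) * (u x : ℂ) ∂(boxMeasure L) := by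
  rw [coef_apply, inner_modeLp]
  refine integral_congr_ae ?_
  filter_upwards [Complex.ofRealCLM.coeFn_compLpL (p := 2) u] with x hx
  rw [hx, Complex.ofRealCLM_apply]

/-- The inclusion of the real into the complex `L²` space is isometric. -/
lemma norm_complexify (u : L2Box L) :
    ‖Complex.ofRealCLM.compLpL 2 (boxMeasure L) u‖ = ‖u‖ := by
  refine le_antisymm (Lp.norm_le_norm_of_ae_le ?_) (Lp.norm_le_norm_of_ae_le ?_) <;>
  · filter_upwards [Complex.ofRealCLM.coeFn_compLpL (p := 2) u] with x hx
    rw [hx, Complex.ofRealCLM_apply, Complex.norm_real]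

lemma hasSum_coef_smul (hL : ∀ i, 0 < L i) (u : L2Box L) :
    HasSum (fun k => coef L k u • modeLp L k) (Complex.ofRealCLM.compLpL 2 (boxMeasure L) u) := by
  have h := (modeBasis hL).hasSum_repr (Complex.ofRealCLM.compLpL 2 (boxMeasure L) u)
  simpa only [HilbertBasis.repr_apply_apply, modeBasis_apply, ← coef_apply] using h

/-- Parseval's identity. -/
lemma hasSum_normSq_coef (hL : ∀ i, 0 < L i) (u : L2Box L) :
    HasSum (fun k => ‖coef L k u‖ ^ 2) (‖u‖ ^ 2) := by
  have h := (modeBasis hL).hasSum_inner_mul_inner (Complex.ofRealCLM.compLpL 2 (boxMeasure L) u)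
    (Complex.ofRealCLM.compLpL 2 (boxMeasure L) u)
  have h2 := RCLike.hasSum_re ℂ h
  rw [inner_self_eq_norm_sq, norm_complexify] at h2
  refine h2.congr_fun fun k => ?_
  rw [modeBasis_apply, ← coef_apply, ← inner_conj_symm, ← coef_apply]
  simp only [RCLike.re_to_complex, Complex.conj_mul', ← Complex.ofReal_pow, Complex.ofReal_re]

lemma eq_of_coef_eq (hL : ∀ i, 0 < L i) {u v : L2Box L} (h : ∀ k, coef L k u = coef L k v) :
    u = v := by
  have h1 := hasSum_normSq_coef hL (u - v)
  have h2 : ∀ k, ‖coef L k (u - v)‖ ^ 2 = 0 := fun k => by rw [map_sub, h k]; simp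
  simp only [h2] at h1
  have := h1.unique hasSum_zero
  exact sub_eq_zero.1 (norm_eq_zero.1 (pow_eq_zero_iff two_ne_zero |>.1 this))

/-- Domination of Fourier coefficients gives domination of `L²` norms. -/
lemma norm_le_of_coef_le (hL : ∀ i, 0 < L i) {u v : L2Box L} {C : ℝ} (hC : 0 ≤ C)
    (h : ∀ k, ‖coef L k u‖ ≤ C * ‖coef L k v‖) : ‖u‖ ≤ C * ‖v‖ := by
  refine le_of_sq_le_sq ?_ (by positivity)
  rw [mul_pow]
  refine hasSum_le (fun k => ?_) (hasSum_normSq_coef hL u)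
    ((hasSum_normSq_coef hL v).mul_left (C ^ 2))
  rw [← mul_pow]
  exact pow_le_pow_left₀ (norm_nonneg _) (h k) 2

/-! ### Real trigonometric polynomials -/

/-- The partial Fourier sum of `u` over the finite set `F` of modes. The real part makes it a real
function even if `F` is not symmetric. -/
noncomputable def partialSum (L : Fin D → ℝ) (F : Finset (Fin D → ℤ)) (u : L2Box L)
    (x : Fin D → ℝ) : ℝ :=
  ∑ k ∈ F, (coef L k u * mode L k x).re

lemma IsSmoothPeriodic.continuous {χ : (Fin D → ℝ) → ℝ} (h : IsSmoothPeriodic L χ) :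
    Continuous χ := h.smooth.continuous

lemma IsSmoothPeriodic.differentiable {χ : (Fin D → ℝ) → ℝ} (h : IsSmoothPeriodic L χ) :
    Differentiable ℝ χ := h.smooth.differentiable (by simp)

lemma IsSmoothPeriodic.mul {χ ρ : (Fin D → ℝ) → ℝ} (h : IsSmoothPeriodic L χ)
    (h' : IsSmoothPeriodic L ρ) : IsSmoothPeriodic L (fun x => χ x * ρ x) :=
  ⟨h.smooth.mul h'.smooth, fun i x => by rw [h.periodic, h'.periodic]⟩

lemma IsSmoothPeriodic.pow {χ : (Fin D → ℝ) → ℝ} (h : IsSmoothPeriodic L χ) (n : ℕ) :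
    IsSmoothPeriodic L (fun x => χ x ^ n) :=
  ⟨h.smooth.pow n, fun i x => by rw [h.periodic]⟩

lemma IsSmoothPeriodic.sum {ι : Type*} {F : Finset ι} {χ : ι → (Fin D → ℝ) → ℝ}
    (h : ∀ k ∈ F, IsSmoothPeriodic L (χ k)) : IsSmoothPeriodic L (fun x => ∑ k ∈ F, χ k x) :=
  ⟨ContDiff.sum fun k hk => (h k hk).smooth,
    fun i x => Finset.sum_congr rfl fun k hk => (h k hk).periodic i x⟩

lemma isSmoothPeriodic_const (c : ℝ) : IsSmoothPeriodic L (fun _ => c) :=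
  ⟨contDiff_const, fun _ _ => rfl⟩

lemma IsSmoothPeriodic.fderiv {χ : (Fin D → ℝ) → ℝ} (h : IsSmoothPeriodic L χ) (v : Fin D → ℝ) :
    IsSmoothPeriodic L (fun x => fderiv ℝ χ x v) := by
  refine ⟨(h.smooth.fderiv_right (m := ∞) (by simp)).clm_apply contDiff_const, fun i x => ?_⟩
  have h1 : (fun y => χ (y + Pi.single i (L i))) = χ := funext (h.periodic i)
  have h2 : _root_.fderiv ℝ (fun y => χ (y + Pi.single i (L i))) x
      = _root_.fderiv ℝ χ (x + Pi.single i (L i)) := fderiv_comp_add_right _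
  rw [← h2, h1]

lemma hasFDerivAt_phase (k : Fin D → ℤ) (x : Fin D → ℝ) :
    HasFDerivAt (phase L k)
      (∑ j, freq L k j • (ContinuousLinearMap.proj j : (Fin D → ℝ) →L[ℝ] ℝ)) x := by
  unfold phase
  exact HasFDerivAt.fun_sum fun j _ => (hasFDerivAt_apply j x).const_mul _

lemma phase_add_period (hL : ∀ i, 0 < L i) (k : Fin D → ℤ) (i : Fin D) (x : Fin D → ℝ) :
    phase L k (x + Pi.single i (L i)) = phase L k x + k i * (2 * Real.pi) := by
  simp only [phase, Pi.add_apply, mul_add, Finset.sum_add_distrib, add_right_inj]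
  rw [Finset.sum_eq_single i]
  · rw [Pi.single_eq_same, freq, div_mul_cancel₀ _ (hL i).ne']
    ring
  · intro j _ hj
    rw [Pi.single_eq_of_ne hj, mul_zero]
  · simp

lemma re_mul_mode (c : ℂ) (k : Fin D → ℤ) (x : Fin D → ℝ) :
    (c * mode L k x).re = (Real.sqrt (boxVolume L))⁻¹ *
      (c.re * Real.cos (phase L k x) - c.im * Real.sin (phase L k x)) := by
  rw [mode, mul_left_comm, Complex.re_ofReal_mul, Complex.mul_re, Complex.exp_ofReal_mul_I_re,
    Complex.exp_ofReal_mul_I_im]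

lemma isSmoothPeriodic_re_mul_mode (hL : ∀ i, 0 < L i) (c : ℂ) (k : Fin D → ℤ) :
    IsSmoothPeriodic L (fun x => (c * mode L k x).re) := by
  simp only [re_mul_mode]
  constructor
  · have : ContDiff ℝ ∞ (phase L k) := by unfold phase; fun_prop
    fun_prop
  · intro i x
    rw [phase_add_period hL, Real.cos_add_int_mul_two_pi, Real.sin_add_int_mul_two_pi]

lemma fderiv_re_mul_mode (c : ℂ) (k : Fin D → ℤ) (i : Fin D) (x : Fin D → ℝ) :
    fderiv ℝ (fun x => (c * mode L k x).re) x (Pi.single i 1)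
      = ((Complex.I * freq L k i) * c * mode L k x).re := by
  have h := hasFDerivAt_phase (L := L) k x
  have h2 := ((h.cos.const_mul c.re).sub (h.sin.const_mul c.im)).const_mul
    (Real.sqrt (boxVolume L))⁻¹
  have h3 : HasFDerivAt (fun x => (c * mode L k x).re) _ x :=
    h2.congr_of_eventuallyEq (Filter.Eventually.of_forall fun y => re_mul_mode c k y)
  rw [h3.fderiv, re_mul_mode]
  have h4 : (∑ j, freq L k j • (ContinuousLinearMap.proj j : (Fin D → ℝ) →L[ℝ] ℝ))
      (Pi.single i 1) = freq L k i := by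
    rw [_root_.sum_apply, Finset.sum_eq_single i]
    · simp
    · intro j _ hj
      simp [Pi.single_eq_of_ne hj]
    · simp
  simp only [_root_.smul_apply, _root_.sub_apply, smul_eq_mul, h4,
    Complex.mul_re, Complex.mul_im, Complex.I_re, Complex.I_im, Complex.ofReal_re,
    Complex.ofReal_im]
  ring

lemma isSmoothPeriodic_partialSum (hL : ∀ i, 0 < L i) (F : Finset (Fin D → ℤ)) (u : L2Box L) :
    IsSmoothPeriodic L (partialSum L F u) :=
  IsSmoothPeriodic.sum fun k _ => isSmoothPeriodic_re_mul_mode hL _ k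

/-! ### Integration by parts on the box -/

lemma memLp_of_continuous {p : ENNReal} {f : (Fin D → ℝ) → ℝ} (hf : Continuous f) :
    MemLp f p (boxMeasure L) := by
  have hK : IsCompact (Set.Icc (0 : Fin D → ℝ) L) := isCompact_Icc
  obtain ⟨C, hC⟩ := hK.exists_bound_of_continuousOn hf.continuousOn
  refine MemLp.of_bound hf.aestronglyMeasurable C ?_
  filter_upwards [ae_mem_box L] with x hx
  refine hC x ⟨fun i => (hx i (Set.mem_univ i)).1.le, fun i => (hx i (Set.mem_univ i)).2.le⟩

/-- A continuous function as an element of `L²(Ω)`. -/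
noncomputable def contLp (L : Fin D → ℝ) (f : (Fin D → ℝ) → ℝ) (hf : Continuous f) : L2Box L :=
  (memLp_of_continuous hf).toLp f

lemma coeFn_contLp {f : (Fin D → ℝ) → ℝ} (hf : Continuous f) :
    contLp L f hf =ᵐ[boxMeasure L] f := MemLp.coeFn_toLp _

lemma integral_mul_eq_inner (u v : L2Box L) :
    ∫ x, u x * v x ∂(boxMeasure L) = inner ℝ u v := by
  rw [L2.inner_def]
  refine integral_congr_ae (Filter.Eventually.of_forall fun x => ?_)
  simp [mul_comm]

lemma integral_mul_cont_eq_inner (u : L2Box L) {f : (Fin D → ℝ) → ℝ} (hf : Continuous f) :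
    ∫ x, u x * f x ∂(boxMeasure L) = inner ℝ u (contLp L f hf) := by
  rw [← integral_mul_eq_inner]
  refine integral_congr_ae ?_
  filter_upwards [coeFn_contLp (L := L) hf] with x hx
  rw [hx]

/-- The integral of a partial derivative of a smooth periodic function over a period cell
vanishes. -/
lemma integral_fderiv_eq_zero (hL : ∀ i, 0 < L i) {χ : (Fin D → ℝ) → ℝ}
    (h : IsSmoothPeriodic L χ) (i : Fin D) :
    ∫ x, fderiv ℝ χ x (Pi.single i 1) ∂(boxMeasure L) = 0 := by
  obtain _ | n := D
  · exact i.elim0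
  have hle : (0 : Fin (n + 1) → ℝ) ≤ L := fun j => (hL j).le
  have hc := (h.fderiv (Pi.single i 1)).continuous
  have hbox : boxMeasure L = volume.restrict (Set.Icc 0 L) :=
    Measure.restrict_congr_set (Measure.univ_pi_Ioo_ae_eq_Icc (f := 0) (g := L))
  have hsum : ∀ x, ∑ j, (if j = i then fderiv ℝ χ x else 0) (Pi.single j 1)
      = fderiv ℝ χ x (Pi.single i 1) := fun x => by
    rw [Finset.sum_eq_single i]
    · simp
    · intro j _ hj
      simp [hj]
    · simp
  -- The divergence theorem is applied to the field `χ eᵢ`, whose fluxes through opposite faces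
  -- cancel by periodicity.
  have key := integral_divergence_of_hasFDerivAt_off_countable' (0 : Fin (n + 1) → ℝ) L hle
    (fun j x => if j = i then χ x else 0) (fun j x => if j = i then fderiv ℝ χ x else 0) ∅
    Set.countable_empty
    (fun j => by
      by_cases hj : j = i
      · simpa [hj] using h.continuous.continuousOn
      · simpa [hj] using continuousOn_const)
    (fun x _ j => by
      by_cases hj : j = i
      · simpa [hj] using (h.differentiable x).hasFDerivAt
      · simpa [hj] using hasFDerivAt_const (0 : ℝ) x)
    (by simp only [hsum]; exact hc.continuousOn.integrableOn_compact isCompact_Icc)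
  simp only [hsum] at key
  rw [hbox, key]
  refine Finset.sum_eq_zero fun j _ => ?_
  by_cases hj : j = i
  · subst hj
    simp only [if_true]
    rw [sub_eq_zero]
    refine integral_congr_ae (Filter.Eventually.of_forall fun x => ?_)
    have : (j.insertNth (L j) x : Fin (n + 1) → ℝ)
        = j.insertNth ((0 : Fin (n + 1) → ℝ) j) x + Pi.single j (L j) := by
      refine Fin.insertNth_eq_iff.2 ⟨by simp, ?_⟩
      funext l
      simp [Fin.removeNth, Fin.succAbove_ne]
    simp only [this, h.periodic]
  · simp [hj]

lemma integral_mul_fderiv (hL : ∀ i, 0 < L i) {χ ρ : (Fin D → ℝ) → ℝ}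
    (h : IsSmoothPeriodic L χ) (h' : IsSmoothPeriodic L ρ) (i : Fin D) :
    ∫ x, χ x * fderiv ℝ ρ x (Pi.single i 1) ∂(boxMeasure L)
      = -∫ x, fderiv ℝ χ x (Pi.single i 1) * ρ x ∂(boxMeasure L) := by
  have h0 := integral_fderiv_eq_zero hL (h.mul h') i
  have h1 : ∀ x, fderiv ℝ (fun x => χ x * ρ x) x (Pi.single i 1)
      = χ x * fderiv ℝ ρ x (Pi.single i 1) + fderiv ℝ χ x (Pi.single i 1) * ρ x := fun x => by
    rw [fderiv_fun_mul (h.differentiable x) (h'.differentiable x)]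
    simp only [_root_.add_apply, _root_.smul_apply, smul_eq_mul]
    ring
  simp only [h1] at h0
  rw [integral_add] at h0
  · linarith
  · exact (memLp_of_continuous (h.continuous.mul (h'.fderiv _).continuous)).integrable le_rfl
  · exact (memLp_of_continuous ((h.fderiv _).continuous.mul h'.continuous)).integrable le_rfl

/-! ### Weak partial derivatives -/

lemma hasWeakPartial_iff {i : Fin D} {u v : L2Box L} :
    HasWeakPartial L i u v ↔ ∀ χ : (Fin D → ℝ) → ℝ, ∀ h : IsSmoothPeriodic L χ,
      inner ℝ u (contLp L _ (h.fderiv (Pi.single i 1)).continuous)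
        = -inner ℝ v (contLp L χ h.continuous) := by
  refine forall_congr' fun χ => forall_congr' fun h => ?_
  rw [integral_mul_cont_eq_inner u (h.fderiv (Pi.single i 1)).continuous,
    integral_mul_cont_eq_inner v h.continuous]

lemma HasWeakPartial.add {i : Fin D} {u v u' v' : L2Box L} (h : HasWeakPartial L i u v)
    (h' : HasWeakPartial L i u' v') : HasWeakPartial L i (u + u') (v + v') := by
  rw [hasWeakPartial_iff] at *
  intro χ hχ
  rw [inner_add_left, inner_add_left, h χ hχ, h' χ hχ, neg_add]

lemma HasWeakPartial.smul {i : Fin D} {u v : L2Box L} (h : HasWeakPartial L i u v) (c : ℝ) :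
    HasWeakPartial L i (c • u) (c • v) := by
  rw [hasWeakPartial_iff] at *
  intro χ hχ
  rw [real_inner_smul_left, real_inner_smul_left, h χ hχ, mul_neg]

/-- The weak partial derivatives are closed operators in `L²(Ω)`. -/
lemma HasWeakPartial.of_tendsto {i : Fin D} {u v : ℕ → L2Box L} {u' v' : L2Box L}
    (h : ∀ n, HasWeakPartial L i (u n) (v n)) (hu : Filter.Tendsto u Filter.atTop (nhds u'))
    (hv : Filter.Tendsto v Filter.atTop (nhds v')) : HasWeakPartial L i u' v' := by
  simp only [hasWeakPartial_iff] at *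
  intro χ hχ
  refine tendsto_nhds_unique (hu.inner tendsto_const_nhds) ?_
  simp only [fun n => h n χ hχ]
  exact (hv.inner tendsto_const_nhds).neg

lemma IsSmoothPeriodic.hasWeakPartial (hL : ∀ i, 0 < L i) {χ : (Fin D → ℝ) → ℝ}
    (h : IsSmoothPeriodic L χ) (i : Fin D) :
    HasWeakPartial L i (contLp L χ h.continuous)
      (contLp L _ (h.fderiv (Pi.single i 1)).continuous) := by
  intro ρ hρ
  have h0 := integral_mul_fderiv hL h hρ i
  rw [integral_congr_ae (g := fun x => χ x * _root_.fderiv ℝ ρ x (Pi.single i 1)),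
    integral_congr_ae (f := fun x => contLp L _ (h.fderiv (Pi.single i 1)).continuous x * ρ x)
      (g := fun x => _root_.fderiv ℝ χ x (Pi.single i 1) * ρ x), h0]
  · filter_upwards [coeFn_contLp (L := L) (h.fderiv (Pi.single i 1)).continuous] with x hx
    rw [hx]
  · filter_upwards [coeFn_contLp (L := L) h.continuous] with x hx
    rw [hx]

/-- The Fourier multiplier of a weak derivative. -/
lemma HasWeakPartial.coef (hL : ∀ i, 0 < L i) {i : Fin D} {u v : L2Box L}
    (h : HasWeakPartial L i u v) (k : Fin D → ℤ) :
    coef L k v = Complex.I * freq L k i * coef L k u := by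
  -- The pairings with the real functions `Re (c e_k)` determine the coefficient.
  have hre : ∀ (w : L2Box L) (c : ℂ), ∫ x, w x * (c * mode L k x).re ∂(boxMeasure L)
      = (c * (starRingEnd ℂ) (FCH.coef L k w)).re := by
    intro w c
    have hint : Integrable (fun x => c * ((w x : ℂ) * mode L k x)) (boxMeasure L) := by
      refine Integrable.const_mul ?_ c
      have h1 : MemLp (fun x => (w x : ℂ)) 2 (boxMeasure L) :=
        (Lp.memLp w).ofReal
      exact (memLp_mode L k).integrable_mul h1 |>.congr
        (Filter.Eventually.of_forall fun x => mul_comm _ _)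
    have h2 : (starRingEnd ℂ) (FCH.coef L k w) = ∫ x, (w x : ℂ) * mode L k x ∂(boxMeasure L) := by
      rw [coef_eq_integral, ← integral_conj]
      refine integral_congr_ae (Filter.Eventually.of_forall fun x => ?_)
      simp [mul_comm]
    rw [h2, ← integral_const_mul, ← RCLike.re_to_complex, ← integral_re hint]
    refine integral_congr_ae (Filter.Eventually.of_forall fun x => ?_)
    simp only [RCLike.re_to_complex]
    rw [mul_left_comm, Complex.re_ofReal_mul]
  have key : ∀ c : ℂ, ((Complex.I * freq L k i * c) * (starRingEnd ℂ) (FCH.coef L k u)).re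
      = -(c * (starRingEnd ℂ) (FCH.coef L k v)).re := by
    intro c
    have := h _ (isSmoothPeriodic_re_mul_mode hL c k)
    simp only [fderiv_re_mul_mode] at this
    rwa [hre, hre] at this
  have h1 := key 1
  have h2 := key Complex.I
  simp only [Complex.mul_re, Complex.mul_im, Complex.I_re, Complex.I_im, Complex.ofReal_re,
    Complex.ofReal_im, Complex.conj_re, Complex.conj_im, Complex.one_re, Complex.one_im] at h1 h2
  apply Complex.ext <;>
    simp only [Complex.mul_re, Complex.mul_im, Complex.I_re, Complex.I_im, Complex.ofReal_re,
      Complex.ofReal_im] <;> linarith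

/-! ### Uniqueness and linearity of weak derivatives -/

lemma HasWeakPartial.unique (hL : ∀ i, 0 < L i) {i : Fin D} {u v v' : L2Box L}
    (h : HasWeakPartial L i u v) (h' : HasWeakPartial L i u v') : v = v' :=
  eq_of_coef_eq hL fun k => by rw [h.coef hL, h'.coef hL]

lemma HasWeakPartial.weakPartial_eq (hL : ∀ i, 0 < L i) {i : Fin D} {u v : L2Box L}
    (h : HasWeakPartial L i u v) : weakPartial L i u = v := by
  have hex : ∃ v, HasWeakPartial L i u v := ⟨v, h⟩
  rw [weakPartial, dif_pos hex]
  exact hex.choose_spec.unique hL h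

lemma MemH1per.hasWeakPartial {u : L2Box L} (h : MemH1per L u) (i : Fin D) :
    HasWeakPartial L i u (weakPartial L i u) := by
  rw [weakPartial, dif_pos (h i)]
  exact (h i).choose_spec

lemma MemH1per.add {u v : L2Box L} (h : MemH1per L u) (h' : MemH1per L v) :
    MemH1per L (u + v) :=
  fun i => ⟨_, (h.hasWeakPartial i).add (h'.hasWeakPartial i)⟩

lemma MemH1per.smul {u : L2Box L} (h : MemH1per L u) (c : ℝ) : MemH1per L (c • u) :=
  fun i => ⟨_, (h.hasWeakPartial i).smul c⟩

lemma weakPartial_add (hL : ∀ i, 0 < L i) {u v : L2Box L} (h : MemH1per L u) (h' : MemH1per L v)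
    (i : Fin D) : weakPartial L i (u + v) = weakPartial L i u + weakPartial L i v :=
  ((h.hasWeakPartial i).add (h'.hasWeakPartial i)).weakPartial_eq hL

lemma weakPartial_smul (hL : ∀ i, 0 < L i) {u : L2Box L} (h : MemH1per L u) (c : ℝ)
    (i : Fin D) : weakPartial L i (c • u) = c • weakPartial L i u :=
  ((h.hasWeakPartial i).smul c).weakPartial_eq hL

lemma MemH2per.add (hL : ∀ i, 0 < L i) {u v : L2Box L} (h : MemH2per L u) (h' : MemH2per L v) :
    MemH2per L (u + v) :=
  ⟨h.1.add h'.1, fun i => by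
    rw [weakPartial_add hL h.1 h'.1]
    exact (h.2 i).add (h'.2 i)⟩

lemma MemH2per.smul (hL : ∀ i, 0 < L i) {u : L2Box L} (h : MemH2per L u) (c : ℝ) :
    MemH2per L (c • u) :=
  ⟨h.1.smul c, fun i => by
    rw [weakPartial_smul hL h.1]
    exact (h.2 i).smul c⟩

lemma laplacian_add (hL : ∀ i, 0 < L i) {u v : L2Box L} (h : MemH2per L u) (h' : MemH2per L v) :
    laplacian L (u + v) = laplacian L u + laplacian L v := by
  simp only [laplacian, weakPartial_add hL h.1 h'.1, weakPartial_add hL (h.2 _) (h'.2 _),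
    Finset.sum_add_distrib]

lemma laplacian_smul (hL : ∀ i, 0 < L i) {u : L2Box L} (h : MemH2per L u) (c : ℝ) :
    laplacian L (c • u) = c • laplacian L u := by
  simp only [laplacian, weakPartial_smul hL h.1, weakPartial_smul hL (h.2 _), Finset.smul_sum]

/-- The constant function `c` as an element of `L²(Ω)`. -/
noncomputable def constLp (L : Fin D → ℝ) (c : ℝ) : L2Box L :=
  contLp L (fun _ => c) continuous_const

lemma coeFn_constLp (c : ℝ) : constLp L c =ᵐ[boxMeasure L] fun _ => c := coeFn_contLp _

lemma hasWeakPartial_const (hL : ∀ i, 0 < L i) (c : ℝ) (i : Fin D) :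
    HasWeakPartial L i (constLp L c) 0 := by
  have h := (isSmoothPeriodic_const (L := L) c).hasWeakPartial hL i
  suffices h0 : contLp L _ ((isSmoothPeriodic_const (L := L) c).fderiv
      (Pi.single i 1)).continuous = 0 from h0 ▸ h
  refine Lp.ext ?_
  filter_upwards [Lp.coeFn_zero ℝ 2 (boxMeasure L), coeFn_contLp (L := L)
    ((isSmoothPeriodic_const (L := L) c).fderiv (Pi.single i 1)).continuous] with x h1 h2
  rw [h2, h1]
  simp

lemma weakPartial_const (hL : ∀ i, 0 < L i) (c : ℝ) (i : Fin D) :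
    weakPartial L i (constLp L c) = 0 :=
  (hasWeakPartial_const hL c i).weakPartial_eq hL

lemma memH1per_zero : MemH1per L (0 : L2Box L) := fun i => ⟨0, by
  rw [hasWeakPartial_iff]; simp⟩

lemma memH1per_const (hL : ∀ i, 0 < L i) (c : ℝ) : MemH1per L (constLp L c) :=
  fun i => ⟨0, hasWeakPartial_const hL c i⟩

lemma memH2per_const (hL : ∀ i, 0 < L i) (c : ℝ) : MemH2per L (constLp L c) :=
  ⟨memH1per_const hL c, fun i => by
    rw [weakPartial_const hL]
    exact memH1per_zero⟩

lemma weakPartial_zero (hL : ∀ i, 0 < L i) (i : Fin D) : weakPartial L i (0 : L2Box L) = 0 :=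
  HasWeakPartial.weakPartial_eq hL (by rw [hasWeakPartial_iff]; simp)

lemma memH2per_zero (hL : ∀ i, 0 < L i) : MemH2per L (0 : L2Box L) :=
  ⟨memH1per_zero, fun i => by
    rw [weakPartial_zero hL]
    exact memH1per_zero⟩

lemma laplacian_const (hL : ∀ i, 0 < L i) (c : ℝ) : laplacian L (constLp L c) = 0 := by
  simp [laplacian, weakPartial_const hL, weakPartial_zero hL]

lemma IsSmoothPeriodic.memH1per (hL : ∀ i, 0 < L i) {χ : (Fin D → ℝ) → ℝ}
    (h : IsSmoothPeriodic L χ) : MemH1per L (contLp L χ h.continuous) :=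
  fun i => ⟨_, h.hasWeakPartial hL i⟩

lemma IsSmoothPeriodic.memH2per (hL : ∀ i, 0 < L i) {χ : (Fin D → ℝ) → ℝ}
    (h : IsSmoothPeriodic L χ) : MemH2per L (contLp L χ h.continuous) :=
  ⟨h.memH1per hL, fun i => by
    rw [(h.hasWeakPartial hL i).weakPartial_eq hL]
    exact (h.fderiv (Pi.single i 1)).memH1per hL⟩

/-! ### Spectral estimates -/

/-- The eigenvalue `∑ⱼ (2π kⱼ / Lⱼ)²` of `-Δ` on the `k`-th mode. -/
noncomputable def eigenvalue (L : Fin D → ℝ) (k : Fin D → ℤ) : ℝ := ∑ j, freq L k j ^ 2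

lemma eigenvalue_nonneg (k : Fin D → ℤ) : 0 ≤ eigenvalue L k :=
  Finset.sum_nonneg fun _ _ => sq_nonneg _

lemma freq_sq_le (k : Fin D → ℤ) (i : Fin D) : freq L k i ^ 2 ≤ eigenvalue L k :=
  Finset.single_le_sum (f := fun j => freq L k j ^ 2) (fun _ _ => sq_nonneg _) (Finset.mem_univ i)

lemma exists_eigenvalue_ge (hL : ∀ i, 0 < L i) :
    ∃ c : ℝ, 0 < c ∧ ∀ k : Fin D → ℤ, c * ‖(fun i => (k i : ℝ))‖ ^ 2 ≤ eigenvalue L k := by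
  have hS : 0 < 1 + ∑ i, L i := by
    have := Finset.sum_nonneg fun i (_ : i ∈ Finset.univ) => (hL i).le
    linarith
  have hc : 0 < 2 * Real.pi / (1 + ∑ i, L i) := by positivity
  refine ⟨(2 * Real.pi / (1 + ∑ i, L i)) ^ 2, by positivity, fun k => ?_⟩
  rw [← mul_pow]
  refine (Real.le_sqrt (by positivity) (eigenvalue_nonneg k)).1 ?_
  rw [← le_div_iff₀' hc]
  refine (pi_norm_le_iff_of_nonneg (by positivity)).2 fun i => ?_
  rw [le_div_iff₀' hc]
  refine Real.le_sqrt_of_sq_le (le_trans ?_ (freq_sq_le k i))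
  rw [← sq_abs (freq L k i)]
  refine pow_le_pow_left₀ (by positivity) ?_ 2
  rw [freq, abs_div, abs_mul, abs_of_pos (show (0 : ℝ) < 2 * Real.pi by positivity),
    abs_of_pos (hL i), Real.norm_eq_abs, div_mul_eq_mul_div]
  refine div_le_div_of_nonneg_left (by positivity) (hL i) ?_
  have := Finset.single_le_sum (fun j _ => (hL j).le) (Finset.mem_univ i)
  linarith

lemma one_le_norm_intCast {k : Fin D → ℤ} (hk : k ≠ 0) : 1 ≤ ‖(fun i => (k i : ℝ))‖ := by
  obtain ⟨i, hi⟩ := Function.ne_iff.1 hk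
  refine le_trans ?_ (norm_le_pi_norm _ i)
  rw [Real.norm_eq_abs]
  exact_mod_cast Int.one_le_abs hi

/-- Spectral gap. -/
lemma exists_eigenvalue_gap (hL : ∀ i, 0 < L i) :
    ∃ c : ℝ, 0 < c ∧ ∀ k : Fin D → ℤ, k ≠ 0 → c ≤ eigenvalue L k := by
  obtain ⟨c, hc, h⟩ := exists_eigenvalue_ge hL
  refine ⟨c, hc, fun k hk => le_trans ?_ (h k)⟩
  exact le_mul_of_one_le_right hc.le (one_le_pow₀ (one_le_norm_intCast hk))

/-- In dimension at most three the inverse of the Laplacian is Hilbert-Schmidt. -/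
lemma summable_inv_eigenvalue_sq (hD : D < 4) (hL : ∀ i, 0 < L i) :
    Summable fun k : Fin D → ℤ => (eigenvalue L k)⁻¹ ^ 2 := by
  obtain ⟨c, hc, h⟩ := exists_eigenvalue_ge hL
  let b := Pi.basisFun ℝ (Fin D)
  let Λ : Submodule ℤ (Fin D → ℝ) := Submodule.span ℤ (Set.range b)
  have hrank : Module.finrank ℤ Λ = D := by
    rw [ZLattice.rank ℝ Λ]; simp
  have h1 : Summable fun z : Λ => ‖z‖⁻¹ ^ 4 :=
    ZLattice.summable_norm_pow_inv Λ 4 (by rw [hrank]; exact hD)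
  let f : (Fin D → ℤ) → Λ := fun k => ⟨fun i => (k i : ℝ),
    (b.mem_span_iff_repr_mem ℤ _).2 fun i => ⟨k i, by simp [b]⟩⟩
  have hf : Function.Injective f := fun k l hkl => by
    funext i
    have := congrFun (congrArg Subtype.val hkl) i
    simpa [f] using this
  have h2 := (h1.comp_injective hf).mul_left (c⁻¹ ^ 2)
  refine h2.of_nonneg_of_le (fun k => sq_nonneg _) fun k => ?_
  have hn : ‖f k‖ = ‖(fun i => (k i : ℝ))‖ := rfl
  simp only [Function.comp_apply, hn]
  rcases eq_or_ne k 0 with rfl | hk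
  · simp [eigenvalue, freq]
    positivity
  · have h3 := one_le_norm_intCast hk
    have h4 := h k
    have h6 : 0 ≤ (eigenvalue L k)⁻¹ := inv_nonneg.2 (eigenvalue_nonneg k)
    calc (eigenvalue L k)⁻¹ ^ 2 ≤ (c * ‖(fun i => (k i : ℝ))‖ ^ 2)⁻¹ ^ 2 := by gcongr
      _ = c⁻¹ ^ 2 * ‖(fun i => (k i : ℝ))‖⁻¹ ^ 4 := by rw [mul_inv]; ring

lemma MemH2per.coef_second (hL : ∀ i, 0 < L i) {u : L2Box L} (h : MemH2per L u) (i j : Fin D)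
    (k : Fin D → ℤ) : coef L k (weakPartial L j (weakPartial L i u))
      = -(freq L k j * freq L k i : ℝ) * coef L k u := by
  rw [((h.2 i).hasWeakPartial j).coef hL, (h.1.hasWeakPartial i).coef hL]
  push_cast
  linear_combination (freq L k j : ℂ) * freq L k i * coef L k u * Complex.I_mul_I

lemma MemH2per.coef_laplacian (hL : ∀ i, 0 < L i) {u : L2Box L} (h : MemH2per L u)
    (k : Fin D → ℤ) : coef L k (laplacian L u) = -(eigenvalue L k : ℝ) * coef L k u := by
  simp only [laplacian, map_sum, h.coef_second hL, eigenvalue]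
  push_cast
  rw [← Finset.sum_mul, Finset.sum_neg_distrib]
  simp only [sq]

/-- Elliptic regularity: the Laplacian bounds all second derivatives, since
`|freq L k i * freq L k j| ≤ eigenvalue L k`. -/
lemma MemH2per.norm_second_le (hL : ∀ i, 0 < L i) {u : L2Box L} (h : MemH2per L u)
    (i j : Fin D) : ‖weakPartial L j (weakPartial L i u)‖ ≤ ‖laplacian L u‖ := by
  have := norm_le_of_coef_le hL (u := weakPartial L j (weakPartial L i u)) (v := laplacian L u)
    zero_le_one fun k => ?_
  · simpa using this
  rw [h.coef_second hL, h.coef_laplacian hL, one_mul, norm_mul, norm_mul, norm_neg, norm_neg,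
    Complex.norm_real, Complex.norm_real, Real.norm_eq_abs, Real.norm_eq_abs,
    abs_of_nonneg (eigenvalue_nonneg k)]
  refine mul_le_mul_of_nonneg_right ?_ (norm_nonneg _)
  refine abs_le_of_sq_le_sq ?_ (eigenvalue_nonneg k)
  rw [mul_pow, sq (eigenvalue L k)]
  exact mul_le_mul (freq_sq_le k j) (freq_sq_le k i) (sq_nonneg _) (eigenvalue_nonneg k)

/-- Functions with vanishing mean value. -/
def MeanZero (L : Fin D → ℝ) (u : L2Box L) : Prop := ∫ x, u x ∂(boxMeasure L) = 0

lemma coef_zero_index (u : L2Box L) :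
    coef L 0 u = ((Real.sqrt (boxVolume L))⁻¹ : ℝ) * ((∫ x, u x ∂(boxMeasure L) : ℝ) : ℂ) := by
  rw [coef_eq_integral, ← integral_complex_ofReal, ← integral_const_mul]
  refine integral_congr_ae (Filter.Eventually.of_forall fun x => ?_)
  simp [mode, phase, freq]

lemma meanZero_iff (hL : ∀ i, 0 < L i) {u : L2Box L} : MeanZero L u ↔ coef L 0 u = 0 := by
  have := boxVolume_pos hL
  rw [coef_zero_index, mul_eq_zero, MeanZero, Complex.ofReal_eq_zero, Complex.ofReal_eq_zero]
  refine ⟨Or.inr, fun h => h.resolve_left ?_⟩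
  positivity

/-- Poincaré inequality. -/
lemma exists_poincare (hL : ∀ i, 0 < L i) : ∃ C : ℝ, 0 < C ∧ ∀ u : L2Box L, MemH1per L u →
    MeanZero L u → ‖u‖ ^ 2 ≤ C * ∑ i, ‖weakPartial L i u‖ ^ 2 := by
  obtain ⟨c, hc, h⟩ := exists_eigenvalue_gap hL
  refine ⟨c⁻¹, inv_pos.2 hc, fun u hu hm => ?_⟩
  have h1 : HasSum (fun k => c⁻¹ * ∑ i, ‖coef L k (weakPartial L i u)‖ ^ 2)
      (c⁻¹ * ∑ i, ‖weakPartial L i u‖ ^ 2) :=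
    (hasSum_sum fun i _ => hasSum_normSq_coef hL (weakPartial L i u)).mul_left _
  refine hasSum_le (fun k => ?_) (hasSum_normSq_coef hL u) h1
  rcases eq_or_ne k 0 with rfl | hk
  · rw [(meanZero_iff hL).1 hm]
    have : 0 ≤ c⁻¹ * ∑ i, ‖coef L 0 (weakPartial L i u)‖ ^ 2 := by positivity
    simpa using this
  · have h2 : ∑ i, ‖coef L k (weakPartial L i u)‖ ^ 2 = eigenvalue L k * ‖coef L k u‖ ^ 2 := by
      rw [eigenvalue, Finset.sum_mul]
      refine Finset.sum_congr rfl fun i _ => ?_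
      rw [(hu.hasWeakPartial i).coef hL, norm_mul, norm_mul, Complex.norm_I, one_mul,
        Complex.norm_real, Real.norm_eq_abs, mul_pow, sq_abs]
    rw [h2, ← mul_assoc]
    refine le_mul_of_one_le_left (sq_nonneg _) ?_
    rw [inv_mul_eq_div, one_le_div hc]
    exact h k hk

/-- On functions of mean zero, the Laplacian controls the function and its gradient. -/
lemma exists_laplacian_bound (hL : ∀ i, 0 < L i) : ∃ C : ℝ, 0 < C ∧ ∀ u : L2Box L,
    MemH2per L u → MeanZero L u →
      ‖u‖ ≤ C * ‖laplacian L u‖ ∧ ∀ i, ‖weakPartial L i u‖ ≤ C * ‖laplacian L u‖ := by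
  obtain ⟨c, hc, h⟩ := exists_eigenvalue_gap hL
  refine ⟨c⁻¹ + (Real.sqrt c)⁻¹, by positivity, fun u hu hm => ⟨?_, fun i => ?_⟩⟩
  · refine norm_le_of_coef_le hL (by positivity) fun k => ?_
    rw [hu.coef_laplacian hL, norm_mul, norm_neg, Complex.norm_real, Real.norm_eq_abs,
      abs_of_nonneg (eigenvalue_nonneg k), ← mul_assoc]
    rcases eq_or_ne k 0 with rfl | hk
    · simp [(meanZero_iff hL).1 hm]
    · refine le_mul_of_one_le_left (norm_nonneg _) ?_
      have h1 : 1 ≤ c⁻¹ * eigenvalue L k := by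
        rw [inv_mul_eq_div, one_le_div hc]
        exact h k hk
      have h2 : 0 ≤ (Real.sqrt c)⁻¹ * eigenvalue L k :=
        mul_nonneg (by positivity) (eigenvalue_nonneg k)
      rw [add_mul]
      linarith
  · refine norm_le_of_coef_le hL (by positivity) fun k => ?_
    rw [hu.coef_laplacian hL, (hu.1.hasWeakPartial i).coef hL, norm_mul, norm_mul, norm_mul,
      norm_neg, Complex.norm_I, one_mul, Complex.norm_real, Complex.norm_real, Real.norm_eq_abs,
      Real.norm_eq_abs, abs_of_nonneg (eigenvalue_nonneg k), ← mul_assoc]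
    rcases eq_or_ne k 0 with rfl | hk
    · simp [(meanZero_iff hL).1 hm]
    · refine mul_le_mul_of_nonneg_right ?_ (norm_nonneg _)
      have h0 := eigenvalue_nonneg (L := L) k
      have h1 : |freq L k i| ≤ Real.sqrt (eigenvalue L k) := Real.abs_le_sqrt (freq_sq_le k i)
      have h2 : Real.sqrt (eigenvalue L k) ≤ (Real.sqrt c)⁻¹ * eigenvalue L k := by
        have h3 : Real.sqrt c ≤ Real.sqrt (eigenvalue L k) := Real.sqrt_le_sqrt (h k hk)
        rw [le_inv_mul_iff₀ (by positivity)]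
        calc Real.sqrt c * Real.sqrt (eigenvalue L k)
            ≤ Real.sqrt (eigenvalue L k) * Real.sqrt (eigenvalue L k) := by gcongr
          _ = eigenvalue L k := Real.mul_self_sqrt h0
      have h4 : 0 ≤ c⁻¹ * eigenvalue L k := by positivity
      rw [add_mul]
      linarith

/-- The Fourier coefficients of a mean zero function in `H²` are absolutely summable, by the
Cauchy-Schwarz inequality for `‖coef L k u‖ = (eigenvalue L k)⁻¹ ‖coef L k (Δu)‖`. -/
lemma exists_sum_coef_bound (hD : D < 4) (hL : ∀ i, 0 < L i) : ∃ C : ℝ, 0 ≤ C ∧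
    ∀ u : L2Box L, MemH2per L u → MeanZero L u → ∀ F : Finset (Fin D → ℤ),
      ∑ k ∈ F, ‖coef L k u‖ ≤ C * ‖laplacian L u‖ := by
  have hs := summable_inv_eigenvalue_sq hD hL
  obtain ⟨c, hc, hgap⟩ := exists_eigenvalue_gap hL
  refine ⟨Real.sqrt (∑' k, (eigenvalue L k)⁻¹ ^ 2), Real.sqrt_nonneg _, fun u hu hm F => ?_⟩
  have h1 : ∀ k, ‖coef L k u‖ = (eigenvalue L k)⁻¹ * ‖coef L k (laplacian L u)‖ := fun k => by
    rw [hu.coef_laplacian hL, norm_mul, norm_neg, Complex.norm_real, Real.norm_eq_abs,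
      abs_of_nonneg (eigenvalue_nonneg k)]
    rcases eq_or_ne k 0 with rfl | hk
    · simp [(meanZero_iff hL).1 hm]
    · rw [inv_mul_cancel_left₀ (hc.trans_le (hgap k hk)).ne']
  simp only [h1]
  refine (Real.sum_mul_le_sqrt_mul_sqrt F _ _).trans ?_
  refine mul_le_mul (Real.sqrt_le_sqrt (hs.sum_le_tsum F fun _ _ => sq_nonneg _)) ?_
    (Real.sqrt_nonneg _) (Real.sqrt_nonneg _)
  have hp := hasSum_normSq_coef hL (laplacian L u)
  refine Real.sqrt_le_iff.2 ⟨norm_nonneg _, ?_⟩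
  rw [← hp.tsum_eq]
  exact hp.summable.sum_le_tsum F fun _ _ => sq_nonneg _

lemma abs_partialSum_le (F : Finset (Fin D → ℤ)) (u : L2Box L) (x : Fin D → ℝ) :
    |partialSum L F u x| ≤ (Real.sqrt (boxVolume L))⁻¹ * ∑ k ∈ F, ‖coef L k u‖ := by
  rw [partialSum, Finset.mul_sum]
  refine (Finset.abs_sum_le_sum_abs _ _).trans (Finset.sum_le_sum fun k _ => ?_)
  refine (Complex.abs_re_le_norm _).trans ?_
  rw [norm_mul, norm_mode, mul_comm]

lemma fderiv_partialSum (hL : ∀ i, 0 < L i) {i : Fin D} {u v : L2Box L}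
    (h : HasWeakPartial L i u v) (F : Finset (Fin D → ℤ)) (x : Fin D → ℝ) :
    fderiv ℝ (partialSum L F u) x (Pi.single i 1) = partialSum L F v x := by
  unfold partialSum
  rw [fderiv_fun_sum fun k _ => (isSmoothPeriodic_re_mul_mode hL _ k).differentiable x,
    _root_.sum_apply]
  refine Finset.sum_congr rfl fun k _ => ?_
  rw [fderiv_re_mul_mode, h.coef hL]

/-- Convergence in `L²(Ω)` of the Fourier series, along the directed set of all finite sets of
modes. -/
lemma tendsto_partialSum (hL : ∀ i, 0 < L i) (u : L2Box L) :
    Filter.Tendsto (fun F => contLp L _ (isSmoothPeriodic_partialSum hL F u).continuous)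
      Filter.atTop (nhds u) := by
  let R : Lp ℂ 2 (boxMeasure L) →L[ℝ] L2Box L := Complex.reCLM.compLpL 2 (boxMeasure L)
  have h := (R.continuous.tendsto _).comp (hasSum_coef_smul hL u)
  have h1 : R (Complex.ofRealCLM.compLpL 2 (boxMeasure L) u) = u := by
    refine Lp.ext ?_
    filter_upwards [Complex.ofRealCLM.coeFn_compLpL (p := 2) u,
      Complex.reCLM.coeFn_compLpL (p := 2) (Complex.ofRealCLM.compLpL 2 (boxMeasure L) u)]
      with x hx hx'
    rw [hx', hx, Complex.ofRealCLM_apply, Complex.reCLM_apply, Complex.ofReal_re]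
  rw [h1] at h
  refine h.congr' (Filter.Eventually.of_forall fun F => ?_)
  simp only [Function.comp_apply]
  refine Lp.ext ?_
  have hall : ∀ᵐ x ∂(boxMeasure L), ∀ k : Fin D → ℤ,
      (coef L k u • modeLp L k : Lp ℂ 2 (boxMeasure L)) x = coef L k u * mode L k x := by
    rw [ae_all_iff]
    intro k
    filter_upwards [Lp.coeFn_smul (coef L k u) (modeLp L k), (memLp_mode L k).coeFn_toLp]
      with x h1 h2
    rw [h1, Pi.smul_apply, modeLp, h2, smul_eq_mul]
  filter_upwards [Complex.reCLM.coeFn_compLpL (p := 2) (∑ k ∈ F, coef L k u • modeLp L k),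
    Lp.coeFn_fun_finsetSum F (fun k => coef L k u • modeLp L k), hall,
    coeFn_contLp (isSmoothPeriodic_partialSum hL F u).continuous] with x h1 h2 h3 h4
  rw [h1, h2, h4, Complex.reCLM_apply, Complex.re_sum, partialSum]
  exact Finset.sum_congr rfl fun k _ => by rw [h3]

/-! ### Smooth approximation and Sobolev embeddings -/

/-- The partial Fourier sums of finitely many functions converge almost everywhere along a common
sequence of sets of modes. -/
lemma exists_seq_partialSum_ae (hL : ∀ i, 0 < L i) {ι : Type*} (s : Finset ι) (w : ι → L2Box L) :
    ∃ F : ℕ → Finset (Fin D → ℤ), Filter.Tendsto F Filter.atTop Filter.atTop ∧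
      ∀ j ∈ s, ∀ᵐ x ∂(boxMeasure L), Filter.Tendsto (fun n => partialSum L (F n) (w j) x)
        Filter.atTop (nhds (w j x)) := by
  classical
  induction s using Finset.induction_on with
  | empty =>
    obtain ⟨F, hF⟩ := Filter.exists_seq_tendsto (Filter.atTop : Filter (Finset (Fin D → ℤ)))
    exact ⟨F, hF, by simp⟩
  | insert j s _ ih =>
    obtain ⟨F, hF, hs⟩ := ih
    have h1 := tendstoInMeasure_of_tendsto_Lp ((tendsto_partialSum hL (w j)).comp hF)
    obtain ⟨ns, hns, hae⟩ := h1.exists_seq_tendsto_ae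
    refine ⟨F ∘ ns, hF.comp hns.tendsto_atTop, fun l hl => ?_⟩
    rcases Finset.mem_insert.1 hl with rfl | hl
    · have h2 : ∀ᵐ x ∂(boxMeasure L), ∀ n,
          contLp L _ (isSmoothPeriodic_partialSum hL (F (ns n)) (w l)).continuous x
            = partialSum L (F (ns n)) (w l) x :=
        ae_all_iff.2 fun n => coeFn_contLp _
      filter_upwards [hae, h2] with x hx hx2
      refine hx.congr fun n => ?_
      exact hx2 n
    · filter_upwards [hs l hl] with x hx
      exact hx.comp hns.tendsto_atTop

/-- A bound on a smooth function and its second derivative bounds the fourth power of its first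
derivative, because `∫ (∂ᵢχ)⁴ = -3 ∫ χ (∂ᵢχ)² ∂ᵢᵢχ`. -/
lemma integral_fderiv_pow_four_le (hL : ∀ i, 0 < L i) {χ : (Fin D → ℝ) → ℝ}
    (h : IsSmoothPeriodic L χ) {S : ℝ} (hS : ∀ x, |χ x| ≤ S) (i : Fin D) :
    ∫ x, fderiv ℝ χ x (Pi.single i 1) ^ 4 ∂(boxMeasure L) ≤ 9 * S ^ 2 *
      ∫ x, fderiv ℝ (fun y => fderiv ℝ χ y (Pi.single i 1)) x (Pi.single i 1) ^ 2
        ∂(boxMeasure L) := by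
  set p : (Fin D → ℝ) → ℝ := fun y => fderiv ℝ χ y (Pi.single i 1)
  have hps : IsSmoothPeriodic L p := h.fderiv (Pi.single i 1)
  set q : (Fin D → ℝ) → ℝ := fun x => fderiv ℝ p x (Pi.single i 1) with hq
  have hqs : IsSmoothPeriodic L q := hps.fderiv (Pi.single i 1)
  have h1 := integral_mul_fderiv hL (hps.pow 3) h i
  have h2 : ∀ x, fderiv ℝ (fun x => p x ^ 3) x (Pi.single i 1) = 3 * p x ^ 2 * q x := fun x => by
    rw [fderiv_fun_pow 3 (hps.differentiable x)]
    simp [hq]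
  have hpi : ∀ x, fderiv ℝ χ x (Pi.single i 1) = p x := fun _ => rfl
  simp only [h2, hpi] at h1
  have hcp := hps.continuous
  have hcq := hqs.continuous
  have hc := h.continuous
  have hI : ∀ {f : (Fin D → ℝ) → ℝ}, Continuous f → Integrable f (boxMeasure L) := fun hf =>
    (memLp_of_continuous hf).integrable le_rfl
  -- Young's inequality splits `3 p² q χ` into a half of `p⁴`, which is absorbed, and the rest.
  have h3 : ∫ x, p x ^ 4 ∂(boxMeasure L)
      ≤ ∫ x, (1 / 2 * p x ^ 4 + 9 / 2 * S ^ 2 * q x ^ 2) ∂(boxMeasure L) := by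
    calc ∫ x, p x ^ 4 ∂(boxMeasure L) = ∫ x, p x ^ 3 * p x ∂(boxMeasure L) := by
          simp only [← pow_succ]
      _ = ∫ x, -(3 * p x ^ 2 * q x * χ x) ∂(boxMeasure L) := by rw [h1, integral_neg]
      _ ≤ _ := by
          refine integral_mono (hI (by fun_prop)) (hI (by fun_prop)) fun x => ?_
          have hx := hS x
          have h4 : (q x * χ x) ^ 2 ≤ S ^ 2 * q x ^ 2 := by
            rw [mul_pow, mul_comm]
            refine mul_le_mul_of_nonneg_right ?_ (sq_nonneg _)
            rw [← sq_abs]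
            exact pow_le_pow_left₀ (abs_nonneg _) hx 2
          nlinarith [sq_nonneg (p x ^ 2 + 3 * (q x * χ x))]
  rw [integral_add (hI (by fun_prop)) (hI (by fun_prop)), integral_const_mul,
    integral_const_mul] at h3
  linarith

lemma norm_contLp_sq {f : (Fin D → ℝ) → ℝ} (hf : Continuous f) :
    ‖contLp L f hf‖ ^ 2 = ∫ x, f x ^ 2 ∂(boxMeasure L) := by
  rw [← real_inner_self_eq_norm_sq, ← integral_mul_eq_inner]
  refine integral_congr_ae ?_
  filter_upwards [coeFn_contLp (L := L) hf] with x hx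
  rw [hx, sq]

lemma norm_sq_eq_integral (u : L2Box L) : ‖u‖ ^ 2 = ∫ x, u x ^ 2 ∂(boxMeasure L) := by
  rw [← real_inner_self_eq_norm_sq, ← integral_mul_eq_inner]
  simp only [sq]

lemma aestronglyMeasurable_coe (u : L2Box L) : AEStronglyMeasurable u (boxMeasure L) :=
  (Lp.memLp u).1

/-- The Sobolev embeddings of `H²` into `L^∞` and of `H²` into `W^{1,4}`, for functions of mean
zero. -/
lemma exists_sobolev_bound (hD : D < 4) (hL : ∀ i, 0 < L i) : ∃ C : ℝ, 0 ≤ C ∧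
    ∀ u : L2Box L, MemH2per L u → MeanZero L u →
      (∀ F x, |partialSum L F u x| ≤ C * ‖laplacian L u‖) ∧
      (∀ᵐ x ∂(boxMeasure L), |u x| ≤ C * ‖laplacian L u‖) ∧
      ∀ i, Integrable (fun x => weakPartial L i u x ^ 4) (boxMeasure L) ∧
        ∫ x, weakPartial L i u x ^ 4 ∂(boxMeasure L) ≤ 9 * C ^ 2 * ‖laplacian L u‖ ^ 4 := by
  obtain ⟨K, hK, hsum⟩ := exists_sum_coef_bound hD hL
  refine ⟨(Real.sqrt (boxVolume L))⁻¹ * K, by positivity, fun u hu hm => ?_⟩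
  set C := (Real.sqrt (boxVolume L))⁻¹ * K with hC
  have hb : ∀ F x, |partialSum L F u x| ≤ C * ‖laplacian L u‖ := fun F x => by
    refine (abs_partialSum_le F u x).trans ?_
    rw [hC, mul_assoc]
    exact mul_le_mul_of_nonneg_left (hsum u hu hm F) (by positivity)
  refine ⟨hb, ?_, fun i => ?_⟩
  · obtain ⟨F, -, hF⟩ := exists_seq_partialSum_ae hL {()} fun _ => u
    filter_upwards [hF () (by simp)] with x hx
    exact le_of_tendsto' hx.abs fun n => hb _ _
  · set v := weakPartial L i u
    set z := weakPartial L i v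
    obtain ⟨F, hFt, hF⟩ := exists_seq_partialSum_ae hL {()} fun _ => v
    have huv : HasWeakPartial L i u v := hu.1.hasWeakPartial i
    have hvz : HasWeakPartial L i v z := (hu.2 i).hasWeakPartial i
    -- The bound for the partial Fourier sums passes to the limit by Fatou's lemma.
    have hle : ∫⁻ x, ENNReal.ofReal (v x ^ 4) ∂(boxMeasure L)
        ≤ ENNReal.ofReal (9 * (C * ‖laplacian L u‖) ^ 2 * ‖z‖ ^ 2) := by
      have h1 : ∫⁻ x, ENNReal.ofReal (v x ^ 4) ∂(boxMeasure L)
          = ∫⁻ x, Filter.liminf (fun n => ENNReal.ofReal (partialSum L (F n) v x ^ 4))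
            Filter.atTop ∂(boxMeasure L) := by
        refine lintegral_congr_ae ?_
        filter_upwards [hF () (by simp)] with x hx
        exact ((ENNReal.continuous_ofReal.tendsto _).comp (hx.pow 4)).liminf_eq.symm
      rw [h1]
      refine (lintegral_liminf_le fun n => ?_).trans ?_
      · have := (isSmoothPeriodic_partialSum hL (F n) v).continuous
        exact ENNReal.measurable_ofReal.comp (this.pow 4).measurable
      have h2 : Filter.Tendsto (fun n => ENNReal.ofReal (9 * (C * ‖laplacian L u‖) ^ 2 *
          ‖contLp L _ (isSmoothPeriodic_partialSum hL (F n) z).continuous‖ ^ 2)) Filter.atTop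
          (nhds (ENNReal.ofReal (9 * (C * ‖laplacian L u‖) ^ 2 * ‖z‖ ^ 2))) :=
        (ENNReal.continuous_ofReal.tendsto _).comp
          ((((tendsto_partialSum hL z).comp hFt).norm.pow 2).const_mul _)
      rw [← h2.liminf_eq]
      refine Filter.liminf_le_liminf (Filter.Eventually.of_forall fun n => ?_)
      have hc := (isSmoothPeriodic_partialSum hL (F n) v).continuous
      have hint : Integrable (fun x => partialSum L (F n) v x ^ 4) (boxMeasure L) :=
        (memLp_of_continuous (hc.pow 4)).integrable le_rfl
      rw [← ofReal_integral_eq_lintegral_ofReal hint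
        (Filter.Eventually.of_forall fun x => by positivity), norm_contLp_sq]
      refine ENNReal.ofReal_le_ofReal ?_
      have h3 := integral_fderiv_pow_four_le hL (isSmoothPeriodic_partialSum hL (F n) u)
        (fun x => hb (F n) x) i
      simp only [fderiv_partialSum hL huv, fderiv_partialSum hL hvz] at h3
      exact h3
    have hint : Integrable (fun x => v x ^ 4) (boxMeasure L) := by
      refine ⟨(aestronglyMeasurable_coe v).pow 4, ?_⟩
      rw [hasFiniteIntegral_iff_ofReal (Filter.Eventually.of_forall fun x => by positivity)]
      exact hle.trans_lt ENNReal.ofReal_lt_top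
    refine ⟨hint, ?_⟩
    rw [integral_eq_lintegral_of_nonneg_ae (Filter.Eventually.of_forall fun x => by positivity)
      hint.1]
    refine (ENNReal.toReal_mono ENNReal.ofReal_ne_top hle).trans ?_
    rw [ENNReal.toReal_ofReal (by positivity)]
    have h5 := pow_le_pow_left₀ (norm_nonneg _) (hu.norm_second_le hL i i) 2
    calc 9 * (C * ‖laplacian L u‖) ^ 2 * ‖z‖ ^ 2
        ≤ 9 * (C * ‖laplacian L u‖) ^ 2 * ‖laplacian L u‖ ^ 2 := by gcongr
      _ = _ := by ring

/-- The mean value of a function. -/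
noncomputable def mean (u : L2Box L) : ℝ := (boxVolume L)⁻¹ * ∫ x, u x ∂(boxMeasure L)

lemma integral_const_box (hL : ∀ i, 0 < L i) (c : ℝ) :
    ∫ _, c ∂(boxMeasure L) = boxVolume L * c := by
  rw [integral_const, smul_eq_mul]
  congr 1
  rw [measureReal_def, boxMeasure, Measure.restrict_apply_univ, Real.volume_pi_Ioo]
  simp [boxVolume, ENNReal.toReal_prod, fun i => (hL i).le]

lemma integrable_coe (u : L2Box L) : Integrable u (boxMeasure L) :=
  (Lp.memLp u).integrable (by norm_num)

lemma integral_add_coe (u v : L2Box L) : ∫ x, (u + v) x ∂(boxMeasure L)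
    = ∫ x, u x ∂(boxMeasure L) + ∫ x, v x ∂(boxMeasure L) := by
  rw [← integral_add (integrable_coe u) (integrable_coe v)]
  exact integral_congr_ae (Lp.coeFn_add u v)

lemma integral_smul_coe (c : ℝ) (u : L2Box L) : ∫ x, (c • u) x ∂(boxMeasure L)
    = c * ∫ x, u x ∂(boxMeasure L) := by
  rw [← integral_const_mul]
  exact integral_congr_ae (Lp.coeFn_smul c u)

lemma integral_constLp (hL : ∀ i, 0 < L i) (c : ℝ) :
    ∫ x, constLp L c x ∂(boxMeasure L) = boxVolume L * c := by
  rw [integral_congr_ae (coeFn_constLp c), integral_const_box hL]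

/-- Subtraction of the mean value makes the mean value vanish. -/
lemma meanZero_add_const (hL : ∀ i, 0 < L i) (u : L2Box L) :
    MeanZero L (u + constLp L (-mean u)) := by
  rw [MeanZero, integral_add_coe, integral_constLp hL, mean, mul_neg,
    mul_inv_cancel_left₀ (boxVolume_pos hL).ne', add_neg_cancel]

lemma MemH2per.sub_mean (hL : ∀ i, 0 < L i) {u : L2Box L} (hu : MemH2per L u) (c : ℝ) :
    MemH2per L (u + constLp L c) ∧ laplacian L (u + constLp L c) = laplacian L u ∧
      ∀ i, weakPartial L i (u + constLp L c) = weakPartial L i u := by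
  refine ⟨hu.add hL (memH2per_const hL c), ?_, fun i => ?_⟩
  · rw [laplacian_add hL hu (memH2per_const hL c), laplacian_const hL, add_zero]
  · rw [weakPartial_add hL hu.1 (memH1per_const hL c), weakPartial_const hL, add_zero]

lemma MemH2per.exists_bound (hD : D < 4) (hL : ∀ i, 0 < L i) {u : L2Box L} (hu : MemH2per L u) :
    ∃ C : ℝ, 0 ≤ C ∧ ∀ᵐ x ∂(boxMeasure L), |u x| ≤ C := by
  obtain ⟨C, hC, h⟩ := exists_sobolev_bound hD hL
  obtain ⟨h2, -, -⟩ := hu.sub_mean hL (-mean u)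
  obtain ⟨-, hb, -⟩ := h _ h2 (meanZero_add_const hL u)
  refine ⟨C * ‖laplacian L (u + constLp L (-mean u))‖ + |mean u|, by positivity, ?_⟩
  filter_upwards [hb, Lp.coeFn_add u (constLp L (-mean u)), coeFn_constLp (L := L) (-mean u)]
    with x h1 h3 h4
  rw [h3, Pi.add_apply, h4] at h1
  have := abs_add_le (u x + -mean u) (mean u)
  rw [neg_add_cancel_right] at this
  linarith

lemma MemH2per.integrable_weakPartial_pow_four (hD : D < 4) (hL : ∀ i, 0 < L i) {u : L2Box L}
    (hu : MemH2per L u) (i : Fin D) :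
    Integrable (fun x => weakPartial L i u x ^ 4) (boxMeasure L) := by
  obtain ⟨C, hC, h⟩ := exists_sobolev_bound hD hL
  obtain ⟨h2, -, hw⟩ := hu.sub_mean hL (-mean u)
  obtain ⟨-, -, hi⟩ := h _ h2 (meanZero_add_const hL u)
  have := (hi i).1
  rwa [hw i] at this

/-- Bounded smooth approximation of a function in `H²`. -/
lemma MemH2per.exists_smooth_seq (hD : D < 4) (hL : ∀ i, 0 < L i) {u : L2Box L}
    (hu : MemH2per L u) :
    ∃ (χ : ℕ → (Fin D → ℝ) → ℝ) (hχ : ∀ n, IsSmoothPeriodic L (χ n)) (S : ℝ), 0 ≤ S ∧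
      (∀ n x, |χ n x| ≤ S) ∧
      (∀ᵐ x ∂(boxMeasure L), Filter.Tendsto (fun n => χ n x) Filter.atTop (nhds (u x))) ∧
      ∀ i, Filter.Tendsto (fun n => contLp L _ ((hχ n).fderiv (Pi.single i 1)).continuous)
        Filter.atTop (nhds (weakPartial L i u)) := by
  obtain ⟨C, hC, h⟩ := exists_sobolev_bound hD hL
  obtain ⟨h2, -, hw⟩ := hu.sub_mean hL (-mean u)
  obtain ⟨hb, -, -⟩ := h _ h2 (meanZero_add_const hL u)
  set w := u + constLp L (-mean u) with hwdef
  obtain ⟨F, hFt, hF⟩ := exists_seq_partialSum_ae hL {()} fun _ => w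
  have hsm : ∀ n, IsSmoothPeriodic L fun x => partialSum L (F n) w x + mean u := fun n =>
    ⟨(isSmoothPeriodic_partialSum hL (F n) w).smooth.add contDiff_const, fun i x => by
      rw [(isSmoothPeriodic_partialSum hL (F n) w).periodic]⟩
  refine ⟨fun n x => partialSum L (F n) w x + mean u, hsm,
    C * ‖laplacian L w‖ + |mean u|, by positivity, fun n x => ?_, ?_, fun i => ?_⟩
  · have := abs_add_le (partialSum L (F n) w x) (mean u)
    have := hb (F n) x
    linarith
  · filter_upwards [hF () (by simp), Lp.coeFn_add u (constLp L (-mean u)),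
      coeFn_constLp (L := L) (-mean u)] with x h1 h3 h4
    have h5 := h1.add_const (mean u)
    rw [hwdef, h3, Pi.add_apply, h4, neg_add_cancel_right] at h5
    exact h5
  · rw [← hw i]
    refine ((tendsto_partialSum hL (weakPartial L i w)).comp hFt).congr fun n => ?_
    simp only [Function.comp_apply]
    congr 1
    funext x
    rw [fderiv_add_const, ← fderiv_partialSum hL (h2.1.hasWeakPartial i)]

lemma integral_abs_mul_le (u v : L2Box L) :
    ∫ x, |u x| * |v x| ∂(boxMeasure L) ≤ ‖u‖ * ‖v‖ := by
  have h : ∫ x, |u x| * |v x| ∂(boxMeasure L) = inner ℝ |u| |v| := by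
    rw [← integral_mul_eq_inner]
    refine integral_congr_ae ?_
    filter_upwards [Lp.coeFn_abs u, Lp.coeFn_abs v] with x h1 h2
    rw [h1, h2]
  rw [h, ← norm_abs_eq_norm u, ← norm_abs_eq_norm v]
  exact real_inner_le_norm _ _

lemma integrable_mul_coe (u v : L2Box L) : Integrable (fun x => u x * v x) (boxMeasure L) :=
  (Lp.memLp u).integrable_mul (Lp.memLp v)

/-- Integration by parts `∫ (3u² - 1) |∂ᵢu|² = -∫ (u³ - u) ∂ᵢᵢu` in `H²`. -/
lemma MemH2per.integral_cubic_mul_second (hD : D < 4) (hL : ∀ i, 0 < L i) {u : L2Box L}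
    (hu : MemH2per L u) (i : Fin D) :
    ∫ x, weakPartial L i (weakPartial L i u) x * (u x ^ 3 - u x) ∂(boxMeasure L)
      = -∫ x, (3 * u x ^ 2 - 1) * weakPartial L i u x ^ 2 ∂(boxMeasure L) := by
  obtain ⟨χ, hχ, S, hS0, hS, hae, hd⟩ := hu.exists_smooth_seq hD hL
  set v := weakPartial L i u
  set z := weakPartial L i v
  have hvz : HasWeakPartial L i v z := (hu.2 i).hasWeakPartial i
  set d : ℕ → L2Box L := fun n => contLp L _ ((hχ n).fderiv (Pi.single i 1)).continuous with hdd
  have hρ : ∀ n, IsSmoothPeriodic L fun x => χ n x ^ 3 - χ n x := fun n =>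
    ⟨((hχ n).smooth.pow 3).sub (hχ n).smooth, fun j x => by rw [(hχ n).periodic]⟩
  have hpol : ∀ n x, |3 * χ n x ^ 2 - 1| ≤ 3 * S ^ 2 + 1 := fun n x => by
    have h1 : χ n x ^ 2 ≤ S ^ 2 := sq_le_sq' (abs_le.1 (hS n x)).1 (abs_le.1 (hS n x)).2
    rw [abs_le]
    constructor <;> nlinarith [sq_nonneg (χ n x)]
  have hcub : ∀ n x, |χ n x ^ 3 - χ n x| ≤ S ^ 3 + S := fun n x => by
    refine (abs_sub _ _).trans ?_
    rw [abs_pow]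
    exact add_le_add (pow_le_pow_left₀ (abs_nonneg _) (hS n x) 3) (hS n x)
  have hcont : ∀ n, Continuous (χ n) := fun n => (hχ n).continuous
  -- The weak derivative is tested with `χ³ - χ`.
  have htest : ∀ n, ∫ x, (3 * χ n x ^ 2 - 1) * (v x * d n x) ∂(boxMeasure L)
      = -∫ x, z x * (χ n x ^ 3 - χ n x) ∂(boxMeasure L) := fun n => by
    rw [← hvz _ (hρ n)]
    refine integral_congr_ae ?_
    filter_upwards [coeFn_contLp (L := L) ((hχ n).fderiv (Pi.single i 1)).continuous] with x hx
    rw [hdd]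
    simp only
    have h3 : fderiv ℝ (fun x => χ n x ^ 3 - χ n x) x (Pi.single i 1)
        = (3 * χ n x ^ 2 - 1) * fderiv ℝ (χ n) x (Pi.single i 1) := by
      rw [fderiv_fun_sub (((hχ n).differentiable x).fun_pow 3) ((hχ n).differentiable x),
        fderiv_fun_pow 3 ((hχ n).differentiable x)]
      simp
      ring
    rw [hx, h3]
    ring
  have hlimR : Filter.Tendsto (fun n => -∫ x, z x * (χ n x ^ 3 - χ n x) ∂(boxMeasure L))
      Filter.atTop (nhds (-∫ x, z x * (u x ^ 3 - u x) ∂(boxMeasure L))) := by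
    refine (tendsto_integral_of_dominated_convergence (fun x => |z x| * (S ^ 3 + S)) (fun n => ?_)
      ((integrable_coe z).abs.mul_const _) (fun n => ?_) ?_).neg
    · exact (aestronglyMeasurable_coe z).mul (hρ n).continuous.aestronglyMeasurable
    · refine Filter.Eventually.of_forall fun x => ?_
      rw [norm_mul]
      exact mul_le_mul_of_nonneg_left (hcub n x) (norm_nonneg _)
    · filter_upwards [hae] with x hx
      exact ((hx.pow 3).sub hx).const_mul _
  have hlim1 : Filter.Tendsto (fun n => ∫ x, (3 * χ n x ^ 2 - 1) * v x ^ 2 ∂(boxMeasure L))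
      Filter.atTop (nhds (∫ x, (3 * u x ^ 2 - 1) * v x ^ 2 ∂(boxMeasure L))) := by
    refine tendsto_integral_of_dominated_convergence (fun x => (3 * S ^ 2 + 1) * v x ^ 2)
      (fun n => ?_) ?_ (fun n => ?_) ?_
    · have := hcont n
      exact (Continuous.aestronglyMeasurable (by fun_prop)).mul ((aestronglyMeasurable_coe v).pow 2)
    · refine Integrable.const_mul ?_ _
      simpa only [sq] using integrable_mul_coe v v
    · refine Filter.Eventually.of_forall fun x => ?_
      rw [norm_mul, Real.norm_of_nonneg (sq_nonneg (v x))]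
      exact mul_le_mul_of_nonneg_right (hpol n x) (sq_nonneg _)
    · filter_upwards [hae] with x hx
      exact (((hx.pow 2).const_mul 3).sub_const 1).mul_const _
  have hlim2 : Filter.Tendsto (fun n => ∫ x, (3 * χ n x ^ 2 - 1) * (v x * (d n - v) x)
      ∂(boxMeasure L)) Filter.atTop (nhds 0) := by
    have hz : Filter.Tendsto (fun n => (3 * S ^ 2 + 1) * (‖v‖ * ‖d n - v‖)) Filter.atTop
        (nhds 0) := by
      have h1 := ((tendsto_iff_norm_sub_tendsto_zero.1 (hd i)).const_mul ‖v‖).const_mul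
        (3 * S ^ 2 + 1)
      simpa using h1
    refine squeeze_zero_norm (fun n => ?_) hz
    refine (norm_integral_le_integral_norm _).trans ?_
    refine le_trans ?_ (mul_le_mul_of_nonneg_left (integral_abs_mul_le v (d n - v))
      (by positivity))
    rw [← integral_const_mul]
    have h2 : Integrable (fun x => |v x| * |(d n - v) x|) (boxMeasure L) := by
      simpa only [abs_mul] using (integrable_mul_coe v (d n - v)).abs
    refine integral_mono_of_nonneg (Filter.Eventually.of_forall fun x => norm_nonneg _)
      (h2.const_mul _) (Filter.Eventually.of_forall fun x => ?_)
    simp only [norm_mul, Real.norm_eq_abs]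
    exact mul_le_mul_of_nonneg_right (hpol n x) (by positivity)
  have hsplit : ∀ n, ∫ x, (3 * χ n x ^ 2 - 1) * (v x * d n x) ∂(boxMeasure L)
      = ∫ x, (3 * χ n x ^ 2 - 1) * v x ^ 2 ∂(boxMeasure L)
        + ∫ x, (3 * χ n x ^ 2 - 1) * (v x * (d n - v) x) ∂(boxMeasure L) := fun n => by
    have hb : ∀ {f : (Fin D → ℝ) → ℝ}, Integrable f (boxMeasure L) →
        Integrable (fun x => (3 * χ n x ^ 2 - 1) * f x) (boxMeasure L) := fun hf => by
      have := hcont n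
      exact hf.bdd_mul (Continuous.aestronglyMeasurable (by fun_prop))
        (Filter.Eventually.of_forall fun x => hpol n x)
    rw [← integral_add (hb (by simpa only [sq] using integrable_mul_coe v v))
      (hb (integrable_mul_coe v (d n - v)))]
    refine integral_congr_ae ?_
    filter_upwards [Lp.coeFn_sub (d n) v] with x hx
    rw [hx, Pi.sub_apply]
    ring
  have hfin := tendsto_nhds_unique ((hlim1.add hlim2).congr fun n => (hsplit n).symm)
    (hlimR.congr fun n => (htest n).symm)
  rw [add_zero] at hfin
  rw [hfin, neg_neg]

/-! ### The Hilbert spaces of mean zero functions -/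

lemma MeanZero.add {u v : L2Box L} (h : MeanZero L u) (h' : MeanZero L v) :
    MeanZero L (u + v) := by
  rw [MeanZero, integral_add_coe, h, h', add_zero]

lemma MeanZero.smul {u : L2Box L} (h : MeanZero L u) (c : ℝ) : MeanZero L (c • u) := by
  rw [MeanZero, integral_smul_coe, h, mul_zero]

lemma meanZero_zero : MeanZero L (0 : L2Box L) := by
  rw [MeanZero]
  simpa using integral_smul_coe (L := L) 0 0

/-- The functions of mean zero in `H¹_per(Ω)`. -/
def H1Zero (L : Fin D → ℝ) : Submodule ℝ (L2Box L) where
  carrier := {u | MemH1per L u ∧ MeanZero L u}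
  add_mem' h h' := ⟨h.1.add h'.1, h.2.add h'.2⟩
  zero_mem' := ⟨memH1per_zero, meanZero_zero⟩
  smul_mem' c _ h := ⟨h.1.smul c, h.2.smul c⟩

/-- The functions of mean zero in `H²_per(Ω)`. The side lengths have to be positive for weak
derivatives to be unique, hence for `H²_per(Ω)` to be closed under addition. -/
def H2Zero (hL : ∀ i, 0 < L i) : Submodule ℝ (L2Box L) where
  carrier := {u | MemH2per L u ∧ MeanZero L u}
  add_mem' h h' := ⟨h.1.add hL h'.1, h.2.add h'.2⟩
  zero_mem' := ⟨memH2per_zero hL, meanZero_zero⟩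
  smul_mem' c _ h := ⟨h.1.smul hL c, h.2.smul c⟩

/-- The gradient of the mean zero functions in `H¹_per(Ω)` as a linear map. The product of the
spaces `L²(Ω)` carries the maximum norm. -/
noncomputable def gradMap (hL : ∀ i, 0 < L i) : H1Zero L →ₗ[ℝ] (Fin D → L2Box L) where
  toFun u i := weakPartial L i u
  map_add' u v := funext fun i => weakPartial_add hL u.2.1 v.2.1 i
  map_smul' c u := funext fun i => weakPartial_smul hL u.2.1 c i

/-- The Laplacian of the mean zero functions in `H²_per(Ω)` as a linear map. -/
noncomputable def laplacianMap (hL : ∀ i, 0 < L i) : H2Zero hL →ₗ[ℝ] L2Box L where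
  toFun u := laplacian L u
  map_add' u v := laplacian_add hL u.2.1 v.2.1
  map_smul' c u := laplacian_smul hL u.2.1 c

lemma MeanZero.of_tendsto (hL : ∀ i, 0 < L i) {u : ℕ → L2Box L} {v : L2Box L}
    (h : ∀ n, MeanZero L (u n)) (ht : Filter.Tendsto u Filter.atTop (nhds v)) :
    MeanZero L v := by
  simp only [meanZero_iff hL] at *
  refine tendsto_nhds_unique (((coef L 0).continuous.tendsto v).comp ht) ?_
  simp only [Function.comp_def, h, tendsto_const_nhds]

/-- A linear image of a sequence is Cauchy if it is controlled by another linear image which is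
Cauchy. -/
lemma cauchySeq_of_norm_le {E F G : Type*} [AddCommGroup E] [Module ℝ E] [NormedAddCommGroup F]
    [NormedSpace ℝ F] [NormedAddCommGroup G] [NormedSpace ℝ G] {S : E →ₗ[ℝ] F} {T : E →ₗ[ℝ] G}
    {C : ℝ} (hC : 0 < C) (h : ∀ x, ‖S x‖ ≤ C * ‖T x‖) {x : ℕ → E}
    (hx : CauchySeq fun n => T (x n)) : CauchySeq fun n => S (x n) := by
  rw [Metric.cauchySeq_iff] at *
  intro ε hε
  obtain ⟨N, hN⟩ := hx (ε / C) (by positivity)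
  refine ⟨N, fun m hm n hn => ?_⟩
  have h1 := hN m hm n hn
  rw [dist_eq_norm, ← map_sub] at *
  refine (h _).trans_lt ?_
  rwa [lt_div_iff₀' hC] at h1

/-- Poincaré inequality in terms of `gradMap`. -/
lemma exists_poincare_gradMap (hL : ∀ i, 0 < L i) :
    ∃ C : ℝ, 0 < C ∧ ∀ u : H1Zero L, ‖(u : L2Box L)‖ ≤ C * ‖gradMap hL u‖ := by
  obtain ⟨C, hC, h⟩ := exists_poincare hL
  refine ⟨Real.sqrt (C * (D + 1)), by positivity, fun u => ?_⟩
  refine le_of_sq_le_sq ?_ (by positivity)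
  rw [mul_pow, Real.sq_sqrt (by positivity)]
  refine (h u u.2.1 u.2.2).trans ?_
  rw [mul_assoc]
  refine mul_le_mul_of_nonneg_left ?_ hC.le
  have h1 : ∀ i ∈ Finset.univ, ‖weakPartial L i (u : L2Box L)‖ ^ 2 ≤ ‖gradMap hL u‖ ^ 2 :=
    fun i _ => pow_le_pow_left₀ (norm_nonneg _) (norm_le_pi_norm (gradMap hL u) i) 2
  refine (Finset.sum_le_sum h1).trans ?_
  simp only [Finset.sum_const, Finset.card_univ, Fintype.card_fin, nsmul_eq_mul]
  nlinarith [sq_nonneg ‖gradMap hL u‖]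

/-- The mean zero functions in `H¹_per(Ω)` are complete for the norm of the gradient. -/
lemma exists_tendsto_gradMap (hL : ∀ i, 0 < L i) (u : ℕ → H1Zero L)
    (hu : CauchySeq fun n => gradMap hL (u n)) :
    ∃ v : H1Zero L, Filter.Tendsto (fun n => gradMap hL (u n)) Filter.atTop
      (nhds (gradMap hL v)) := by
  obtain ⟨C, hC, hP⟩ := exists_poincare_gradMap hL
  have h1 : CauchySeq fun n => (H1Zero L).subtype (u n) :=
    cauchySeq_of_norm_le (S := (H1Zero L).subtype) (T := gradMap hL) hC hP hu
  obtain ⟨w, hw⟩ := cauchySeq_tendsto_of_complete h1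
  obtain ⟨p, hp⟩ := cauchySeq_tendsto_of_complete hu
  have hp' := tendsto_pi_nhds.1 hp
  have hwp : ∀ i, HasWeakPartial L i w (p i) := fun i =>
    HasWeakPartial.of_tendsto (fun n => (u n).2.1.hasWeakPartial i) hw (hp' i)
  refine ⟨⟨w, fun i => ⟨p i, hwp i⟩, MeanZero.of_tendsto hL (fun n => (u n).2.2) hw⟩, ?_⟩
  have : gradMap hL ⟨w, fun i => ⟨p i, hwp i⟩, MeanZero.of_tendsto hL (fun n => (u n).2.2) hw⟩
      = p :=
    funext fun i => (hwp i).weakPartial_eq hL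
  rwa [this]

/-- The mean zero functions in `H²_per(Ω)` are complete for the norm of the Laplacian. -/
lemma exists_tendsto_laplacianMap (hL : ∀ i, 0 < L i) (u : ℕ → H2Zero hL)
    (hu : CauchySeq fun n => laplacianMap hL (u n)) :
    ∃ v : H2Zero hL, Filter.Tendsto (fun n => laplacianMap hL (u n)) Filter.atTop
      (nhds (laplacianMap hL v)) := by
  obtain ⟨C, hC, hP⟩ := exists_laplacian_bound hL
  have h0 : CauchySeq fun n => (H2Zero hL).subtype (u n) :=
    cauchySeq_of_norm_le (S := (H2Zero hL).subtype) (T := laplacianMap hL) hC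
      (fun x => (hP x x.2.1 x.2.2).1) hu
  let S1 : Fin D → H2Zero hL →ₗ[ℝ] L2Box L := fun i =>
    { toFun := fun u => weakPartial L i u
      map_add' := fun u v => weakPartial_add hL u.2.1.1 v.2.1.1 i
      map_smul' := fun c u => weakPartial_smul hL u.2.1.1 c i }
  let S2 : Fin D → Fin D → H2Zero hL →ₗ[ℝ] L2Box L := fun i j =>
    { toFun := fun u => weakPartial L j (weakPartial L i u)
      map_add' := fun u v => by
        rw [Submodule.coe_add, weakPartial_add hL u.2.1.1 v.2.1.1 i,
          weakPartial_add hL (u.2.1.2 i) (v.2.1.2 i)]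
      map_smul' := fun c u => by
        rw [Submodule.coe_smul, weakPartial_smul hL u.2.1.1 c i,
          weakPartial_smul hL (u.2.1.2 i), RingHom.id_apply] }
  have h1 : ∀ i, CauchySeq fun n => S1 i (u n) := fun i =>
    cauchySeq_of_norm_le (S := S1 i) (T := laplacianMap hL) hC
      (fun x => (hP x x.2.1 x.2.2).2 i) hu
  have h2 : ∀ i j, CauchySeq fun n => S2 i j (u n) := fun i j =>
    cauchySeq_of_norm_le (S := S2 i j) (T := laplacianMap hL) one_pos
      (fun x => by rw [one_mul]; exact x.2.1.norm_second_le hL i j) hu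
  obtain ⟨w, hw⟩ := cauchySeq_tendsto_of_complete h0
  choose p hp using fun i => cauchySeq_tendsto_of_complete (h1 i)
  choose q hq using fun i j => cauchySeq_tendsto_of_complete (h2 i j)
  have hwp : ∀ i, HasWeakPartial L i w (p i) := fun i =>
    HasWeakPartial.of_tendsto (fun n => (u n).2.1.1.hasWeakPartial i) hw (hp i)
  have hpq : ∀ i j, HasWeakPartial L j (p i) (q i j) := fun i j =>
    HasWeakPartial.of_tendsto (fun n => ((u n).2.1.2 i).hasWeakPartial j) (hp i) (hq i j)
  have hwe : ∀ i, weakPartial L i w = p i := fun i => (hwp i).weakPartial_eq hL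
  have hmem : w ∈ H2Zero hL := by
    refine ⟨⟨fun i => ⟨p i, hwp i⟩, fun i j => ?_⟩, MeanZero.of_tendsto hL (fun n => (u n).2.2) hw⟩
    rw [hwe]
    exact ⟨q i j, hpq i j⟩
  refine ⟨⟨w, hmem⟩, ?_⟩
  have hlap : laplacianMap hL ⟨w, hmem⟩ = ∑ i, q i i := by
    change laplacian L w = _
    rw [laplacian]
    refine Finset.sum_congr rfl fun i _ => ?_
    rw [hwe, (hpq i i).weakPartial_eq hL]
  rw [hlap]
  exact tendsto_finsetSum _ fun i _ => hq i i

/-! ### Minimisation of strongly convex functionals -/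

/-- A functional whose Taylor remainder dominates the square of a complete seminorm `‖T ·‖`, and
which is locally bounded above, has a critical point. Minimising sequences are Cauchy by strong
convexity, and the functional is lower semicontinuous because its differentials are bounded. -/
theorem exists_critical_point {E F : Type*} [AddCommGroup E] [Module ℝ E] [NormedAddCommGroup F]
    [NormedSpace ℝ F] (T : E →ₗ[ℝ] F)
    (hT : ∀ x : ℕ → E, CauchySeq (fun n => T (x n)) →
      ∃ y, Filter.Tendsto (fun n => T (x n)) Filter.atTop (nhds (T y)))
    (J : E → ℝ) (DJ : E → E → ℝ) {c : ℝ} (hc : 0 < c)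
    (hconv : ∀ u h, J u + DJ u h + c * ‖T h‖ ^ 2 ≤ J (u + h))
    (hbdd : ∀ u, ∃ C, ∀ h, ‖T h‖ ≤ 1 → J (u + h) ≤ C)
    (hsmul : ∀ u h (t : ℝ), DJ u (t • h) = t * DJ u h)
    (hcont : ∀ u h, ContinuousAt (fun t : ℝ => DJ (u + t • h) h) 0) :
    ∃ u, ∀ h, DJ u h = 0 := by
  have hneg : ∀ u h, DJ u (-h) = -DJ u h := fun u h => by
    have := hsmul u h (-1)
    rwa [neg_one_smul, neg_one_mul] at this
  have hconv' : ∀ u h, J u + DJ u h ≤ J (u + h) := fun u h => by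
    have := hconv u h
    have : 0 ≤ c * ‖T h‖ ^ 2 := by positivity
    linarith
  -- A convex functional which is bounded above on a ball has a bounded differential.
  have hDJ : ∀ u, ∃ C, 0 ≤ C ∧ ∀ h, |DJ u h| ≤ C * ‖T h‖ := fun u => by
    obtain ⟨C, hC⟩ := hbdd u
    have h1 : ∀ h, ‖T h‖ ≤ 1 → |DJ u h| ≤ C - J u := fun h hh => by
      have h2 := hconv' u h
      have h3 := hconv' u (-h)
      have h4 := hC h hh
      have h5 := hC (-h) (by rwa [map_neg, norm_neg])
      rw [hneg] at h3
      rw [abs_le]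
      constructor <;> linarith
    have hC0 : 0 ≤ C - J u := (abs_nonneg _).trans (h1 0 (by simp))
    refine ⟨C - J u, hC0, fun h => ?_⟩
    rcases (norm_nonneg (T h)).eq_or_lt with h0 | h0
    · rw [← h0, mul_zero]
      by_contra! hpos
      have h2 := h1 (((C - J u + 1) / |DJ u h|) • h) (by rw [map_smul, norm_smul, ← h0]; simp)
      rw [hsmul, abs_mul, abs_div, abs_abs, div_mul_cancel₀ _ hpos.ne',
        abs_of_nonneg (by linarith)] at h2
      linarith
    · have h2 := h1 (‖T h‖⁻¹ • h) (by
        rw [map_smul, norm_smul, norm_inv, norm_norm, inv_mul_cancel₀ h0.ne'])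
      rwa [hsmul, abs_mul, abs_of_pos (inv_pos.2 h0), inv_mul_le_iff₀ h0, mul_comm] at h2
  -- Strong convexity bounds the functional from below by a coercive quadratic.
  have hlow : BddBelow (Set.range J) := by
    obtain ⟨C, -, hC⟩ := hDJ 0
    refine ⟨J 0 - C ^ 2 / (4 * c), ?_⟩
    rintro _ ⟨h, rfl⟩
    have h1 := hconv 0 h
    rw [zero_add] at h1
    have h2 := (abs_le.1 (hC h)).1
    have h3 : C * ‖T h‖ - c * ‖T h‖ ^ 2 ≤ C ^ 2 / (4 * c) := by
      rw [le_div_iff₀ (by positivity)]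
      nlinarith [sq_nonneg (C - 2 * c * ‖T h‖)]
    linarith
  set I := sInf (Set.range J)
  have hIle : ∀ y, I ≤ J y := fun y => csInf_le hlow ⟨y, rfl⟩
  have hseq : ∀ n : ℕ, ∃ x, J x < I + 1 / ((n : ℝ) + 1) := fun n => by
    obtain ⟨_, ⟨x, rfl⟩, hx⟩ := exists_lt_of_csInf_lt (Set.range_nonempty J)
      (show sInf (Set.range J) < I + 1 / ((n : ℝ) + 1) by
        have : (0 : ℝ) < 1 / ((n : ℝ) + 1) := by positivity
        linarith)
    exact ⟨x, hx⟩
  choose x hx using hseq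
  -- Strong convexity at the midpoint `x n + d` of two elements of the minimising sequence.
  have hpair : ∀ n k, c * ‖T (x k) - T (x n)‖ ^ 2
      ≤ 2 * (1 / ((n : ℝ) + 1) + 1 / ((k : ℝ) + 1)) := fun n k => by
    set d := (1 / 2 : ℝ) • (x k - x n) with hd
    have hdd : d + d = x k - x n := by rw [hd, ← add_smul]; norm_num
    have h1 := hconv (x n + d) d
    have h2 := hconv (x n + d) (-d)
    have hk : x n + d + d = x k := by rw [add_assoc, hdd]; abel
    rw [hk] at h1
    rw [add_neg_cancel_right, hneg, map_neg, norm_neg] at h2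
    have h3 := hIle (x n + d)
    have h4 : ‖T d‖ = 1 / 2 * ‖T (x k) - T (x n)‖ := by
      rw [hd, map_smul, norm_smul, map_sub]; norm_num
    rw [h4] at h1 h2
    have := hx n
    have := hx k
    nlinarith
  have hcauchy : CauchySeq fun n => T (x n) := by
    rw [Metric.cauchySeq_iff']
    intro ε hε
    obtain ⟨N, hN⟩ := exists_nat_one_div_lt (show 0 < c * ε ^ 2 / 4 by positivity)
    refine ⟨N, fun n hn => ?_⟩
    rw [dist_eq_norm]
    have h1 := hpair N n
    have h2 : 1 / ((n : ℝ) + 1) ≤ 1 / ((N : ℝ) + 1) :=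
      one_div_le_one_div_of_le (by positivity) (by
        have : (N : ℝ) ≤ n := by exact_mod_cast hn
        linarith)
    have h3 : c * ‖T (x n) - T (x N)‖ ^ 2 < c * ε ^ 2 := by linarith
    exact lt_of_pow_lt_pow_left₀ 2 hε.le (lt_of_mul_lt_mul_left h3 hc.le)
  obtain ⟨u, hu⟩ := hT x hcauchy
  have hmin : ∀ y, J u ≤ J y := by
    obtain ⟨C, -, hC⟩ := hDJ u
    have h1 : ∀ n : ℕ, J u ≤ I + 1 / ((n : ℝ) + 1) + C * ‖T (x n) - T u‖ := fun n => by
      have h2 := hconv' u (x n - u)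
      rw [add_sub_cancel] at h2
      have h3 := (abs_le.1 (hC (x n - u))).1
      rw [map_sub] at h3
      have := hx n
      linarith
    have h2 : Filter.Tendsto (fun n : ℕ => I + 1 / ((n : ℝ) + 1) + C * ‖T (x n) - T u‖)
        Filter.atTop (nhds (I + 0 + C * 0)) :=
      (tendsto_const_nhds.add tendsto_one_div_add_atTop_nhds_zero_nat).add
        ((tendsto_iff_norm_sub_tendsto_zero.1 hu).const_mul C)
    have h3 := ge_of_tendsto' h2 h1
    intro y
    have := hIle y
    linarith
  -- The monotonicity of the differential along a line turns minimality into criticality.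
  have hnonneg : ∀ h, 0 ≤ DJ u h := fun h => by
    have h1 : Filter.Tendsto (fun t : ℝ => DJ (u + t • h) h) (nhdsWithin 0 (Set.Ioi 0))
        (nhds (DJ u h)) := by
      have := (hcont u h).tendsto
      rw [zero_smul, add_zero] at this
      exact this.mono_left nhdsWithin_le_nhds
    refine ge_of_tendsto h1 ?_
    filter_upwards [self_mem_nhdsWithin] with t ht
    have h2 := hconv' (u + t • h) (-(t • h))
    rw [add_neg_cancel_right, hneg, hsmul] at h2
    have h3 := hmin (u + t • h)
    have h4 : 0 ≤ t * DJ (u + t • h) h := by linarith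
    exact nonneg_of_mul_nonneg_right h4 ht
  refine ⟨u, fun h => le_antisymm ?_ (hnonneg h)⟩
  have := hnonneg (-h)
  rw [hneg] at this
  linarith

/-! ### Convexity of the energy densities -/

lemma pow_four_tangent (z y : ℝ) : z ^ 4 + 4 * z ^ 3 * (y - z) ≤ y ^ 4 := by
  nlinarith [sq_nonneg (y ^ 2 - z ^ 2), sq_nonneg (z * (y - z))]

lemma pow_six_tangent (z y : ℝ) : z ^ 6 + 6 * z ^ 5 * (y - z) ≤ y ^ 6 := by
  have h : y ^ 6 - (z ^ 6 + 6 * z ^ 5 * (y - z)) = ((y - z) * ((y - z) ^ 2 + 3 * z * (y - z)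
      + 2 * z ^ 2)) ^ 2 + 2 * (z * (y - z) * (y + z)) ^ 2 + 3 * (z ^ 2 * (y - z)) ^ 2 := by ring
  have : 0 ≤ y ^ 6 - (z ^ 6 + 6 * z ^ 5 * (y - z)) := by rw [h]; positivity
  linarith

/-- The quartic `A (a⁴ + r⁴) + 3 a² r²` is convex for `A ≥ 1`, because
`a⁴ + 3 a² r² + r⁴ = ((a + r)⁴ + (a - r)⁴) / 4 + (a⁴ + r⁴) / 2`. -/
lemma quartic_tangent {A : ℝ} (hA : 1 ≤ A) (a r b t : ℝ) :
    A * (a ^ 4 + r ^ 4) + 3 * a ^ 2 * r ^ 2 + (4 * A * a ^ 3 + 6 * a * r ^ 2) * (b - a)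
      + (4 * A * r ^ 2 + 6 * a ^ 2) * (r * t - r ^ 2)
      ≤ A * (b ^ 4 + t ^ 4) + 3 * b ^ 2 * t ^ 2 := by
  have h1 := pow_four_tangent (a + r) (b + t)
  have h2 := pow_four_tangent (a - r) (b - t)
  have h3 := pow_four_tangent a b
  have h4 := pow_four_tangent r t
  have h5 := mul_nonneg (sub_nonneg.2 hA) (sub_nonneg.2 h3)
  have h6 := mul_nonneg (sub_nonneg.2 hA) (sub_nonneg.2 h4)
  linarith

/-- The vector version of `quartic_tangent`: here `X = |p|²`, `Y = |q|²` and `Z = p · q`, so that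
`|p + q|² = X + 2 Z + Y`. -/
lemma quartic_tangent_vector {A : ℝ} (hA : 1 ≤ A) {a b X Y Z : ℝ} (hX : 0 ≤ X) (hY : 0 ≤ Y)
    (hZ : Z ^ 2 ≤ X * Y) :
    A * (a ^ 4 + X ^ 2) + 3 * a ^ 2 * X + (4 * A * a ^ 3 + 6 * a * X) * b
      + (4 * A * X + 6 * a ^ 2) * Z
      ≤ A * ((a + b) ^ 4 + (X + 2 * Z + Y) ^ 2) + 3 * (a + b) ^ 2 * (X + 2 * Z + Y) := by
  have hX' : 0 ≤ X + 2 * Z + Y := by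
    have h1 : |2 * Z| ≤ X + Y :=
      abs_le_of_sq_le_sq (by nlinarith [sq_nonneg (X - Y)]) (by positivity)
    linarith [(abs_le.1 h1).1]
  set r := Real.sqrt X with hr
  set t := Real.sqrt (X + 2 * Z + Y) with ht
  have hr2 : r ^ 2 = X := Real.sq_sqrt hX
  have ht2 : t ^ 2 = X + 2 * Z + Y := Real.sq_sqrt hX'
  -- The Cauchy-Schwarz inequality `p · (p + q) ≤ |p| |p + q|`.
  have hrt : X + Z ≤ r * t := by
    rw [hr, ht, ← Real.sqrt_mul hX]
    refine Real.le_sqrt_of_sq_le ?_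
    nlinarith
  have h := quartic_tangent hA a r (a + b) t
  have hr4 : r ^ 4 = X ^ 2 := by rw [← hr2]; ring
  have ht4 : t ^ 4 = (X + 2 * Z + Y) ^ 2 := by rw [← ht2]; ring
  rw [hr4, ht4, hr2, ht2, add_sub_cancel_left] at h
  have h7 : (4 * A * X + 6 * a ^ 2) * Z ≤ (4 * A * X + 6 * a ^ 2) * (r * t - X) :=
    mul_le_mul_of_nonneg_left (by linarith) (by positivity)
  linarith

/-- The density of the convex part of the energy, as a function of the values `a` of the function,
`X` of its squared gradient, and `l` of its Laplacian. -/
noncomputable def convexDensity (ε η A a X l : ℝ) : ℝ :=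
  (ε ^ 2)⁻¹ / 2 * a ^ 6 + A * a ^ 4 + ((ε ^ 2)⁻¹ + η) / 2 * a ^ 2 + 3 * a ^ 2 * X + A * X ^ 2
    + ε ^ 2 / 2 * l ^ 2

/-- The differential of `convexDensity` in a direction with value `b` and Laplacian `m`, whose
gradient has inner product `Z` with the gradient of the function. -/
noncomputable def convexDensityDeriv (ε η A a X l b Z m : ℝ) : ℝ :=
  (3 * (ε ^ 2)⁻¹ * a ^ 5 + 4 * A * a ^ 3 + ((ε ^ 2)⁻¹ + η) * a) * b + ε ^ 2 * (l * m)
    + 6 * (a * X * b) + 6 * (a ^ 2 * Z) + 4 * A * (X * Z)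

/-- The density of the part of the energy which is treated explicitly. -/
noncomputable def explicitDensity (ε η A a X : ℝ) : ℝ :=
  ((ε ^ 2)⁻¹ + η / 4 + A) * a ^ 4 + (1 + η * ε ^ 2 / 2) * X + A * X ^ 2

/-- The differential of `explicitDensity`, with directions as in `convexDensityDeriv`. -/
noncomputable def explicitDensityDeriv (ε η A a X b Z : ℝ) : ℝ :=
  ((4 * (ε ^ 2)⁻¹ + η) * a ^ 3 + 4 * A * a ^ 3) * b + (2 + η * ε ^ 2) * Z + 4 * A * (X * Z)

/-- The tangent inequality for `convexDensity`. Here `Y` is the squared gradient of the increment,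
and the last term on the left is the surplus of the quadratic term in the Laplacian. -/
lemma convexDensity_tangent {ε η A : ℝ} (hη : 0 ≤ (ε ^ 2)⁻¹ + η)
    (hA : 1 ≤ A) {a X l b Y Z m : ℝ} (hX : 0 ≤ X) (hY : 0 ≤ Y) (hZ : Z ^ 2 ≤ X * Y) :
    convexDensity ε η A a X l + convexDensityDeriv ε η A a X l b Z m + ε ^ 2 / 2 * m ^ 2
      ≤ convexDensity ε η A (a + b) (X + 2 * Z + Y) (l + m) := by
  have h1 := quartic_tangent_vector hA (a := a) (b := b) hX hY hZ
  have h2 := mul_le_mul_of_nonneg_left (pow_six_tangent a (a + b))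
    (show 0 ≤ (ε ^ 2)⁻¹ / 2 by positivity)
  have h3 : 0 ≤ ((ε ^ 2)⁻¹ + η) / 2 * b ^ 2 := by positivity
  unfold convexDensity convexDensityDeriv
  rw [add_sub_cancel_left] at h2
  linarith

/-- The tangent inequality for `explicitDensity`. The coefficients of `a⁴` and `X` are nonnegative
by the lower bound on `η`. -/
lemma explicitDensity_tangent {ε η A : ℝ} (hε : 0 < ε) (hη : 0 ≤ (ε ^ 2)⁻¹ + η)
    (hA : 1 ≤ A) {a X b Y Z : ℝ} (hX : 0 ≤ X) (hY : 0 ≤ Y) :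
    explicitDensity ε η A a X + explicitDensityDeriv ε η A a X b Z
      ≤ explicitDensity ε η A (a + b) (X + 2 * Z + Y) := by
  have hκ : 0 < (ε ^ 2)⁻¹ := by positivity
  have h1 := mul_le_mul_of_nonneg_left (pow_four_tangent a (a + b))
    (show 0 ≤ (ε ^ 2)⁻¹ + η / 4 + A by linarith)
  have h2 : 0 ≤ 1 + η * ε ^ 2 / 2 := by
    have h3 := mul_nonneg hη (sq_nonneg ε)
    rw [add_mul, inv_mul_cancel₀ (by positivity)] at h3
    linarith
  have h3 := mul_nonneg h2 hY
  have h4 : 0 ≤ A * ((2 * Z + Y) ^ 2 + 2 * (X * Y)) := by positivity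
  unfold explicitDensity explicitDensityDeriv
  rw [add_sub_cancel_left] at h1
  linarith

/-! ### Pointwise algebra of gradients -/

lemma gradSq_nonneg (u : L2Box L) (x : Fin D → ℝ) : 0 ≤ gradSq L u x := by
  unfold gradSq gradDot
  exact Finset.sum_nonneg fun _ _ => mul_self_nonneg _

lemma gradDot_comm (u v : L2Box L) (x : Fin D → ℝ) : gradDot L u v x = gradDot L v u x :=
  Finset.sum_congr rfl fun _ _ => mul_comm _ _

lemma gradDot_sq_le (u v : L2Box L) (x : Fin D → ℝ) :
    gradDot L u v x ^ 2 ≤ gradSq L u x * gradSq L v x := by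
  have := Finset.sum_mul_sq_le_sq_mul_sq Finset.univ (fun i => weakPartial L i u x)
    (fun i => weakPartial L i v x)
  simpa only [sq, gradDot, gradSq] using this

lemma abs_gradDot_le (u v : L2Box L) (x : Fin D → ℝ) :
    |gradDot L u v x| ≤ gradSq L u x + gradSq L v x := by
  have hX := gradSq_nonneg u x
  have hY := gradSq_nonneg v x
  refine abs_le_of_sq_le_sq ?_ (by positivity)
  nlinarith [gradDot_sq_le u v x]

lemma ae_gradDot_add_smul (hL : ∀ i, 0 < L i) {u h : L2Box L} (hu : MemH1per L u)
    (hh : MemH1per L h) (w : L2Box L) (t : ℝ) : ∀ᵐ x ∂(boxMeasure L),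
      gradDot L w (u + t • h) x = gradDot L w u x + t * gradDot L w h x := by
  have h1 : ∀ᵐ x ∂(boxMeasure L), ∀ i,
      weakPartial L i (u + t • h) x = weakPartial L i u x + t * weakPartial L i h x := by
    rw [ae_all_iff]
    intro i
    rw [weakPartial_add hL hu (hh.smul t), weakPartial_smul hL hh]
    filter_upwards [Lp.coeFn_add (weakPartial L i u) (t • weakPartial L i h),
      Lp.coeFn_smul t (weakPartial L i h)] with x h2 h3
    rw [h2, Pi.add_apply, h3, Pi.smul_apply, smul_eq_mul]
  filter_upwards [h1] with x hx
  simp only [gradDot, hx, Finset.mul_sum, ← Finset.sum_add_distrib]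
  exact Finset.sum_congr rfl fun i _ => by ring

lemma ae_gradSq_add_smul (hL : ∀ i, 0 < L i) {u h : L2Box L} (hu : MemH1per L u)
    (hh : MemH1per L h) (t : ℝ) : ∀ᵐ x ∂(boxMeasure L),
      gradSq L (u + t • h) x
        = gradSq L u x + 2 * (t * gradDot L u h x) + t ^ 2 * gradSq L h x := by
  filter_upwards [ae_gradDot_add_smul hL hu hh (u + t • h) t, ae_gradDot_add_smul hL hu hh u t,
    ae_gradDot_add_smul hL hu hh h t] with x h1 h2 h3
  rw [gradSq, h1, gradDot_comm (u + t • h) u, h2, gradDot_comm (u + t • h) h, h3, gradDot_comm h u,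
    gradSq, gradSq]
  ring

lemma ae_add_smul (u h : L2Box L) (t : ℝ) :
    ∀ᵐ x ∂(boxMeasure L), (u + t • h) x = u x + t * h x := by
  filter_upwards [Lp.coeFn_add u (t • h), Lp.coeFn_smul t h] with x h1 h2
  rw [h1, Pi.add_apply, h2, Pi.smul_apply, smul_eq_mul]

/-! ### Integrability -/

lemma integrable_gradDot (u v : L2Box L) : Integrable (gradDot L u v) (boxMeasure L) :=
  integrable_finsetSum _ fun _ _ => integrable_mul_coe _ _

lemma integral_gradSq (u : L2Box L) :
    ∫ x, gradSq L u x ∂(boxMeasure L) = ∑ i, ‖weakPartial L i u‖ ^ 2 := by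
  rw [Finset.sum_congr rfl fun i _ => norm_sq_eq_integral (weakPartial L i u)]
  simp only [gradSq, gradDot, sq]
  exact integral_finsetSum _ fun _ _ => integrable_mul_coe _ _

lemma MemH2per.memLp_gradSq (hD : D < 4) (hL : ∀ i, 0 < L i) {u : L2Box L} (hu : MemH2per L u) :
    MemLp (gradSq L u) 2 (boxMeasure L) := by
  suffices h : ∀ i ∈ Finset.univ, MemLp (fun x => weakPartial L i u x * weakPartial L i u x) 2
      (boxMeasure L) from memLp_finsetSum _ h
  intro i _
  have hm := (aestronglyMeasurable_coe (weakPartial L i u)).mul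
    (aestronglyMeasurable_coe (weakPartial L i u))
  refine (memLp_two_iff_integrable_sq hm).2 ?_
  refine (hu.integrable_weakPartial_pow_four hD hL i).congr
    (Filter.Eventually.of_forall fun x => ?_)
  simp only [Pi.mul_apply]
  ring

lemma MemH2per.memLp_gradDot (hD : D < 4) (hL : ∀ i, 0 < L i) {u v : L2Box L}
    (hu : MemH2per L u) (hv : MemH2per L v) : MemLp (gradDot L u v) 2 (boxMeasure L) := by
  refine ((hu.memLp_gradSq hD hL).add (hv.memLp_gradSq hD hL)).mono
    (integrable_gradDot u v).1 (Filter.Eventually.of_forall fun x => ?_)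
  rw [Real.norm_eq_abs, Real.norm_eq_abs, Pi.add_apply]
  exact (abs_gradDot_le u v x).trans (le_abs_self _)

/-- A continuous function of a function in `H²` is bounded. -/
lemma MemH2per.exists_comp_bound (hD : D < 4) (hL : ∀ i, 0 < L i) {u : L2Box L}
    (hu : MemH2per L u) {f : ℝ → ℝ} (hf : Continuous f) :
    ∃ C : ℝ, ∀ᵐ x ∂(boxMeasure L), ‖f (u x)‖ ≤ C := by
  obtain ⟨R, -, hR⟩ := hu.exists_bound hD hL
  obtain ⟨C, hC⟩ := (isCompact_Icc (a := -R) (b := R)).exists_bound_of_continuousOn hf.continuousOn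
  refine ⟨C, ?_⟩
  filter_upwards [hR] with x hx
  exact hC _ (abs_le.1 hx)

lemma MemH2per.integrable_comp_mul (hD : D < 4) (hL : ∀ i, 0 < L i) {u : L2Box L}
    (hu : MemH2per L u) {f : ℝ → ℝ} (hf : Continuous f) {G : (Fin D → ℝ) → ℝ}
    (hG : Integrable G (boxMeasure L)) : Integrable (fun x => f (u x) * G x) (boxMeasure L) := by
  obtain ⟨C, hC⟩ := hu.exists_comp_bound hD hL hf
  exact hG.bdd_mul (hf.comp_aestronglyMeasurable (aestronglyMeasurable_coe u)) hC

lemma MemH2per.integrable_comp (hD : D < 4) (hL : ∀ i, 0 < L i) {u : L2Box L}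
    (hu : MemH2per L u) {f : ℝ → ℝ} (hf : Continuous f) :
    Integrable (fun x => f (u x)) (boxMeasure L) := by
  simpa using hu.integrable_comp_mul hD hL hf (integrable_const (1 : ℝ))

lemma integrable_sq_coe (u : L2Box L) : Integrable (fun x => u x ^ 2) (boxMeasure L) := by
  simpa only [sq] using integrable_mul_coe u u

lemma MemH2per.integrable_convexDensity (hD : D < 4) (hL : ∀ i, 0 < L i) (ε η A : ℝ)
    {u : L2Box L} (hu : MemH2per L u) : Integrable (fun x =>
      convexDensity ε η A (u x) (gradSq L u x) (laplacian L u x)) (boxMeasure L) := by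
  have h1 := hu.integrable_comp hD hL (f := fun a => (ε ^ 2)⁻¹ / 2 * a ^ 6 + A * a ^ 4
    + ((ε ^ 2)⁻¹ + η) / 2 * a ^ 2) (by fun_prop)
  have h2 := hu.integrable_comp_mul hD hL (f := fun a => 3 * a ^ 2) (by fun_prop)
    (integrable_gradDot u u)
  have h3 := ((hu.memLp_gradSq hD hL).integrable_sq).const_mul A
  have h4 := (integrable_sq_coe (laplacian L u)).const_mul (ε ^ 2 / 2)
  exact ((h1.add h2).add h3).add h4

lemma MemH2per.integrable_explicitDensity (hD : D < 4) (hL : ∀ i, 0 < L i) (ε η A : ℝ)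
    {u : L2Box L} (hu : MemH2per L u) : Integrable (fun x =>
      explicitDensity ε η A (u x) (gradSq L u x)) (boxMeasure L) := by
  have h1 := hu.integrable_comp hD hL (f := fun a => ((ε ^ 2)⁻¹ + η / 4 + A) * a ^ 4)
    (by fun_prop)
  have h2 := (integrable_gradDot u u).const_mul (1 + η * ε ^ 2 / 2)
  have h3 := ((hu.memLp_gradSq hD hL).integrable_sq).const_mul A
  exact (h1.add h2).add h3

/-- The five integrands of the implicit part are integrable. -/
lemma MemH2per.integrable_implicit (hD : D < 4) (hL : ∀ i, 0 < L i) (ε η A : ℝ)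
    {u h : L2Box L} (hu : MemH2per L u) (hh : MemH2per L h) :
    Integrable (fun x => (3 * (ε ^ 2)⁻¹ * u x ^ 5 + 4 * A * u x ^ 3 + ((ε ^ 2)⁻¹ + η) * u x) * h x)
      (boxMeasure L) ∧
    Integrable (fun x => laplacian L u x * laplacian L h x) (boxMeasure L) ∧
    Integrable (fun x => u x * gradSq L u x * h x) (boxMeasure L) ∧
    Integrable (fun x => u x ^ 2 * gradDot L u h x) (boxMeasure L) ∧
    Integrable (fun x => gradSq L u x * gradDot L u h x) (boxMeasure L) := by
  refine ⟨hu.integrable_comp_mul hD hL (f := fun a => 3 * (ε ^ 2)⁻¹ * a ^ 5 + 4 * A * a ^ 3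
      + ((ε ^ 2)⁻¹ + η) * a) (by fun_prop) (integrable_coe h), integrable_mul_coe _ _, ?_,
    hu.integrable_comp_mul hD hL (f := fun a => a ^ 2) (by fun_prop) (integrable_gradDot u h),
    (hu.memLp_gradSq hD hL).integrable_mul (hu.memLp_gradDot hD hL hh)⟩
  simpa only [mul_assoc] using! hu.integrable_comp_mul hD hL (f := fun a => a) continuous_id
    ((hu.memLp_gradSq hD hL).integrable_mul (Lp.memLp h))

lemma MemH2per.integrable_convexDensityDeriv (hD : D < 4) (hL : ∀ i, 0 < L i) (ε η A : ℝ)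
    {u h : L2Box L} (hu : MemH2per L u) (hh : MemH2per L h) : Integrable (fun x =>
      convexDensityDeriv ε η A (u x) (gradSq L u x) (laplacian L u x) (h x) (gradDot L u h x)
        (laplacian L h x)) (boxMeasure L) := by
  obtain ⟨h1, h2, h3, h4, h5⟩ := hu.integrable_implicit hD hL ε η A hh
  exact (((h1.add (h2.const_mul (ε ^ 2))).add (h3.const_mul 6)).add (h4.const_mul 6)).add
    (h5.const_mul (4 * A))

/-- The implicit part is the differential of the convex part of the energy. -/
lemma MemH2per.implicitPart_eq (hD : D < 4) (hL : ∀ i, 0 < L i) (ε η A : ℝ)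
    {u h : L2Box L} (hu : MemH2per L u) (hh : MemH2per L h) :
    implicitPart L ε η A u h = ∫ x, convexDensityDeriv ε η A (u x) (gradSq L u x)
      (laplacian L u x) (h x) (gradDot L u h x) (laplacian L h x) ∂(boxMeasure L) := by
  obtain ⟨h1, h2, h3, h4, h5⟩ := hu.integrable_implicit hD hL ε η A hh
  have h12 := h1.add (h2.const_mul (ε ^ 2))
  have h123 := h12.add (h3.const_mul 6)
  have h1234 := h123.add (h4.const_mul 6)
  simp only [implicitPart, convexDensityDeriv, ← integral_const_mul]
  symm
  exact (integral_add h1234 (h5.const_mul (4 * A))).trans (congrArg₂ _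
    ((integral_add h123 (h4.const_mul 6)).trans (congrArg₂ _ ((integral_add h12
      (h3.const_mul 6)).trans (congrArg₂ _ (integral_add h1 (h2.const_mul (ε ^ 2))) rfl)) rfl)) rfl)

/-- The three integrands of the explicit part are integrable. -/
lemma MemH2per.integrable_explicit (hD : D < 4) (hL : ∀ i, 0 < L i) (ε η A : ℝ)
    {u h : L2Box L} (hu : MemH2per L u) (hh : MemH2per L h) :
    Integrable (fun x => ((4 * (ε ^ 2)⁻¹ + η) * u x ^ 3 + 4 * A * u x ^ 3) * h x)
      (boxMeasure L) ∧
    Integrable (gradDot L u h) (boxMeasure L) ∧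
    Integrable (fun x => gradSq L u x * gradDot L u h x) (boxMeasure L) :=
  ⟨hu.integrable_comp_mul hD hL (f := fun a => (4 * (ε ^ 2)⁻¹ + η) * a ^ 3 + 4 * A * a ^ 3)
      (by fun_prop) (integrable_coe h), integrable_gradDot u h,
    (hu.memLp_gradSq hD hL).integrable_mul (hu.memLp_gradDot hD hL hh)⟩

lemma MemH2per.integrable_explicitDensityDeriv (hD : D < 4) (hL : ∀ i, 0 < L i) (ε η A : ℝ)
    {u h : L2Box L} (hu : MemH2per L u) (hh : MemH2per L h) : Integrable (fun x =>
      explicitDensityDeriv ε η A (u x) (gradSq L u x) (h x) (gradDot L u h x))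
      (boxMeasure L) := by
  obtain ⟨h1, h2, h3⟩ := hu.integrable_explicit hD hL ε η A hh
  exact (h1.add (h2.const_mul (2 + η * ε ^ 2))).add (h3.const_mul (4 * A))

/-- The explicit part is the differential of the explicitly treated part of the energy. -/
lemma MemH2per.explicitPart_eq (hD : D < 4) (hL : ∀ i, 0 < L i) (ε η A : ℝ)
    {u h : L2Box L} (hu : MemH2per L u) (hh : MemH2per L h) :
    explicitPart L ε η A u h = ∫ x, explicitDensityDeriv ε η A (u x) (gradSq L u x)
      (h x) (gradDot L u h x) ∂(boxMeasure L) := by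
  obtain ⟨h1, h2, h3⟩ := hu.integrable_explicit hD hL ε η A hh
  have h12 := h1.add (h2.const_mul (2 + η * ε ^ 2))
  simp only [explicitPart, explicitDensityDeriv, ← integral_const_mul]
  symm
  exact (integral_add h12 (h3.const_mul (4 * A))).trans (congrArg₂ _
    (integral_add h1 (h2.const_mul (2 + η * ε ^ 2))) rfl)

lemma ae_laplacian_add_smul (hL : ∀ i, 0 < L i) {u h : L2Box L} (hu : MemH2per L u)
    (hh : MemH2per L h) (t : ℝ) : ∀ᵐ x ∂(boxMeasure L),
      laplacian L (u + t • h) x = laplacian L u x + t * laplacian L h x := by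
  rw [laplacian_add hL hu (hh.smul hL t), laplacian_smul hL hh]
  exact ae_add_smul _ _ t

/-! ### Linearity in the test function -/

lemma MemH2per.implicitPart_add_smul (hD : D < 4) (hL : ∀ i, 0 < L i) (ε η A : ℝ)
    {u h k : L2Box L} (hu : MemH2per L u) (hh : MemH2per L h) (hk : MemH2per L k) (t : ℝ) :
    implicitPart L ε η A u (h + t • k)
      = implicitPart L ε η A u h + t * implicitPart L ε η A u k := by
  rw [hu.implicitPart_eq hD hL ε η A (hh.add hL (hk.smul hL t)), hu.implicitPart_eq hD hL ε η A hh,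
    hu.implicitPart_eq hD hL ε η A hk, ← integral_const_mul,
    ← integral_add (hu.integrable_convexDensityDeriv hD hL ε η A hh)
      ((hu.integrable_convexDensityDeriv hD hL ε η A hk).const_mul t)]
  refine integral_congr_ae ?_
  filter_upwards [ae_add_smul h k t, ae_gradDot_add_smul hL hh.1 hk.1 u t,
    ae_laplacian_add_smul hL hh hk t] with x h1 h2 h3
  rw [h1, h2, h3]
  unfold convexDensityDeriv
  ring

lemma MemH2per.explicitPart_add_smul (hD : D < 4) (hL : ∀ i, 0 < L i) (ε η A : ℝ)
    {u h k : L2Box L} (hu : MemH2per L u) (hh : MemH2per L h) (hk : MemH2per L k) (t : ℝ) :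
    explicitPart L ε η A u (h + t • k)
      = explicitPart L ε η A u h + t * explicitPart L ε η A u k := by
  rw [hu.explicitPart_eq hD hL ε η A (hh.add hL (hk.smul hL t)), hu.explicitPart_eq hD hL ε η A hh,
    hu.explicitPart_eq hD hL ε η A hk, ← integral_const_mul,
    ← integral_add (hu.integrable_explicitDensityDeriv hD hL ε η A hh)
      ((hu.integrable_explicitDensityDeriv hD hL ε η A hk).const_mul t)]
  refine integral_congr_ae ?_
  filter_upwards [ae_add_smul h k t, ae_gradDot_add_smul hL hh.1 hk.1 u t] with x h1 h2
  rw [h1, h2]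
  unfold explicitDensityDeriv
  ring

/-! ### The convex splitting of the energy -/

/-- The convex part of the energy. -/
noncomputable def convexEnergy (L : Fin D → ℝ) (ε η A : ℝ) (u : L2Box L) : ℝ :=
  ∫ x, convexDensity ε η A (u x) (gradSq L u x) (laplacian L u x) ∂(boxMeasure L)

/-- The part of the energy which is treated explicitly, up to sign. -/
noncomputable def explicitEnergy (L : Fin D → ℝ) (ε η A : ℝ) (u : L2Box L) : ℝ :=
  ∫ x, explicitDensity ε η A (u x) (gradSq L u x) ∂(boxMeasure L)

/-- The convex splitting: the energy is the difference of two convex functionals. The mixed term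
`∫ (u³ - u) Δu` of the square is integrated by parts. -/
lemma MemH2per.energyFCH_eq (hD : D < 4) (hL : ∀ i, 0 < L i) {ε : ℝ} (hε : 0 < ε) (η A : ℝ)
    {u : L2Box L} (hu : MemH2per L u) :
    energyFCH L ε η u = convexEnergy L ε η A u - explicitEnergy L ε η A u := by
  have hcross : ∫ x, (u x ^ 3 - u x) * laplacian L u x ∂(boxMeasure L)
      = -∫ x, (3 * u x ^ 2 - 1) * gradSq L u x ∂(boxMeasure L) := by
    have h1 : ∫ x, (u x ^ 3 - u x) * laplacian L u x ∂(boxMeasure L)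
        = ∑ i, ∫ x, weakPartial L i (weakPartial L i u) x * (u x ^ 3 - u x) ∂(boxMeasure L) := by
      rw [← integral_finsetSum]
      · refine integral_congr_ae ?_
        filter_upwards [Lp.coeFn_fun_finsetSum Finset.univ
          fun i => weakPartial L i (weakPartial L i u)] with x hx
        rw [laplacian, hx, Finset.mul_sum]
        exact Finset.sum_congr rfl fun i _ => mul_comm _ _
      · intro i _
        refine (hu.integrable_comp_mul hD hL (f := fun a => a ^ 3 - a) (by fun_prop)
          (integrable_coe (weakPartial L i (weakPartial L i u)))).congr
          (Filter.Eventually.of_forall fun x => mul_comm _ _)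
    have h2 : ∫ x, (3 * u x ^ 2 - 1) * gradSq L u x ∂(boxMeasure L)
        = ∑ i, ∫ x, (3 * u x ^ 2 - 1) * weakPartial L i u x ^ 2 ∂(boxMeasure L) := by
      rw [← integral_finsetSum]
      · refine integral_congr_ae (Filter.Eventually.of_forall fun x => ?_)
        simp only [gradSq, gradDot, Finset.mul_sum, sq]
      · intro i _
        exact hu.integrable_comp_mul hD hL (f := fun a => 3 * a ^ 2 - 1) (by fun_prop)
          (integrable_sq_coe _)
    rw [h1, h2, ← Finset.sum_neg_distrib]
    exact Finset.sum_congr rfl fun i _ => hu.integral_cubic_mul_second hD hL i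
  have i1 := hu.integrable_comp hD hL (f := fun a => (a ^ 3 - a) ^ 2) (by fun_prop)
  have i2 := hu.integrable_comp_mul hD hL (f := fun a => a ^ 3 - a) (by fun_prop)
    (integrable_coe (laplacian L u))
  have i3 := integrable_sq_coe (laplacian L u)
  have i4 := hu.integrable_comp_mul hD hL (f := fun a => 3 * a ^ 2 - 1) (by fun_prop)
    (integrable_gradDot u u)
  have i5 : Integrable (fun x => 1 / 4 * u x ^ 4 - 1 / 2 * u x ^ 2 + ε ^ 2 / 2 * gradSq L u x)
      (boxMeasure L) :=
    (hu.integrable_comp hD hL (f := fun a => 1 / 4 * a ^ 4 - 1 / 2 * a ^ 2) (by fun_prop)).add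
      ((integrable_gradDot u u).const_mul (ε ^ 2 / 2))
  have hsq : ∫ x, (u x ^ 3 - u x - ε ^ 2 * laplacian L u x) ^ 2 ∂(boxMeasure L)
      = ∫ x, ((u x ^ 3 - u x) ^ 2 + 2 * ε ^ 2 * ((3 * u x ^ 2 - 1) * gradSq L u x)
        + ε ^ 4 * laplacian L u x ^ 2) ∂(boxMeasure L) := by
    have h1 : ∫ x, (u x ^ 3 - u x - ε ^ 2 * laplacian L u x) ^ 2 ∂(boxMeasure L)
        = ∫ x, ((u x ^ 3 - u x) ^ 2 + -2 * ε ^ 2 * ((u x ^ 3 - u x) * laplacian L u x)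
          + ε ^ 4 * laplacian L u x ^ 2) ∂(boxMeasure L) :=
      integral_congr_ae (Filter.Eventually.of_forall fun x => by simp only; ring)
    have h2 := integral_add (i1.add (i2.const_mul (-2 * ε ^ 2))) (i3.const_mul (ε ^ 4))
    have h3 := integral_add i1 (i2.const_mul (-2 * ε ^ 2))
    have h4 := integral_add (i1.add (i4.const_mul (2 * ε ^ 2))) (i3.const_mul (ε ^ 4))
    have h5 := integral_add i1 (i4.const_mul (2 * ε ^ 2))
    simp only [Pi.add_apply, integral_const_mul] at h2 h3 h4 h5
    change _ = ∫ x, ((u x ^ 3 - u x) ^ 2 + 2 * ε ^ 2 * ((3 * u x ^ 2 - 1) * gradDot L u u x)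
        + ε ^ 4 * laplacian L u x ^ 2) ∂(boxMeasure L)
    rw [h1, h2, h3, h4, h5, hcross]
    simp only [gradSq]
    ring
  have i6 : Integrable (fun x => (u x ^ 3 - u x) ^ 2 + 2 * ε ^ 2 * ((3 * u x ^ 2 - 1)
      * gradSq L u x) + ε ^ 4 * laplacian L u x ^ 2) (boxMeasure L) :=
    (i1.add (i4.const_mul (2 * ε ^ 2))).add (i3.const_mul (ε ^ 4))
  rw [energyFCH, energyCH, hsq, convexEnergy, explicitEnergy, ← integral_const_mul,
    ← integral_const_mul, ← integral_sub (i6.const_mul _) (i5.const_mul _),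
    ← integral_sub (hu.integrable_convexDensity hD hL ε η A)
      (hu.integrable_explicitDensity hD hL ε η A)]
  refine integral_congr_ae (Filter.Eventually.of_forall fun x => ?_)
  simp only [convexDensity, explicitDensity]
  field_simp
  ring

/-- The convex part of the energy lies above its tangents, with a quadratic surplus. -/
lemma convexEnergy_tangent (hD : D < 4) (hL : ∀ i, 0 < L i) {ε η A : ℝ}
    (hη : 0 ≤ (ε ^ 2)⁻¹ + η) (hA : 1 ≤ A) {u h : L2Box L} (hu : MemH2per L u)
    (hh : MemH2per L h) :
    convexEnergy L ε η A u + implicitPart L ε η A u h + ε ^ 2 / 2 * ‖laplacian L h‖ ^ 2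
      ≤ convexEnergy L ε η A (u + h) := by
  have hadd := hu.add hL hh
  have i1 := hu.integrable_convexDensity hD hL ε η A
  have i2 := hu.integrable_convexDensityDeriv hD hL ε η A hh
  have i3 : Integrable (fun x => ε ^ 2 / 2 * laplacian L h x ^ 2) (boxMeasure L) :=
    (integrable_sq_coe (laplacian L h)).const_mul _
  have i12 : Integrable (fun x => convexDensity ε η A (u x) (gradSq L u x) (laplacian L u x)
      + convexDensityDeriv ε η A (u x) (gradSq L u x) (laplacian L u x) (h x) (gradDot L u h x)
        (laplacian L h x)) (boxMeasure L) := i1.add i2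
  rw [hu.implicitPart_eq hD hL ε η A hh, norm_sq_eq_integral, ← integral_const_mul, convexEnergy,
    convexEnergy, ← integral_add i1 i2, ← integral_add i12 i3]
  refine integral_mono_ae (i12.add i3)
    (hadd.integrable_convexDensity hD hL ε η A) ?_
  filter_upwards [ae_add_smul u h 1, ae_gradSq_add_smul hL hu.1 hh.1 1,
    ae_laplacian_add_smul hL hu hh 1] with x h1 h2 h3
  simp only [one_smul, one_mul, one_pow] at h1 h2 h3
  rw [h1, h2, h3]
  exact convexDensity_tangent hη hA (gradSq_nonneg u x) (gradSq_nonneg h x) (gradDot_sq_le u h x)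

/-- The explicitly treated part of the energy lies above its tangents. -/
lemma explicitEnergy_tangent (hD : D < 4) (hL : ∀ i, 0 < L i) {ε η A : ℝ} (hε : 0 < ε)
    (hη : 0 ≤ (ε ^ 2)⁻¹ + η) (hA : 1 ≤ A) {u h : L2Box L} (hu : MemH2per L u)
    (hh : MemH2per L h) :
    explicitEnergy L ε η A u + explicitPart L ε η A u h ≤ explicitEnergy L ε η A (u + h) := by
  have hadd := hu.add hL hh
  rw [hu.explicitPart_eq hD hL ε η A hh, explicitEnergy, explicitEnergy,
    ← integral_add (hu.integrable_explicitDensity hD hL ε η A)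
      (hu.integrable_explicitDensityDeriv hD hL ε η A hh)]
  refine integral_mono_ae ((hu.integrable_explicitDensity hD hL ε η A).add
      (hu.integrable_explicitDensityDeriv hD hL ε η A hh))
    (hadd.integrable_explicitDensity hD hL ε η A) ?_
  filter_upwards [ae_add_smul u h 1, ae_gradSq_add_smul hL hu.1 hh.1 1] with x h1 h2
  simp only [one_smul, one_mul, one_pow] at h1 h2
  rw [h1, h2]
  exact explicitDensity_tangent hε hη hA (gradSq_nonneg u x) (gradSq_nonneg h x)

/-! ### Local bounds and continuity along lines -/

/-- The quantities entering the energy are bounded uniformly on a ball around `u` for the norm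
`‖Δ·‖`, by the Sobolev embeddings. -/
lemma exists_local_bound (hD : D < 4) (hL : ∀ i, 0 < L i) {u : L2Box L} (hu : MemH2per L u) :
    ∃ R : ℝ, 0 ≤ R ∧ ∀ h : L2Box L, MemH2per L h → MeanZero L h → ‖laplacian L h‖ ≤ 1 →
      (∀ᵐ x ∂(boxMeasure L), |(u + h) x| ≤ R) ∧
      ∫ x, gradSq L (u + h) x ^ 2 ∂(boxMeasure L) ≤ R ∧
      ∫ x, laplacian L (u + h) x ^ 2 ∂(boxMeasure L) ≤ R := by
  obtain ⟨C, hC, hsob⟩ := exists_sobolev_bound hD hL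
  obtain ⟨S, hS, hSu⟩ := hu.exists_bound hD hL
  set G := ∫ x, gradSq L u x ^ 2 ∂(boxMeasure L)
  refine ⟨(S + C) + (18 * G + 18 * (D * (D * (9 * C ^ 2)))) + (‖laplacian L u‖ + 1) ^ 2,
    by positivity, fun h hh hm hh1 => ?_⟩
  obtain ⟨-, hb, h4⟩ := hsob h hh hm
  have hCh : C * ‖laplacian L h‖ ≤ C := mul_le_of_le_one_right hC hh1
  refine ⟨?_, ?_, ?_⟩
  · filter_upwards [hSu, hb, Lp.coeFn_add u h] with x h1 h2 h3
    rw [h3, Pi.add_apply]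
    have := abs_add_le (u x) (h x)
    have : 0 ≤ 18 * G + 18 * (D * (D * (9 * C ^ 2))) + (‖laplacian L u‖ + 1) ^ 2 := by positivity
    linarith
  · have hle : ∫ x, gradSq L h x ^ 2 ∂(boxMeasure L) ≤ D * (D * (9 * C ^ 2)) := by
      have i4 : Integrable (fun x => ∑ i, weakPartial L i h x ^ 4) (boxMeasure L) :=
        integrable_finsetSum _ fun i _ => (h4 i).1
      have h1 : ∫ x, gradSq L h x ^ 2 ∂(boxMeasure L)
          ≤ ∫ x, D * ∑ i, weakPartial L i h x ^ 4 ∂(boxMeasure L) := by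
        refine integral_mono (hh.memLp_gradSq hD hL).integrable_sq (i4.const_mul _) fun x => ?_
        have := sq_sum_le_card_mul_sum_sq (s := Finset.univ)
          (f := fun i => weakPartial L i h x * weakPartial L i h x)
        simp only [Finset.card_univ, Fintype.card_fin] at this
        refine this.trans (le_of_eq ?_)
        congr 1
        exact Finset.sum_congr rfl fun i _ => by ring
      refine h1.trans ?_
      rw [integral_const_mul, integral_finsetSum _ fun i _ => (h4 i).1]
      refine mul_le_mul_of_nonneg_left ?_ (Nat.cast_nonneg _)
      have h2 : ∀ i ∈ Finset.univ, ∫ x, weakPartial L i h x ^ 4 ∂(boxMeasure L) ≤ 9 * C ^ 2 :=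
        fun i _ => (h4 i).2.trans
          (mul_le_of_le_one_right (by positivity) (pow_le_one₀ (norm_nonneg _) hh1))
      refine (Finset.sum_le_sum h2).trans (le_of_eq ?_)
      simp
    have hX := (hu.memLp_gradSq hD hL).integrable_sq
    have hY := (hh.memLp_gradSq hD hL).integrable_sq
    have h5 : ∫ x, gradSq L (u + h) x ^ 2 ∂(boxMeasure L)
        ≤ ∫ x, (18 * gradSq L u x ^ 2 + 18 * gradSq L h x ^ 2) ∂(boxMeasure L) := by
      refine integral_mono_ae ((hu.add hL hh).memLp_gradSq hD hL).integrable_sq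
        ((hX.const_mul 18).add (hY.const_mul 18)) ?_
      filter_upwards [ae_gradSq_add_smul hL hu.1 hh.1 1] with x hx
      have h0 := gradSq_nonneg (u + h) x
      have h6 := abs_le.1 (abs_gradDot_le u h x)
      simp only [one_smul, one_mul, one_pow] at hx
      have h7 : gradSq L (u + h) x ≤ 3 * (gradSq L u x + gradSq L h x) := by linarith
      have h8 := pow_le_pow_left₀ h0 h7 2
      nlinarith [sq_nonneg (gradSq L u x - gradSq L h x)]
    rw [integral_add (hX.const_mul 18) (hY.const_mul 18), integral_const_mul,
      integral_const_mul] at h5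
    have : 0 ≤ (S + C) + (‖laplacian L u‖ + 1) ^ 2 := by positivity
    linarith
  · rw [← norm_sq_eq_integral, laplacian_add hL hu hh]
    have h1 : ‖laplacian L u + laplacian L h‖ ≤ ‖laplacian L u‖ + 1 :=
      (norm_add_le _ _).trans (by linarith)
    have h2 := pow_le_pow_left₀ (norm_nonneg _) h1 2
    have : 0 ≤ (S + C) + (18 * G + 18 * (D * (D * (9 * C ^ 2)))) := by positivity
    linarith

lemma abs_pow_le_of_abs_le {a R : ℝ} (h : |a| ≤ R) (n : ℕ) : a ^ (2 * n) ≤ R ^ (2 * n) := by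
  rw [pow_mul, pow_mul, ← sq_abs a]
  gcongr

lemma exists_convexEnergy_bound (hD : D < 4) (hL : ∀ i, 0 < L i) {ε η A : ℝ}
    (hη : 0 ≤ (ε ^ 2)⁻¹ + η) (hA : 1 ≤ A) {u : L2Box L} (hu : MemH2per L u) :
    ∃ C : ℝ, ∀ h : L2Box L, MemH2per L h → MeanZero L h → ‖laplacian L h‖ ≤ 1 →
      convexEnergy L ε η A (u + h) ≤ C := by
  obtain ⟨R, hR, hb⟩ := exists_local_bound hD hL hu
  set c0 := (ε ^ 2)⁻¹ / 2 * R ^ 6 + A * R ^ 4 + ((ε ^ 2)⁻¹ + η) / 2 * R ^ 2 + 3 * R ^ 2 with hc0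
  refine ⟨boxVolume L * c0 + (3 * R ^ 2 + A) * R + ε ^ 2 / 2 * R, fun h hh hm hh1 => ?_⟩
  obtain ⟨h1, h2, h3⟩ := hb h hh hm hh1
  have hadd := hu.add hL hh
  have iX := ((hadd.memLp_gradSq hD hL).integrable_sq).const_mul (3 * R ^ 2 + A)
  have iL := (integrable_sq_coe (laplacian L (u + h))).const_mul (ε ^ 2 / 2)
  have ic : Integrable (fun _ : Fin D → ℝ => c0) (boxMeasure L) := integrable_const _
  have icX : Integrable (fun x => c0 + (3 * R ^ 2 + A) * gradSq L (u + h) x ^ 2)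
    (boxMeasure L) := ic.add iX
  have hle : convexEnergy L ε η A (u + h) ≤ ∫ x, (c0 + (3 * R ^ 2 + A) * gradSq L (u + h) x ^ 2
      + ε ^ 2 / 2 * laplacian L (u + h) x ^ 2) ∂(boxMeasure L) := by
    refine integral_mono_ae (hadd.integrable_convexDensity hD hL ε η A) (icX.add iL) ?_
    filter_upwards [h1] with x hx
    have hX := gradSq_nonneg (u + h) x
    have p2 : (u + h) x ^ 2 ≤ R ^ 2 := abs_pow_le_of_abs_le hx 1
    have p4 : (u + h) x ^ 4 ≤ R ^ 4 := abs_pow_le_of_abs_le hx 2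
    have p6 : (u + h) x ^ 6 ≤ R ^ 6 := abs_pow_le_of_abs_le hx 3
    have h6 := mul_le_mul_of_nonneg_left p6 (show 0 ≤ (ε ^ 2)⁻¹ / 2 by positivity)
    have h4 := mul_le_mul_of_nonneg_left p4 (show 0 ≤ A by linarith)
    have h5 := mul_le_mul_of_nonneg_left p2 (show 0 ≤ ((ε ^ 2)⁻¹ + η) / 2 by linarith)
    have h7 := mul_le_mul_of_nonneg_right p2 hX
    have h8 : R ^ 2 * gradSq L (u + h) x ≤ R ^ 2 * (1 + gradSq L (u + h) x ^ 2) :=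
      mul_le_mul_of_nonneg_left (by nlinarith) (sq_nonneg R)
    simp only [convexDensity, hc0]
    linarith
  rw [integral_add icX iL, integral_add ic iX, integral_const_mul, integral_const_mul,
    integral_const_box hL] at hle
  have h4 := mul_le_mul_of_nonneg_left h2 (show 0 ≤ 3 * R ^ 2 + A by positivity)
  have h5 := mul_le_mul_of_nonneg_left h3 (show 0 ≤ ε ^ 2 / 2 by positivity)
  linarith

lemma exists_explicitEnergy_bound (hD : D < 4) (hL : ∀ i, 0 < L i) (ε η A : ℝ)
    {u : L2Box L} (hu : MemH2per L u) :
    ∃ C : ℝ, ∀ h : L2Box L, MemH2per L h → MeanZero L h → ‖laplacian L h‖ ≤ 1 →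
      explicitEnergy L ε η A (u + h) ≤ C := by
  obtain ⟨R, hR, hb⟩ := exists_local_bound hD hL hu
  set c0 := |(ε ^ 2)⁻¹ + η / 4 + A| * R ^ 4 + |1 + η * ε ^ 2 / 2| with hc0
  set c1 := |1 + η * ε ^ 2 / 2| + |A| with hc1
  refine ⟨boxVolume L * c0 + c1 * R, fun h hh hm hh1 => ?_⟩
  obtain ⟨h1, h2, -⟩ := hb h hh hm hh1
  have hadd := hu.add hL hh
  have iX := ((hadd.memLp_gradSq hD hL).integrable_sq).const_mul c1
  have ic : Integrable (fun _ : Fin D → ℝ => c0) (boxMeasure L) := integrable_const _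
  have hle : explicitEnergy L ε η A (u + h) ≤ ∫ x, (c0 + c1 * gradSq L (u + h) x ^ 2)
      ∂(boxMeasure L) := by
    refine integral_mono_ae (hadd.integrable_explicitDensity hD hL ε η A) (ic.add iX) ?_
    filter_upwards [h1] with x hx
    have hX := gradSq_nonneg (u + h) x
    have h4 : ((ε ^ 2)⁻¹ + η / 4 + A) * (u + h) x ^ 4 ≤ |(ε ^ 2)⁻¹ + η / 4 + A| * R ^ 4 :=
      mul_le_mul (le_abs_self _) (abs_pow_le_of_abs_le hx 2) (by positivity) (abs_nonneg _)
    have h5 : (1 + η * ε ^ 2 / 2) * gradSq L (u + h) x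
        ≤ |1 + η * ε ^ 2 / 2| * (1 + gradSq L (u + h) x ^ 2) :=
      mul_le_mul (le_abs_self _) (by nlinarith) hX (abs_nonneg _)
    have h6 := mul_le_mul_of_nonneg_right (le_abs_self A) (sq_nonneg (gradSq L (u + h) x))
    simp only [explicitDensity, hc0, hc1]
    linarith
  rw [integral_add ic iX, integral_const_mul, integral_const_box hL] at hle
  have h4 := mul_le_mul_of_nonneg_left h2 (show 0 ≤ c1 by positivity)
  linarith

/-- The implicit part is continuous along lines, by dominated convergence. -/
lemma continuousAt_implicitPart (hD : D < 4) (hL : ∀ i, 0 < L i) (ε η A : ℝ)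
    {u h : L2Box L} (hu : MemH2per L u) (hh : MemH2per L h) :
    ContinuousAt (fun t : ℝ => implicitPart L ε η A (u + t • h) h) 0 := by
  let G : ℝ → (Fin D → ℝ) → ℝ := fun t x => convexDensityDeriv ε η A (u x + t * h x)
    (gradSq L u x + 2 * (t * gradDot L u h x) + t ^ 2 * gradSq L h x)
    (laplacian L u x + t * laplacian L h x) (h x) (gradDot L h u x + t * gradDot L h h x)
    (laplacian L h x)
  have hmem : ∀ t : ℝ, MemH2per L (u + t • h) := fun t => hu.add hL (hh.smul hL t)
  have hae : ∀ t : ℝ, (fun x => convexDensityDeriv ε η A ((u + t • h) x) (gradSq L (u + t • h) x)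
      (laplacian L (u + t • h) x) (h x) (gradDot L (u + t • h) h x) (laplacian L h x))
      =ᵐ[boxMeasure L] G t := fun t => by
    filter_upwards [ae_add_smul u h t, ae_gradSq_add_smul hL hu.1 hh.1 t,
      ae_laplacian_add_smul hL hu hh t, ae_gradDot_add_smul hL hu.1 hh.1 h t] with x h1 h2 h3 h4
    rw [h1, h2, h3, gradDot_comm (u + t • h) h, h4]
  have heq : (fun t : ℝ => implicitPart L ε η A (u + t • h) h)
      = fun t => ∫ x, G t x ∂(boxMeasure L) := funext fun t => by
    rw [(hmem t).implicitPart_eq hD hL ε η A hh]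
    exact integral_congr_ae (hae t)
  rw [heq]
  obtain ⟨S, hS, hSu⟩ := hu.exists_bound hD hL
  obtain ⟨S', hS', hSh⟩ := hh.exists_bound hD hL
  set R := S + S'
  -- For `|t| ≤ 1` the squared gradient of `u + t h` and its inner product with the gradient of `h`
  -- are bounded by multiples of the square-integrable function `Q`.
  let Q : (Fin D → ℝ) → ℝ := fun x => gradSq L u x + gradSq L h x
  have hQ : MemLp Q 2 (boxMeasure L) := (hu.memLp_gradSq hD hL).add (hh.memLp_gradSq hD hL)
  let bound : (Fin D → ℝ) → ℝ := fun x =>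
    (|3 * (ε ^ 2)⁻¹| * R ^ 5 + |4 * A| * R ^ 3 + |(ε ^ 2)⁻¹ + η| * R) * R
      + (36 * R ^ 2) * Q x + |4 * A| * 6 * Q x ^ 2
      + ε ^ 2 * (|laplacian L u x * laplacian L h x| + laplacian L h x ^ 2)
  refine continuousAt_of_dominated (bound := bound) (Filter.Eventually.of_forall fun t => ?_) ?_ ?_
    (Filter.Eventually.of_forall fun x => ?_)
  · exact ((hmem t).integrable_convexDensityDeriv hD hL ε η A hh).1.congr (hae t)
  · have hnear : ∀ᶠ t : ℝ in nhds 0, |t| ≤ 1 := by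
      filter_upwards [Metric.closedBall_mem_nhds (0 : ℝ) one_pos] with t ht
      simpa using ht
    filter_upwards [hnear] with t ht
    filter_upwards [hSu, hSh] with x h1 h2
    have hX := gradSq_nonneg u x
    have hY := gradSq_nonneg h x
    have hZ := abs_gradDot_le u h x
    have ha : |u x + t * h x| ≤ R := by
      refine (abs_add_le _ _).trans (add_le_add h1 ?_)
      rw [abs_mul]
      exact (mul_le_of_le_one_left (abs_nonneg _) ht).trans h2
    have hb : |h x| ≤ R := by linarith
    have ht2 : t ^ 2 ≤ 1 := by rw [← sq_abs]; exact pow_le_one₀ (abs_nonneg _) ht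
    have hXb : |gradSq L u x + 2 * (t * gradDot L u h x) + t ^ 2 * gradSq L h x| ≤ 3 * Q x := by
      have h3 : |t * gradDot L u h x| ≤ gradSq L u x + gradSq L h x := by
        rw [abs_mul]
        exact (mul_le_of_le_one_left (abs_nonneg _) ht).trans hZ
      have h4 : t ^ 2 * gradSq L h x ≤ gradSq L h x := mul_le_of_le_one_left hY ht2
      have h5 : 0 ≤ t ^ 2 * gradSq L h x := by positivity
      have h6 := abs_le.1 h3
      simp only [Q]
      rw [abs_le]
      constructor <;> linarith
    have hZb : |gradDot L h u x + t * gradDot L h h x| ≤ 2 * Q x := by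
      have h3 : |t * gradDot L h h x| ≤ gradSq L h x := by
        rw [abs_mul]
        exact (mul_le_of_le_one_left (abs_nonneg _) ht).trans (abs_of_nonneg hY).le
      rw [gradDot_comm h u]
      refine (abs_add_le _ _).trans ?_
      simp only [Q]
      linarith
    set a := u x + t * h x
    set Xt := gradSq L u x + 2 * (t * gradDot L u h x) + t ^ 2 * gradSq L h x
    set Zt := gradDot L h u x + t * gradDot L h h x
    have e1 : |(3 * (ε ^ 2)⁻¹ * a ^ 5 + 4 * A * a ^ 3 + ((ε ^ 2)⁻¹ + η) * a) * h x|
        ≤ (|3 * (ε ^ 2)⁻¹| * R ^ 5 + |4 * A| * R ^ 3 + |(ε ^ 2)⁻¹ + η| * R) * R := by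
      rw [abs_mul]
      refine mul_le_mul ((abs_add_three _ _ _).trans ?_) hb (abs_nonneg _) (by positivity)
      simp only [abs_mul, abs_pow]
      gcongr
    have e2 : |ε ^ 2 * ((laplacian L u x + t * laplacian L h x) * laplacian L h x)|
        ≤ ε ^ 2 * (|laplacian L u x * laplacian L h x| + laplacian L h x ^ 2) := by
      rw [abs_mul, abs_of_nonneg (sq_nonneg ε)]
      refine mul_le_mul_of_nonneg_left ?_ (sq_nonneg ε)
      rw [add_mul]
      refine (abs_add_le _ _).trans (add_le_add le_rfl ?_)
      rw [mul_assoc, abs_mul, ← sq, abs_of_nonneg (sq_nonneg (laplacian L h x))]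
      exact mul_le_of_le_one_left (sq_nonneg _) ht
    have e3 : |6 * (a * Xt * h x)| ≤ 6 * (R * (3 * Q x) * R) := by
      rw [abs_mul, abs_mul, abs_mul, abs_of_pos (show (0 : ℝ) < 6 by norm_num)]
      gcongr
    have e4 : |6 * (a ^ 2 * Zt)| ≤ 6 * (R ^ 2 * (2 * Q x)) := by
      rw [abs_mul, abs_mul, abs_pow, abs_of_pos (show (0 : ℝ) < 6 by norm_num)]
      gcongr
    have e5 : |4 * A * (Xt * Zt)| ≤ |4 * A| * (3 * Q x * (2 * Q x)) := by
      rw [abs_mul, abs_mul Xt]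
      gcongr
    have hsum := (abs_add_le ((3 * (ε ^ 2)⁻¹ * a ^ 5 + 4 * A * a ^ 3 + ((ε ^ 2)⁻¹ + η) * a) * h x
      + ε ^ 2 * ((laplacian L u x + t * laplacian L h x) * laplacian L h x)
      + 6 * (a * Xt * h x) + 6 * (a ^ 2 * Zt)) (4 * A * (Xt * Zt)))
    have hsum2 := (abs_add_le ((3 * (ε ^ 2)⁻¹ * a ^ 5 + 4 * A * a ^ 3 + ((ε ^ 2)⁻¹ + η) * a) * h x
      + ε ^ 2 * ((laplacian L u x + t * laplacian L h x) * laplacian L h x)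
      + 6 * (a * Xt * h x)) (6 * (a ^ 2 * Zt)))
    have hsum3 := abs_add_three ((3 * (ε ^ 2)⁻¹ * a ^ 5 + 4 * A * a ^ 3
      + ((ε ^ 2)⁻¹ + η) * a) * h x)
      (ε ^ 2 * ((laplacian L u x + t * laplacian L h x) * laplacian L h x)) (6 * (a * Xt * h x))
    rw [Real.norm_eq_abs]
    simp only [G, bound, convexDensityDeriv]
    have hRQ : 0 ≤ R ^ 2 * Q x := by positivity
    linarith
  · refine (((integrable_const _).add ((hQ.integrable (by norm_num)).const_mul _)).add
      (hQ.integrable_sq.const_mul _)).add (((integrable_mul_coe _ _).abs.add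
        (integrable_sq_coe _)).const_mul _)
  · simp only [G, convexDensityDeriv]
    fun_prop

/-! ### The weighted Laplace problem -/

/-- The weighted Dirichlet form `(M(g) ∇u, ∇v)`. -/
noncomputable def mobilityForm (L : Fin D → ℝ) (M : ℝ → ℝ) (g u v : L2Box L) : ℝ :=
  ∫ x, M (g x) * gradDot L u v x ∂(boxMeasure L)

lemma mobilityForm_comm (M : ℝ → ℝ) (g u v : L2Box L) :
    mobilityForm L M g u v = mobilityForm L M g v u := by
  simp only [mobilityForm, gradDot_comm u v]

section Mobility

variable {M : ℝ → ℝ} {g : L2Box L}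

lemma mobilityForm_add_smul (hD : D < 4) (hL : ∀ i, 0 < L i) (hM : Continuous M)
    (hg : MemH2per L g) {v w : L2Box L} (hv : MemH1per L v) (hw : MemH1per L w) (u : L2Box L)
    (t : ℝ) : mobilityForm L M g u (v + t • w)
      = mobilityForm L M g u v + t * mobilityForm L M g u w := by
  have i1 := hg.integrable_comp_mul hD hL hM (integrable_gradDot u v)
  have i2 := hg.integrable_comp_mul hD hL hM (integrable_gradDot u w)
  simp only [mobilityForm]
  rw [← integral_const_mul, ← integral_add i1 (i2.const_mul t)]
  refine integral_congr_ae ?_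
  filter_upwards [ae_gradDot_add_smul hL hv hw u t] with x hx
  rw [hx]
  ring

lemma mobilityForm_self_add_smul (hD : D < 4) (hL : ∀ i, 0 < L i) (hM : Continuous M)
    (hg : MemH2per L g) {v w : L2Box L} (hv : MemH1per L v) (hw : MemH1per L w) (t : ℝ) :
    mobilityForm L M g (v + t • w) (v + t • w) = mobilityForm L M g v v
      + 2 * t * mobilityForm L M g v w + t ^ 2 * mobilityForm L M g w w := by
  rw [mobilityForm_add_smul hD hL hM hg hv hw, mobilityForm_comm _ _ _ v,
    mobilityForm_comm _ _ _ w, mobilityForm_add_smul hD hL hM hg hv hw,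
    mobilityForm_add_smul hD hL hM hg hv hw, mobilityForm_comm _ _ w v]
  ring

lemma mobilityForm_self_nonneg (hMpos : ∀ r, 0 < M r) (u : L2Box L) :
    0 ≤ mobilityForm L M g u u :=
  integral_nonneg fun x => mul_nonneg (hMpos _).le (gradSq_nonneg u x)

/-- The mobility is bounded away from zero along a bounded function. -/
lemma exists_mobilityForm_coercive (hD : D < 4) (hL : ∀ i, 0 < L i) (hM : Continuous M)
    (hMpos : ∀ r, 0 < M r) (hg : MemH2per L g) : ∃ c : ℝ, 0 < c ∧ ∀ u : L2Box L,
      c * ∑ i, ‖weakPartial L i u‖ ^ 2 ≤ mobilityForm L M g u u := by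
  obtain ⟨R, hR, hb⟩ := hg.exists_bound hD hL
  obtain ⟨r, -, hr⟩ := (isCompact_Icc (a := -R) (b := R)).exists_isMinOn
    ⟨0, by constructor <;> linarith⟩ hM.continuousOn
  refine ⟨M r, hMpos r, fun u => ?_⟩
  rw [← integral_gradSq, ← integral_const_mul]
  refine integral_mono_ae ((integrable_gradDot u u).const_mul _)
    (hg.integrable_comp_mul hD hL hM (integrable_gradDot u u)) ?_
  filter_upwards [hb] with x hx
  exact mul_le_mul_of_nonneg_right (hr (abs_le.1 hx)) (gradSq_nonneg u x)

lemma norm_gradMap_sq_le (hL : ∀ i, 0 < L i) (u : H1Zero L) :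
    ‖gradMap hL u‖ ^ 2 ≤ ∑ i, ‖weakPartial L i (u : L2Box L)‖ ^ 2 := by
  have h0 : 0 ≤ ∑ i, ‖weakPartial L i (u : L2Box L)‖ ^ 2 := by positivity
  refine (Real.le_sqrt (norm_nonneg _) h0).1 ?_
  refine (pi_norm_le_iff_of_nonneg (Real.sqrt_nonneg _)).2 fun i => Real.le_sqrt_of_sq_le ?_
  exact Finset.single_le_sum (f := fun i => ‖weakPartial L i (u : L2Box L)‖ ^ 2)
    (fun _ _ => sq_nonneg _) (Finset.mem_univ i)

lemma sum_norm_sq_le_gradMap (hL : ∀ i, 0 < L i) (u : H1Zero L) :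
    ∑ i, ‖weakPartial L i (u : L2Box L)‖ ^ 2 ≤ D * ‖gradMap hL u‖ ^ 2 := by
  have h1 : ∀ i ∈ Finset.univ, ‖weakPartial L i (u : L2Box L)‖ ^ 2 ≤ ‖gradMap hL u‖ ^ 2 :=
    fun i _ => pow_le_pow_left₀ (norm_nonneg _) (norm_le_pi_norm (gradMap hL u) i) 2
  refine (Finset.sum_le_sum h1).trans (le_of_eq ?_)
  simp

lemma exists_abs_mobilityForm_le (hD : D < 4) (hL : ∀ i, 0 < L i) (hM : Continuous M)
    (hg : MemH2per L g) : ∃ C : ℝ, 0 ≤ C ∧ ∀ u v : L2Box L, |mobilityForm L M g u v|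
      ≤ C * (∑ i, ‖weakPartial L i u‖ ^ 2 + ∑ i, ‖weakPartial L i v‖ ^ 2) := by
  obtain ⟨C, hC⟩ := hg.exists_comp_bound hD hL hM
  refine ⟨|C|, abs_nonneg C, fun u v => ?_⟩
  rw [← integral_gradSq, ← integral_gradSq]
  unfold gradSq
  rw [← integral_add (integrable_gradDot u u) (integrable_gradDot v v), ← integral_const_mul]
  refine (abs_integral_le_integral_abs).trans ?_
  refine integral_mono_ae (hg.integrable_comp_mul hD hL hM (integrable_gradDot u v)).abs
    (((integrable_gradDot u u).add (integrable_gradDot v v)).const_mul _) ?_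
  filter_upwards [hC] with x hx
  rw [abs_mul]
  exact mul_le_mul (hx.trans (le_abs_self C)) (abs_gradDot_le u v x) (abs_nonneg _) (abs_nonneg _)

/-- Solvability of the weighted Laplace problem `s ∇·(M(g) ∇w) = f` for right-hand sides of mean
zero, by minimisation of the Dirichlet energy. -/
lemma exists_mobilityForm_solution (hD : D < 4) (hL : ∀ i, 0 < L i) (hM : Continuous M)
    (hMpos : ∀ r, 0 < M r) (hg : MemH2per L g) {s : ℝ} (hs : 0 < s) {f : L2Box L}
    (hf : MeanZero L f) : ∃ w : L2Box L, MemH1per L w ∧ MeanZero L w ∧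
      ∀ ν : L2Box L, MemH1per L ν → s * mobilityForm L M g w ν = -inner ℝ f ν := by
  obtain ⟨c, hc, hcoer⟩ := exists_mobilityForm_coercive hD hL hM hMpos hg
  obtain ⟨C, hC, hbd⟩ := exists_abs_mobilityForm_le hD hL hM hg
  obtain ⟨P, hP, hpoin⟩ := exists_poincare_gradMap hL
  let B : L2Box L → L2Box L → ℝ := mobilityForm L M g
  have hexp : ∀ u h : H1Zero L, B (u + h : H1Zero L) (u + h : H1Zero L)
      = B u u + 2 * B u h + B h h := fun u h => by
    have := mobilityForm_self_add_smul hD hL hM hg u.2.1 h.2.1 1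
    simpa [B] using this
  obtain ⟨w, hw⟩ := exists_critical_point (gradMap hL) (exists_tendsto_gradMap hL)
    (fun w => s / 2 * B w w + inner ℝ f (w : L2Box L))
    (fun w h => s * B w h + inner ℝ f (h : L2Box L)) (c := s / 2 * c) (by positivity)
    (fun u h => by
      have h1 := (mul_le_mul_of_nonneg_left (norm_gradMap_sq_le hL h) hc.le).trans (hcoer h)
      have h2 := mul_le_mul_of_nonneg_left h1 (show 0 ≤ s / 2 by positivity)
      rw [hexp, Submodule.coe_add, inner_add_right]
      simp only [B]
      linarith)
    (fun u => by
      refine ⟨s / 2 * B u u + inner ℝ f (u : L2Box L)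
        + s * (C * (∑ i, ‖weakPartial L i (u : L2Box L)‖ ^ 2 + D))
        + s / 2 * (C * (D + D)) + ‖f‖ * P, fun h hh => ?_⟩
      have hsum : ∑ i, ‖weakPartial L i (h : L2Box L)‖ ^ 2 ≤ D :=
        (sum_norm_sq_le_gradMap hL h).trans
          (mul_le_of_le_one_right (Nat.cast_nonneg _) (pow_le_one₀ (norm_nonneg _) hh))
      have h1 : B u h ≤ C * (∑ i, ‖weakPartial L i (u : L2Box L)‖ ^ 2 + D) :=
        ((le_abs_self _).trans (hbd u h)).trans (by gcongr)
      have h2 : B h h ≤ C * (D + D) := ((le_abs_self _).trans (hbd h h)).trans (by gcongr)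
      have h3 : inner ℝ f (h : L2Box L) ≤ ‖f‖ * P :=
        (real_inner_le_norm _ _).trans (mul_le_mul_of_nonneg_left
          ((hpoin h).trans (mul_le_of_le_one_right hP.le hh)) (norm_nonneg _))
      have h4 := mul_le_mul_of_nonneg_left h1 hs.le
      have h5 := mul_le_mul_of_nonneg_left h2 (show 0 ≤ s / 2 by positivity)
      rw [hexp, Submodule.coe_add, inner_add_right]
      linarith)
    (fun u h t => by
      have h1 := mobilityForm_add_smul hD hL hM hg memH1per_zero h.2.1 (u : L2Box L) t
      have h2 : mobilityForm L M g (u : L2Box L) 0 = 0 := by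
        have := mobilityForm_add_smul hD hL hM hg memH1per_zero memH1per_zero (u : L2Box L) 1
        simpa using this
      rw [zero_add, h2, zero_add] at h1
      simp only [B, Submodule.coe_smul, h1, real_inner_smul_right]
      ring)
    (fun u h => by
      have h1 : ∀ t : ℝ, B (u + t • h : H1Zero L) h = B u h + t * B h h := fun t => by
        simp only [B, Submodule.coe_add, Submodule.coe_smul]
        rw [mobilityForm_comm, mobilityForm_add_smul hD hL hM hg u.2.1 h.2.1,
          mobilityForm_comm _ _ (h : L2Box L) u]
      simp only [h1]
      fun_prop)
  refine ⟨w, w.2.1, w.2.2, fun ν hν => ?_⟩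
  -- Both sides are insensitive to constants, so it is enough to test with mean zero functions.
  have hcν := memH1per_const (L := L) hL (-mean ν)
  have h0 := hw ⟨ν + constLp L (-mean ν), hν.add hcν, meanZero_add_const hL ν⟩
  have h1 : B w (ν + constLp L (-mean ν)) = B w ν := by
    simp only [B, mobilityForm, gradDot, weakPartial_add hL hν hcν, weakPartial_const hL, add_zero]
  have h2 : inner ℝ f (constLp L (-mean ν)) = 0 := by
    rw [← integral_mul_eq_inner]
    have : ∫ x, f x * constLp L (-mean ν) x ∂(boxMeasure L)
        = ∫ x, f x * -mean ν ∂(boxMeasure L) := by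
      refine integral_congr_ae ?_
      filter_upwards [coeFn_constLp (L := L) (-mean ν)] with x hx
      rw [hx]
    rw [this, integral_mul_const, hf, zero_mul]
  simp only [h1, inner_add_right, h2, add_zero] at h0
  simp only [B] at h0
  linarith

end Mobility

/-! ### The scheme -/

/-- `H²_per(Ω)` is dense in `L²(Ω)`. -/
lemma eq_zero_of_inner_H2 (hL : ∀ i, 0 < L i) {u : L2Box L}
    (h : ∀ ψ : L2Box L, MemH2per L ψ → inner ℝ u ψ = 0) : u = 0 := by
  have h1 := (tendsto_const_nhds (x := u)).inner (𝕜 := ℝ) (tendsto_partialSum hL u)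
  have h2 : inner ℝ u u = 0 := by
    refine tendsto_nhds_unique h1 ?_
    simp only [fun F => h _ ((isSmoothPeriodic_partialSum hL F u).memH2per hL)]
    exact tendsto_const_nhds
  exact inner_self_eq_zero.1 h2

lemma inner_constLp (u : L2Box L) (c : ℝ) :
    inner ℝ u (constLp L c) = c * ∫ x, u x ∂(boxMeasure L) := by
  rw [← integral_mul_eq_inner, ← integral_const_mul]
  refine integral_congr_ae ?_
  filter_upwards [coeFn_constLp (L := L) c] with x hx
  rw [hx, mul_comm]

lemma mobilityForm_const (hL : ∀ i, 0 < L i) (M : ℝ → ℝ) (g u : L2Box L) (c : ℝ) :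
    mobilityForm L M g u (constLp L c) = 0 := by
  have h : ∀ᵐ x ∂(boxMeasure L), M (g x) * gradDot L u (constLp L c) x = 0 := by
    filter_upwards [Lp.coeFn_zero ℝ 2 (boxMeasure L)] with x hx
    simp only [gradDot, weakPartial_const hL]
    rw [Finset.sum_eq_zero, mul_zero]
    intro i _
    rw [hx, Pi.zero_apply, mul_zero]
  rw [mobilityForm, integral_congr_ae h, integral_zero]

section Scheme

variable {ε η A s : ℝ} {M : ℝ → ℝ} {g : L2Box L}

lemma IsSchemeStep.inner_add {φ μ : L2Box L} (h : IsSchemeStep L ε η A s M g φ μ) {ν : L2Box L}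
    (hν : MemH1per L ν) : inner ℝ φ ν + s * mobilityForm L M g μ ν = inner ℝ g ν := by
  rw [← integral_mul_eq_inner, ← integral_mul_eq_inner]
  exact h.massBalance ν hν

lemma IsSchemeStep.implicitPart_sub {φ μ : L2Box L} (h : IsSchemeStep L ε η A s M g φ μ)
    {ψ : L2Box L} (hψ : MemH2per L ψ) :
    implicitPart L ε η A φ ψ - inner ℝ μ ψ = explicitPart L ε η A g ψ := by
  rw [← integral_mul_eq_inner]
  exact h.potential ψ hψ

lemma add_neg_one_smul_cancel (u v : L2Box L) : v + (u + (-1 : ℝ) • v) = u := by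
  rw [neg_one_smul]; abel

/-- Mass conservation. -/
lemma IsSchemeStep.meanZero_sub (hL : ∀ i, 0 < L i) {φ μ : L2Box L}
    (h : IsSchemeStep L ε η A s M g φ μ) : MeanZero L (φ + (-1 : ℝ) • g) := by
  have h1 := h.inner_add (memH1per_const hL 1)
  rw [mobilityForm_const hL, inner_constLp, inner_constLp] at h1
  rw [MeanZero, integral_add_coe, integral_smul_coe]
  linarith

lemma MemH2per.implicitPart_neg (hD : D < 4) (hL : ∀ i, 0 < L i) (ε η A : ℝ)
    {u h : L2Box L} (hu : MemH2per L u) (hh : MemH2per L h) :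
    implicitPart L ε η A u ((-1 : ℝ) • h) = -implicitPart L ε η A u h := by
  have h2 := hu.implicitPart_add_smul hD hL ε η A ((hh.smul hL (-1))) hh 1
  have h3 := hu.implicitPart_add_smul hD hL ε η A (memH2per_zero hL) (memH2per_zero hL) 1
  have e1 : (-1 : ℝ) • h + (1 : ℝ) • h = 0 := by rw [← add_smul]; norm_num
  rw [smul_zero, add_zero] at h3
  rw [e1] at h2
  linarith

/-- The tangent inequalities at two functions add up to strong monotonicity. -/
lemma implicitPart_strongly_monotone (hD : D < 4) (hL : ∀ i, 0 < L i)
    (hη : 0 ≤ (ε ^ 2)⁻¹ + η) (hA : 1 ≤ A) {u v : L2Box L} (hu : MemH2per L u)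
    (hv : MemH2per L v) : ε ^ 2 * ‖laplacian L (u + (-1 : ℝ) • v)‖ ^ 2
      ≤ implicitPart L ε η A u (u + (-1 : ℝ) • v) - implicitPart L ε η A v (u + (-1 : ℝ) • v) := by
  set d := u + (-1 : ℝ) • v with hd
  have hdm : MemH2per L d := hu.add hL (hv.smul hL _)
  have h1 := convexEnergy_tangent hD hL hη hA hv hdm
  have h2 := convexEnergy_tangent hD hL hη hA hu (hdm.smul hL (-1))
  have e1 : v + d = u := add_neg_one_smul_cancel u v
  have e2 : u + (-1 : ℝ) • d = v := by rw [hd, neg_one_smul, neg_one_smul]; abel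
  rw [e1] at h1
  rw [e2, hu.implicitPart_neg hD hL ε η A hdm, laplacian_smul hL hdm, norm_smul, norm_neg,
    norm_one, one_mul] at h2
  linarith

/-- The scheme has at most one solution. -/
lemma IsSchemeStep.unique (hD : D < 4) (hL : ∀ i, 0 < L i) (hε : 0 < ε)
    (hη : 0 ≤ (ε ^ 2)⁻¹ + η) (hA : 1 ≤ A) (hs : 0 < s) (hM : Continuous M)
    (hMpos : ∀ r, 0 < M r) (hg : MemH2per L g) {φ μ φ' μ' : L2Box L}
    (h : IsSchemeStep L ε η A s M g φ μ) (hφ : MemH2per L φ) (hμ : MemH1per L μ)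
    (h' : IsSchemeStep L ε η A s M g φ' μ') (hφ' : MemH2per L φ') (hμ' : MemH1per L μ') :
    φ' = φ ∧ μ' = μ := by
  set d := φ' + (-1 : ℝ) • φ with hd
  set m := μ' + (-1 : ℝ) • μ with hm
  have hdm : MemH2per L d := hφ'.add hL (hφ.smul hL _)
  have hmm : MemH1per L m := hμ'.add (hμ.smul _)
  have hdz : MeanZero L d := by
    have h1 := h.meanZero_sub hL
    have h2 := h'.meanZero_sub hL
    rw [MeanZero, integral_add_coe, integral_smul_coe] at h1 h2 ⊢
    linarith
  -- Testing the difference of the mass balances with `m` shows `(d, m) ≤ 0`.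
  have hneg : inner ℝ d m ≤ 0 := by
    have h1 := h.inner_add hmm
    have h2 := h'.inner_add hmm
    have h3 := mobilityForm_add_smul hD hL hM hg hμ' hμ m (-1)
    rw [← hm, mobilityForm_comm M g m μ', mobilityForm_comm M g m μ] at h3
    have h4 := mul_nonneg hs.le (mobilityForm_self_nonneg (L := L) (g := g) hMpos m)
    rw [hd, inner_add_left, real_inner_smul_left]
    rw [h3] at h4
    linarith
  have hmon := implicitPart_strongly_monotone hD hL hη hA hφ' hφ
  have h1 := h.implicitPart_sub hdm
  have h2 := h'.implicitPart_sub hdm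
  have h3 : inner ℝ d m = inner ℝ μ' d - inner ℝ μ d := by
    rw [real_inner_comm, hm, inner_add_left, real_inner_smul_left]
    ring
  have hlap : ‖laplacian L d‖ = 0 := by
    have h4 : ε ^ 2 * ‖laplacian L d‖ ^ 2 ≤ 0 := by
      refine hmon.trans ?_
      rw [← hd]
      linarith
    have h5 : ‖laplacian L d‖ ^ 2 ≤ 0 := by
      by_contra! h6
      have := mul_pos (pow_pos hε 2) h6
      linarith
    exact pow_eq_zero_iff two_ne_zero |>.1 (le_antisymm h5 (sq_nonneg _))
  obtain ⟨C, -, hC⟩ := exists_laplacian_bound hL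
  have hd0 : d = 0 := by
    have := (hC d hdm hdz).1
    rw [hlap, mul_zero] at this
    exact norm_le_zero_iff.1 this
  have hφe : φ' = φ := by
    have := add_neg_one_smul_cancel φ' φ
    rw [← hd, hd0, add_zero] at this
    exact this.symm
  refine ⟨hφe, ?_⟩
  have hm0 : m = 0 := eq_zero_of_inner_H2 hL fun ψ hψ => by
    have h1 := h.implicitPart_sub hψ
    have h2 := h'.implicitPart_sub hψ
    rw [hφe] at h2
    rw [hm, inner_add_left, real_inner_smul_left]
    linarith
  have := add_neg_one_smul_cancel μ' μ
  rw [← hm, hm0, add_zero] at this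
  exact this.symm

/-- The energy does not increase along the scheme: the convex part is estimated by its tangent at
the new time, the explicit part by its tangent at the old time. -/
lemma IsSchemeStep.energy_le (hD : D < 4) (hL : ∀ i, 0 < L i) (hε : 0 < ε)
    (hη : 0 ≤ (ε ^ 2)⁻¹ + η) (hA : 1 ≤ A) (hs : 0 < s)
    (hMpos : ∀ r, 0 < M r) (hg : MemH2per L g) {φ μ : L2Box L}
    (h : IsSchemeStep L ε η A s M g φ μ) (hφ : MemH2per L φ) (hμ : MemH1per L μ) :
    energyFCH L ε η φ ≤ energyFCH L ε η g := by
  set d := φ + (-1 : ℝ) • g with hd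
  have hdm : MemH2per L d := hφ.add hL (hg.smul hL _)
  have e1 : g + d = φ := add_neg_one_smul_cancel φ g
  have e2 : φ + (-1 : ℝ) • d = g := by rw [hd, neg_one_smul, neg_one_smul]; abel
  have h1 := convexEnergy_tangent hD hL hη hA hφ (hdm.smul hL (-1))
  have h2 := explicitEnergy_tangent hD hL hε hη hA hg hdm
  rw [e2, hφ.implicitPart_neg hD hL ε η A hdm] at h1
  rw [e1] at h2
  have h3 := h.implicitPart_sub hdm
  -- Testing the mass balance with `μ` shows `(μ, d) ≤ 0`.
  have h4 := h.inner_add hμ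
  have h5 := mul_nonneg hs.le (mobilityForm_self_nonneg (L := L) (g := g) hMpos μ)
  have h6 : inner ℝ μ d = inner ℝ φ μ - inner ℝ g μ := by
    rw [real_inner_comm, hd, inner_add_left, real_inner_smul_left]
    ring
  have h7 : 0 ≤ ε ^ 2 / 2 * ‖laplacian L ((-1 : ℝ) • d)‖ ^ 2 := by positivity
  rw [hφ.energyFCH_eq hD hL hε η A, hg.energyFCH_eq hD hL hε η A]
  linarith

/-- Existence of a scheme step. The new state minimises, over the affine space of functions of
`H²_per(Ω)` with the mean value of `g`, the convex energy minus the explicit part plus the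
squared dual norm of the increment which is induced by the mobility. -/
lemma exists_isSchemeStep (hD : D < 4) (hL : ∀ i, 0 < L i) (hε : 0 < ε)
    (hη : 0 ≤ (ε ^ 2)⁻¹ + η) (hA : 1 ≤ A) (hs : 0 < s) (hM : Continuous M)
    (hMpos : ∀ r, 0 < M r) (hg : MemH2per L g) :
    ∃ φ μ : L2Box L, MemH2per L φ ∧ MemH1per L μ ∧ IsSchemeStep L ε η A s M g φ μ := by
  -- `W x` solves `s ∇·(M(g) ∇w) = x`.
  have hex : ∀ x : H2Zero hL, ∃ w : L2Box L, MemH1per L w ∧ MeanZero L w ∧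
      ∀ ν : L2Box L, MemH1per L ν → s * mobilityForm L M g w ν = -inner ℝ (x : L2Box L) ν :=
    fun x => exists_mobilityForm_solution hD hL hM hMpos hg hs x.2.2
  choose W hW1 hWm hW using hex
  let B : L2Box L → L2Box L → ℝ := mobilityForm L M g
  obtain ⟨c, hc, hcoer⟩ := exists_mobilityForm_coercive hD hL hM hMpos hg
  obtain ⟨P, hP, hpoin⟩ := exists_poincare hL
  obtain ⟨K, hK, hKb⟩ := exists_laplacian_bound hL
  have hmem : ∀ x : H2Zero hL, MemH2per L (g + (x : L2Box L)) := fun x => hg.add hL x.2.1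
  have hassoc : ∀ x h : H2Zero hL, g + ((x + h : H2Zero hL) : L2Box L)
      = g + (x : L2Box L) + (h : L2Box L) := fun x h => by
    rw [Submodule.coe_add, add_assoc]
  -- The dual norm is convex, with differential `-W x` at `x`.
  have hdual : ∀ x h : H2Zero hL, s / 2 * B (W x) (W x) - inner ℝ (h : L2Box L) (W x)
      ≤ s / 2 * B (W (x + h)) (W (x + h)) := fun x h => by
    have h1 := hW x (W x) (hW1 x)
    have h2 := hW (x + h) (W x) (hW1 x)
    have h3 := mobilityForm_self_add_smul hD hL hM hg (hW1 (x + h)) (hW1 x) (-1)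
    have h4 := mul_nonneg hs.le (mobilityForm_self_nonneg (L := L) (g := g) hMpos
      (W (x + h) + (-1 : ℝ) • W x))
    rw [h3] at h4
    rw [Submodule.coe_add, inner_add_left] at h2
    simp only [B]
    linarith
  -- The dual norm is bounded by the `L²` norm, by coercivity and the Poincaré inequality.
  have hdual_le : ∀ x : H2Zero hL, s / 2 * B (W x) (W x)
      ≤ ‖(x : L2Box L)‖ ^ 2 * P / (2 * (s * c)) := fun x => by
    have h1 := hW x (W x) (hW1 x)
    have h2 := hpoin (W x) (hW1 x) (hWm x)
    have h3 := mul_le_mul_of_nonneg_left (hcoer (W x)) hs.le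
    have h4 := neg_le_of_abs_le (abs_real_inner_le_norm (x : L2Box L) (W x))
    set q := s * mobilityForm L M g (W x) (W x) with hq
    have h5 : s * c * ‖W x‖ ^ 2 ≤ P * q := by
      calc s * c * ‖W x‖ ^ 2 ≤ s * c * (P * ∑ i, ‖weakPartial L i (W x)‖ ^ 2) := by gcongr
        _ = P * (s * (c * ∑ i, ‖weakPartial L i (W x)‖ ^ 2)) := by ring
        _ ≤ P * q := by gcongr
    have h6 : q ≤ ‖(x : L2Box L)‖ * ‖W x‖ := by linarith
    have h7 : s / 2 * B (W x) (W x) = q / 2 := by simp only [B, hq]; ring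
    rw [h7, le_div_iff₀ (by positivity)]
    have h8 : 0 ≤ q := mul_nonneg hs.le (mobilityForm_self_nonneg hMpos _)
    -- `q² (sc) ≤ ‖x‖² (sc) ‖W x‖² ≤ ‖x‖² P q`
    have h9 : q * (q * (s * c)) ≤ q * (‖(x : L2Box L)‖ ^ 2 * P) := by
      have h10 : q ^ 2 ≤ (‖(x : L2Box L)‖ * ‖W x‖) ^ 2 := pow_le_pow_left₀ h8 h6 2
      calc q * (q * (s * c)) = q ^ 2 * (s * c) := by ring
        _ ≤ (‖(x : L2Box L)‖ * ‖W x‖) ^ 2 * (s * c) := by gcongr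
        _ = ‖(x : L2Box L)‖ ^ 2 * (s * c * ‖W x‖ ^ 2) := by ring
        _ ≤ ‖(x : L2Box L)‖ ^ 2 * (P * q) := by gcongr
        _ = _ := by ring
    have hgoal : q / 2 * (2 * (s * c)) = q * (s * c) := by ring
    rw [hgoal]
    rcases h8.eq_or_lt with h0 | h0
    · rw [← h0, zero_mul]; positivity
    · exact le_of_mul_le_mul_left h9 h0
  have hexpl_smul : ∀ (h : H2Zero hL) (t : ℝ),
      explicitPart L ε η A g ((t • h : H2Zero hL) : L2Box L)
      = t * explicitPart L ε η A g h := fun h t => by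
    have h1 := hg.explicitPart_add_smul hD hL ε η A (memH2per_zero hL) h.2.1 t
    have h2 := hg.explicitPart_add_smul hD hL ε η A (memH2per_zero hL) (memH2per_zero hL) 1
    rw [smul_zero, add_zero] at h2
    rw [zero_add] at h1
    rw [Submodule.coe_smul]
    linarith
  have himpl_smul : ∀ (x h : H2Zero hL) (t : ℝ), implicitPart L ε η A (g + (x : L2Box L))
      ((t • h : H2Zero hL) : L2Box L) = t * implicitPart L ε η A (g + (x : L2Box L)) h :=
    fun x h t => by
      have h1 := (hmem x).implicitPart_add_smul hD hL ε η A (memH2per_zero hL) h.2.1 t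
      have h2 := (hmem x).implicitPart_add_smul hD hL ε η A (memH2per_zero hL)
        (memH2per_zero hL) 1
      rw [smul_zero, add_zero] at h2
      rw [zero_add] at h1
      rw [Submodule.coe_smul]
      linarith
  have hexpl_add : ∀ x h : H2Zero hL, explicitPart L ε η A g ((x + h : H2Zero hL) : L2Box L)
      = explicitPart L ε η A g x + explicitPart L ε η A g h := fun x h => by
    have := hg.explicitPart_add_smul hD hL ε η A x.2.1 h.2.1 1
    rwa [one_smul, one_mul] at this
  obtain ⟨x, hx⟩ := exists_critical_point (laplacianMap hL) (exists_tendsto_laplacianMap hL)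
    (fun x => convexEnergy L ε η A (g + (x : L2Box L)) - explicitPart L ε η A g x
      + s / 2 * B (W x) (W x))
    (fun x h => implicitPart L ε η A (g + (x : L2Box L)) h - explicitPart L ε η A g h
      - inner ℝ (h : L2Box L) (W x)) (c := ε ^ 2 / 2) (by positivity)
    (fun x h => by
      have h1 := convexEnergy_tangent hD hL hη hA (hmem x) h.2.1
      have h2 := hdual x h
      have h3 : laplacianMap hL h = laplacian L (h : L2Box L) := rfl
      rw [hexpl_add, hassoc, h3]
      linarith)
    (fun x => by
      obtain ⟨C1, hC1⟩ := exists_convexEnergy_bound hD hL hη hA (hmem x)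
      obtain ⟨C2, hC2⟩ := exists_explicitEnergy_bound hD hL ε η A hg
      refine ⟨C1 - explicitPart L ε η A g x + (C2 - explicitEnergy L ε η A g)
        + (‖(x : L2Box L)‖ + K) ^ 2 * P / (2 * (s * c)), fun h hh => ?_⟩
      have hh' : ‖laplacian L (h : L2Box L)‖ ≤ 1 := hh
      have h1 := hC1 h h.2.1 h.2.2 hh'
      have hneg : ‖laplacian L ((-1 : ℝ) • h : H2Zero hL)‖ ≤ 1 := by
        rw [Submodule.coe_smul, laplacian_smul hL h.2.1, norm_smul, norm_neg, norm_one, one_mul]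
        exact hh'
      -- The linear term is bounded above through the tangent of the explicit energy at `g` in the
      -- direction `-h`.
      have h2 := hC2 ((-1 : ℝ) • h : H2Zero hL) ((-1 : ℝ) • h).2.1 ((-1 : ℝ) • h).2.2 hneg
      have h3 := explicitEnergy_tangent hD hL hε hη hA hg ((-1 : ℝ) • h).2.1
      rw [hexpl_smul] at h3
      have h4 := hdual_le (x + h)
      have h5 : ‖((x + h : H2Zero hL) : L2Box L)‖ ≤ ‖(x : L2Box L)‖ + K := by
        rw [Submodule.coe_add]
        refine (norm_add_le _ _).trans (add_le_add le_rfl ?_)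
        exact (hKb h h.2.1 h.2.2).1.trans (mul_le_of_le_one_right hK.le hh')
      have h6 : ‖((x + h : H2Zero hL) : L2Box L)‖ ^ 2 * P / (2 * (s * c))
          ≤ (‖(x : L2Box L)‖ + K) ^ 2 * P / (2 * (s * c)) := by gcongr
      rw [hexpl_add, hassoc]
      linarith)
    (fun x h t => by
      rw [himpl_smul, hexpl_smul, Submodule.coe_smul, real_inner_smul_left]
      ring)
    (fun x h => by
      -- Along a line the pairing with `W` is affine, by the symmetry of the form.
      have hlin : ∀ t : ℝ, inner ℝ (h : L2Box L) (W (x + t • h))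
          = inner ℝ (x : L2Box L) (W h) + t * inner ℝ (h : L2Box L) (W h) := fun t => by
        have h1 := hW h (W (x + t • h)) (hW1 _)
        have h2 := hW (x + t • h) (W h) (hW1 _)
        rw [mobilityForm_comm, h1, Submodule.coe_add, Submodule.coe_smul, inner_add_left,
          real_inner_smul_left] at h2
        linarith
      have h3 := continuousAt_implicitPart hD hL ε η A (hmem x) h.2.1
      simp only [hlin]
      have h4 : (fun t : ℝ => implicitPart L ε η A (g + ((x + t • h : H2Zero hL) : L2Box L)) h)
          = fun t : ℝ => implicitPart L ε η A (g + (x : L2Box L) + t • (h : L2Box L)) h := by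
        funext t
        rw [hassoc, Submodule.coe_smul]
      exact ((h4 ▸ h3).sub continuousAt_const).sub
        (Continuous.continuousAt (by fun_prop)))
  -- The Lagrange multiplier of the mass constraint is fixed by testing with constants.
  set φ := g + (x : L2Box L) with hφ
  set κ := (boxVolume L)⁻¹ * (implicitPart L ε η A φ (constLp L 1)
    - explicitPart L ε η A g (constLp L 1) - inner ℝ (W x) (constLp L 1)) with hκ
  have hV := boxVolume_pos hL
  refine ⟨φ, W x + constLp L κ, hmem x, (hW1 x).add (memH1per_const hL κ), ?_, ?_⟩
  · intro ν hν
    have h1 := hW x ν hν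
    have h2 : mobilityForm L M g (W x + constLp L κ) ν = mobilityForm L M g (W x) ν := by
      have := mobilityForm_add_smul hD hL hM hg (hW1 x) (memH1per_const hL κ) ν 1
      rw [one_smul, mobilityForm_const hL, mul_zero, add_zero] at this
      rw [mobilityForm_comm, this, mobilityForm_comm]
    change _ + s * mobilityForm L M g (W x + constLp L κ) ν = _
    rw [integral_mul_eq_inner, integral_mul_eq_inner, h2, h1, hφ, inner_add_left]
    ring
  · intro ψ hψ
    have hc1 := memH2per_const (L := L) hL (-mean ψ)
    have hψ0 : ψ + constLp L (-mean ψ) ∈ H2Zero hL :=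
      ⟨hψ.add hL hc1, meanZero_add_const hL ψ⟩
    have h0 := hx ⟨_, hψ0⟩
    simp only at h0
    have hconst : constLp L (-mean ψ) = (-mean ψ) • constLp L 1 := by
      refine Lp.ext ?_
      filter_upwards [coeFn_constLp (L := L) (-mean ψ), coeFn_constLp (L := L) 1,
        Lp.coeFn_smul (-mean ψ) (constLp L 1)] with y h1 h2 h3
      rw [h1, h3, Pi.smul_apply, h2, smul_eq_mul, mul_one]
    have hone := memH2per_const (L := L) hL 1
    rw [hconst, (hmem x).implicitPart_add_smul hD hL ε η A hψ hone,
      hg.explicitPart_add_smul hD hL ε η A hψ hone, inner_add_left, real_inner_smul_left] at h0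
    rw [integral_mul_eq_inner, inner_add_left]
    have h5 : inner ℝ (constLp L κ) ψ = mean ψ * (boxVolume L * κ) := by
      rw [real_inner_comm, inner_constLp, mean]
      field_simp
    have h6 : boxVolume L * κ = implicitPart L ε η A φ (constLp L 1)
        - explicitPart L ε η A g (constLp L 1) - inner ℝ (W x) (constLp L 1) := by
      rw [hκ, mul_inv_cancel_left₀ hV.ne']
    rw [h5, h6, real_inner_comm ψ (W x)]
    rw [real_inner_comm (W x) (constLp L 1), ← hφ] at h0
    linarith

end Scheme

end FCH

theorem mainTheorem2 (D : ℕ) (hD : D = 2 ∨ D = 3) (L : Fin D → ℝ) (hL : ∀ i, 0 < L i)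
    (ε η A s : ℝ) (hε : 0 < ε) (hη : 0 ≤ (ε ^ 2)⁻¹ + η) (hA : 1 ≤ A) (hs : 0 < s)
    (M : ℝ → ℝ) (hMcont : Continuous M) (hMpos : ∀ r, 0 < M r)
    (φk : FCH.L2Box L) (hφk : FCH.MemH2per L φk) :
    ∃ φ μ : FCH.L2Box L,
      FCH.MemH2per L φ ∧ FCH.MemH1per L μ ∧
      FCH.IsSchemeStep L ε η A s M φk φ μ ∧
      (∀ φ' μ' : FCH.L2Box L, FCH.MemH2per L φ' → FCH.MemH1per L μ' →
        FCH.IsSchemeStep L ε η A s M φk φ' μ' → φ' = φ ∧ μ' = μ) ∧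
      FCH.energyFCH L ε η φ ≤ FCH.energyFCH L ε η φk := by
  have hD4 : D < 4 := by omega
  obtain ⟨φ, μ, hφ, hμ, hstep⟩ :=
    FCH.exists_isSchemeStep (s := s) hD4 hL hε hη hA hs hMcont hMpos hφk
  exact ⟨φ, μ, hφ, hμ, hstep, fun φ' μ' hφ' hμ' hstep' =>
    hstep.unique hD4 hL hε hη hA hs hMcont hMpos hφk hφ hμ hstep' hφ' hμ',
    hstep.energy_le hD4 hL hε hη hA hs hMpos hφk hφ hμ⟩
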